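/- **Setting.** Let $f:\mathbb R\to\mathbb R$ be a stationary centered Gaussian process with correlation function $\kappa(x)=\mathbb E[f(0)f(x)]$, normalized by $\kappa(0)=1=-\kappa''(0)$, and such that $\kappa(x)\to0$ as $x\to+\infty$. We say that $f$ is of class $\mathcal C^p$ if its trajectories are almost surely of class $\mathcal C^p$. For a non-empty finite set $A$, let $\Delta_A=\{x\in\mathbb R^A\mid \exists a\neq b,\ x_a=x_b\}$ be the large diagonal, and let $\Delta_k=\Delta_{\{1,\dots,k\}}$. *Kac–Rice density.* For $k\ge1$ and $x\in\mathbb R^k$ let $D_k(x)=\det\operatorname{Var}(f(x_1),\dots,f(x_k))$ and, if $D_k(x)\ne0$, $$\rho_k(x)=\frac{\mathbb E\big[\prod_{i=1}^k|f'(x_i)|\ \big|\ f(x_1)=\dots=f(x_k)=0\big]}{(2\pi)^{k/2}D_k(x)^{1/2}}.$$ *Divided differences.* For $x\in\mathbb R^p$ and $g\in\mathcal C^{p-1}(\mathbb R)$, let $c_i(x)$ be the number of $j<i$ with $x_j=x_i$. The divided difference $[g]_p(x)$ is the coefficient of degree $p-1$ of the unique polynomial $\pi$ of degree at most $p-1$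 such that $\pi^{(c_i(x))}(x_i)=g^{(c_i(x))}(x_i)$ for all $1\le i\le p$. *Densities associated with a partition.* Let $A$ be a non-empty finite set, let $\mathcal I$ be a partition of $A$ into non-empty blocks, and let $x\in\mathbb R^A$. Write $\underline x_I=(x_i)_{i\in I}$, after choosing an ordering $I=\{i_1,\dots,i_m\}$ of each block. Let $\mathrm{ev}^{\mathcal I}_x(f)$ be the random vector formed by all $[f]_j(x_{i_1},\dots,x_{i_j})$, $1\le j\le |I|$, $I\in\mathcal I$, and let $D_{\mathcal I}(x)=\det\operatorname{Var}(\mathrm{ev}^{\mathcal I}_x(f))$. If $D_{\mathcal I}(x)\neq0$, let $$N_{\mathcal I}(x)=\mathbb E\Big[\prod_{I\in\mathcal I}\prod_{i\in I}\big|[f]_{|I|+1}(\underline x_I,x_i)\big|\ \Big|\ \mathrm{ev}^{\mathcal I}_x(f)=0\Big],\qquad \rho_{\mathcal I}(x)=\Big(\prod_{I\in\mathcal I}\ \prod_{(i,j)\in I^2,\,i\ne j}|x_i-x_j|^{1/2}\Big)\frac{N_{\mathcal I}(x)}{(2\pi)^{|A|/2}D_{\mathcal I}(x)^{1/2}}.$$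 Conditional expectations given $X=0$, with $X$ a non-degenerate Gaussian vector, are the value at $u=0$ of the continuous version of $u\mapsto\mathbb E[\,\cdot\mid X=u]$. **Proposition (Equality of Kac–Rice densities).** 1. Let $A$ be a non-empty finite set and assume that $f$ is of class $\mathcal C^{|A|}$. Then $\rho_{\{A\}}$ is a well-defined continuous map from $\mathbb R^A$ to $\mathbb R$. For all $x\in\mathbb R^A$ and every partition $\mathcal I$ of $A$ such that $D_{\mathcal I}(x)\ne0$, the quantity $\rho_{\mathcal I}(x)$ is well-defined and $\rho_{\{A\}}(x)=\rho_{\mathcal I}(x)$, whatever orderings of the blocks are chosen on either side. Moreover, $\rho_{\{A\}}(x)=0$ if and only if $x\in\Delta_A$. 2. Let $k\ge1$ and assume that $f$ is of class $\mathcal C^k$. Then $D_k(x)\ne0$ if and only if $x\notin\Delta_k$, and $\rho_k$, which is thus defined on $\mathbb R^k\setminus\Delta_k$, has a unique continuous extension to $\mathbb R^k$. The vanishing locus of this extension is exactly $\Delta_k$. For all $x\in\mathbb R^k$ and every partition $\mathcal I$ of $\{1,\dots,k\}$ such that $D_{\mathcal I}(x)\ne0$, the extension takes the value $\rho_{\mathcal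 I}(x)$ at $x$, for any choice of orderings of the blocks. -/

import Mathlib

open MeasureTheory ProbabilityTheory Filter Topology

namespace KacRice

noncomputable section

/-! ### Gaussian processes on the real line -/

/-- `f` is a centered Gaussian process indexed by `ℝ` that is stationary: for every `t`, the
process `s ↦ f (s + t)` has the same finite-dimensional distributions as `f`. -/
structure IsStationaryCenteredGaussian {Ω : Type*} [MeasurableSpace Ω]
    (f : ℝ → Ω → ℝ) (P : Measure Ω) : Prop where
  gaussian : IsGaussianProcess f P
  centered : ∀ t, ∫ ω, f t ω ∂P = 0
  stationary : ∀ (t : ℝ) (S : Finset ℝ),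
    P.map (fun ω (s : S) => f (s + t) ω) = P.map (fun ω (s : S) => f s ω)

/-- The correlation function `κ x = E[f(0) f(x)]`. -/
def corr {Ω : Type*} [MeasurableSpace Ω] (f : ℝ → Ω → ℝ) (P : Measure Ω) (x : ℝ) : ℝ :=
  ∫ ω, f 0 ω * f x ω ∂P

/-- Normalization: `κ 0 = 1 = -κ'' 0`. -/
def IsNormalized {Ω : Type*} [MeasurableSpace Ω] (f : ℝ → Ω → ℝ) (P : Measure Ω) : Prop :=
  corr f P 0 = 1 ∧ iteratedDeriv 2 (corr f P) 0 = -1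

/-- The trajectories are almost surely of class `C^n`. -/
def IsOfClass {Ω : Type*} [MeasurableSpace Ω] (n : ℕ) (f : ℝ → Ω → ℝ) (P : Measure Ω) : Prop :=
  ∀ᵐ ω ∂P, ContDiff ℝ n (fun t => f t ω)

/-- The trajectory `t ↦ f t ω`. -/
def path {Ω : Type*} (f : ℝ → Ω → ℝ) (ω : Ω) : ℝ → ℝ := fun t => f t ω

/-! ### Conditional expectation given a vanishing random vector -/

/-- `g` is a continuous version of `u ↦ E[Z | X = u]`: a continuous function such that
`E[Z 1_{X ∈ B}] = ∫_B g d(law of X)` for every Borel set `B`. -/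
structure IsContCondExp {Ω ι : Type*} [MeasurableSpace Ω] [Fintype ι] (P : Measure Ω)
    (X : Ω → ι → ℝ) (Z : Ω → ℝ) (g : (ι → ℝ) → ℝ) : Prop where
  aemeasurable : AEMeasurable X P
  integrable : Integrable Z P
  continuous : Continuous g
  integrable_map : Integrable g (P.map X)
  setIntegral_eq : ∀ B : Set (ι → ℝ), MeasurableSet B →
    ∫ ω in X ⁻¹' B, Z ω ∂P = ∫ u in B, g u ∂(P.map X)

open Classical in
/-- `E[Z | X = 0]`: the value at `0` of the continuous version of `u ↦ E[Z | X = u]`. It is unique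
as soon as the law of `X` has full support, e.g. when `X` is a non-degenerate Gaussian vector.
(The value is `0` by convention if there is no continuous version.) -/
def condExpZero {Ω ι : Type*} [MeasurableSpace Ω] [Fintype ι] (P : Measure Ω)
    (X : Ω → ι → ℝ) (Z : Ω → ℝ) : ℝ :=
  if h : ∃ g, IsContCondExp P X Z g then h.choose 0 else 0

/-- The determinant of the variance matrix of the random vector `X`. -/
def varDet {Ω ι : Type*} [MeasurableSpace Ω] [Fintype ι] [DecidableEq ι] (P : Measure Ω)
    (X : Ω → ι → ℝ) : ℝ :=
  (Matrix.of fun i j => covariance (fun ω => X ω i) (fun ω => X ω j) P).det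

/-! ### The large diagonal and the classical density -/

/-- The large diagonal of `ℝ^A`. -/
def largeDiagonal (A : Type*) : Set (A → ℝ) := {x | ∃ a b, a ≠ b ∧ x a = x b}

/-- `D_k(x) = det Var(f(x_1), …, f(x_k))`. -/
def krD {Ω : Type*} [MeasurableSpace Ω] (f : ℝ → Ω → ℝ) (P : Measure Ω) {k : ℕ}
    (x : Fin k → ℝ) : ℝ :=
  varDet P (fun ω i => f (x i) ω)

/-- `N_k(x) = E[|f'(x_1)| ⋯ |f'(x_k)| | f(x_1) = ⋯ = f(x_k) = 0]`, meaningful if `D_k(x) ≠ 0`. -/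
def krN {Ω : Type*} [MeasurableSpace Ω] (f : ℝ → Ω → ℝ) (P : Measure Ω) {k : ℕ}
    (x : Fin k → ℝ) : ℝ :=
  condExpZero P (fun ω i => f (x i) ω) (fun ω => ∏ i, |deriv (path f ω) (x i)|)

/-- The Kac–Rice density `ρ_k(x) = N_k(x) / ((2π)^{k/2} D_k(x)^{1/2})`,
meaningful if `D_k(x) ≠ 0`. -/
def krDensity {Ω : Type*} [MeasurableSpace Ω] (f : ℝ → Ω → ℝ) (P : Measure Ω) {k : ℕ}
    (x : Fin k → ℝ) : ℝ :=
  krN f P x / ((2 * Real.pi) ^ ((k : ℝ) / 2) * √(krD f P x))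

/-! ### Hermite interpolation and divided differences -/

/-- `c_i(x)`, the number of indices `j < i` such that `x_j = x_i`. -/
def priorCount {p : ℕ} (x : Fin p → ℝ) (i : Fin p) : ℕ :=
  (Finset.univ.filter fun j => j < i ∧ x j = x i).card

/-- The evaluation map `ev_x(g) = (g^{(c_i(x))}(x_i) / c_i(x)!)_i`. -/
def evalMap {p : ℕ} (x : Fin p → ℝ) (g : ℝ → ℝ) (i : Fin p) : ℝ :=
  iteratedDeriv (priorCount x i) g (x i) / ((priorCount x i).factorial : ℝ)

theorem iteratedDeriv_polynomial (n : ℕ) (Q : Polynomial ℝ) :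
    iteratedDeriv n (fun t => Q.eval t) = fun t => (Polynomial.derivative^[n] Q).eval t := by
  induction n generalizing Q with
  | zero => simp
  | succ n ih =>
    rw [iteratedDeriv_succ', Function.iterate_succ_apply, ← ih]
    congr 1
    funext t
    exact Q.deriv

theorem exists_priorCount_eq {p : ℕ} (x : Fin p → ℝ) (y : ℝ) (m : ℕ)
    (hm : m < (Finset.univ.filter fun j => x j = y).card) :
    ∃ i, x i = y ∧ priorCount x i = m := by
  set S := Finset.univ.filter fun j => x j = y with hS
  have hmaps : Set.MapsTo (priorCount x) S (Finset.range S.card) := by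
    intro i hi
    have hi' : x i = y := by simpa [hS] using hi
    simp only [Finset.coe_range, Set.mem_Iio]
    apply Finset.card_lt_card
    refine (Finset.ssubset_iff_of_subset ?_).2 ⟨i, by simpa [hS] using hi', by simp⟩
    intro j hj
    simp only [Finset.mem_filter, Finset.mem_univ, true_and] at hj
    simp [hS, hj.2, hi']
  have hlt : ∀ i ∈ S, ∀ j ∈ S, i < j → priorCount x i < priorCount x j := by
    intro i hi j hj hij
    have hi' : x i = y := by simpa [hS] using hi
    have hj' : x j = y := by simpa [hS] using hj
    apply Finset.card_lt_card
    refine (Finset.ssubset_iff_of_subset ?_).2 ⟨i, by simp [hij, hi', hj'], by simp⟩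
    intro l hl
    simp only [Finset.mem_filter, Finset.mem_univ, true_and] at hl ⊢
    exact ⟨hl.1.trans hij, by rw [hl.2, hi', hj']⟩
  have hinj : Set.InjOn (priorCount x) S := by
    intro i hi j hj hij
    rcases lt_trichotomy i j with h | h | h
    · exact absurd hij (hlt i hi j hj h).ne
    · exact h
    · exact absurd hij (hlt j hj i hi h).ne'
  have hsurj := Finset.surjOn_of_injOn_of_card_le (priorCount x) hmaps hinj (by simp)
  obtain ⟨i, hi, him⟩ := hsurj (by simpa using hm : m ∈ (Finset.range S.card : Set ℕ))
  exact ⟨i, by simpa [hS] using hi, him⟩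

theorem eq_zero_of_evalMap_eq_zero {p : ℕ} (x : Fin p → ℝ) (Q : Polynomial ℝ)
    (hdeg : Q.degree < p) (h : evalMap x (fun t => Q.eval t) = 0) : Q = 0 := by
  classical
  by_contra hQ
  have hle : Multiset.map x Finset.univ.val ≤ Q.roots := by
    rw [Multiset.le_iff_count]
    intro y
    rw [Polynomial.count_roots, Multiset.count_map]
    set N := (Multiset.filter (fun j => y = x j) Finset.univ.val).card with hN
    have hN' : N = (Finset.univ.filter fun j => x j = y).card := by
      simp [hN, Finset.card_def, eq_comm]
    rcases Nat.eq_zero_or_pos N with h0 | hpos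
    · omega
    have key : N - 1 < Q.rootMultiplicity y := by
      apply Polynomial.lt_rootMultiplicity_of_isRoot_iterate_derivative hQ
      intro m hm
      obtain ⟨i, hi, him⟩ := exists_priorCount_eq x y m (by omega)
      have := congrFun h i
      simp only [evalMap, iteratedDeriv_polynomial, Pi.zero_apply, div_eq_zero_iff] at this
      rw [him, hi] at this
      rcases this with h1 | h1
      · exact h1
      · exact absurd h1 (by exact_mod_cast Nat.factorial_ne_zero m)
    omega
  have h1 := Multiset.card_le_card hle
  have h2 := Q.card_roots'
  have h3 : Q.natDegree < p := (Polynomial.natDegree_lt_iff_degree_lt hQ).2 hdeg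
  simp at h1
  omega

/-- Existence and uniqueness of the Hermite interpolation polynomial. -/
theorem existsUnique_hermite {p : ℕ} (x : Fin p → ℝ) (g : ℝ → ℝ) :
    ∃! Q : Polynomial ℝ, Q.degree < p ∧ evalMap x (fun t => Q.eval t) = evalMap x g := by
  let T : Polynomial.degreeLT ℝ p →ₗ[ℝ] (Fin p → ℝ) :=
    { toFun := fun Q => evalMap x (fun t => (Q : Polynomial ℝ).eval t)
      map_add' := fun Q R => by
        funext i
        simp only [evalMap, Submodule.coe_add, iteratedDeriv_polynomial, Pi.add_apply]
        rw [iterate_map_add, Polynomial.eval_add, add_div]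
      map_smul' := fun c Q => by
        funext i
        simp [evalMap, iteratedDeriv_polynomial, mul_div_assoc] }
  have hinj : Function.Injective T := by
    rw [← LinearMap.ker_eq_bot, LinearMap.ker_eq_bot']
    intro Q hQ
    exact Subtype.ext (eq_zero_of_evalMap_eq_zero x Q (Polynomial.mem_degreeLT.1 Q.2) hQ)
  have hfin : Module.finrank ℝ (Polynomial.degreeLT ℝ p) = Module.finrank ℝ (Fin p → ℝ) :=
    (Polynomial.degreeLTEquiv ℝ p).finrank_eq
  have : FiniteDimensional ℝ (Polynomial.degreeLT ℝ p) :=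
    (Polynomial.degreeLTEquiv ℝ p).symm.finiteDimensional
  have hsurj : Function.Surjective T :=
    (LinearMap.injective_iff_surjective_of_finrank_eq_finrank hfin).1 hinj
  obtain ⟨Q, hQ⟩ := hsurj (evalMap x g)
  refine ⟨Q, ⟨Polynomial.mem_degreeLT.1 Q.2, hQ⟩, ?_⟩
  rintro R ⟨hR, hR'⟩
  have : (⟨R, Polynomial.mem_degreeLT.2 hR⟩ : Polynomial.degreeLT ℝ p) = Q :=
    hinj (hR'.trans hQ.symm)
  exact congrArg Subtype.val this

/-- The Hermite interpolation polynomial of `g` at `x ∈ ℝ^p`: the polynomial of degree at most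
`p - 1` with the same image as `g` under `ev_x`. -/
def hermite {p : ℕ} (g : ℝ → ℝ) (x : Fin p → ℝ) : Polynomial ℝ :=
  (existsUnique_hermite x g).choose

/-- The divided difference `[g]_p(x)`, i.e. the coefficient of degree `p - 1` of the Hermite
interpolation polynomial (used for `p ≥ 1`). -/
def divDiff {p : ℕ} (g : ℝ → ℝ) (x : Fin p → ℝ) : ℝ := (hermite g x).coeff (p - 1)

/-! ### Densities associated with a partition

The bijection `e : A ≃ Fin n` encodes an ordering of the finite set `A`, which induces an ordering
of every block of a partition of `A`. -/

/-- The increasing enumeration of `S ⊆ A` for the ordering `e`. -/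
def enum {A : Type*} {n : ℕ} (e : A ≃ Fin n) (S : Finset A) (j : Fin S.card) : A :=
  e.symm ((S.map e.toEmbedding).orderEmbOfFin (Finset.card_map _) j)

/-- The map `ev_x^𝓘`. If `I = {i_1, …, i_m}` (in increasing order) is a block of `𝓘` and `a = i_j`,
then the component of index `a` is `[g]_j(x_{i_1}, …, x_{i_j})`. -/
def evPartition {A : Type*} [Fintype A] [DecidableEq A] {n : ℕ} (e : A ≃ Fin n)
    (𝓘 : Finpartition (Finset.univ : Finset A)) (x : A → ℝ) (g : ℝ → ℝ) (a : A) : ℝ :=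
  divDiff g (fun j => x (enum e ((𝓘.part a).filter fun b => e b ≤ e a) j))

/-- `D_𝓘(x) = det Var(ev_x^𝓘(f))`. -/
def partD {Ω A : Type*} [MeasurableSpace Ω] [Fintype A] [DecidableEq A] {n : ℕ}
    (f : ℝ → Ω → ℝ) (P : Measure Ω) (e : A ≃ Fin n)
    (𝓘 : Finpartition (Finset.univ : Finset A)) (x : A → ℝ) : ℝ :=
  varDet P (fun ω => evPartition e 𝓘 x (path f ω))

/-- The random variable `∏_{I ∈ 𝓘} ∏_{i ∈ I} |[f]_{|I|+1}(x_I, x_i)|`. -/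
def partProd {Ω A : Type*} [Fintype A] [DecidableEq A] {n : ℕ}
    (f : ℝ → Ω → ℝ) (e : A ≃ Fin n)
    (𝓘 : Finpartition (Finset.univ : Finset A)) (x : A → ℝ) (ω : Ω) : ℝ :=
  ∏ I ∈ 𝓘.parts, ∏ i ∈ I,
    |divDiff (path f ω) (Fin.snoc (α := fun _ => ℝ) (fun j => x (enum e I j)) (x i))|

/-- `N_𝓘(x) = E[∏_{I ∈ 𝓘} ∏_{i ∈ I} |[f]_{|I|+1}(x_I, x_i)| | ev_x^𝓘(f) = 0]`,
meaningful if `D_𝓘(x) ≠ 0`. -/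
def partN {Ω A : Type*} [MeasurableSpace Ω] [Fintype A] [DecidableEq A] {n : ℕ}
    (f : ℝ → Ω → ℝ) (P : Measure Ω) (e : A ≃ Fin n)
    (𝓘 : Finpartition (Finset.univ : Finset A)) (x : A → ℝ) : ℝ :=
  condExpZero P (fun ω => evPartition e 𝓘 x (path f ω)) (partProd f e 𝓘 x)

/-- The density `ρ_𝓘(x)`, meaningful if `D_𝓘(x) ≠ 0`. -/
def partDensity {Ω A : Type*} [MeasurableSpace Ω] [Fintype A] [DecidableEq A] {n : ℕ}
    (f : ℝ → Ω → ℝ) (P : Measure Ω) (e : A ≃ Fin n)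
    (𝓘 : Finpartition (Finset.univ : Finset A)) (x : A → ℝ) : ℝ :=
  (∏ I ∈ 𝓘.parts, ∏ q ∈ I.offDiag, √|x q.1 - x q.2|) *
    (partN f P e 𝓘 x / ((2 * Real.pi) ^ ((Fintype.card A : ℝ) / 2) * √(partD f P e 𝓘 x)))

/-- `ρ_𝓘(x)` is well-defined: `D_𝓘(x) ≠ 0`, and `u ↦ E[⋯ | ev_x^𝓘(f) = u]` has exactly one
continuous version. -/
def PartDensityDefined {Ω A : Type*} [MeasurableSpace Ω] [Fintype A] [DecidableEq A] {n : ℕ}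
    (f : ℝ → Ω → ℝ) (P : Measure Ω) (e : A ≃ Fin n)
    (𝓘 : Finpartition (Finset.univ : Finset A)) (x : A → ℝ) : Prop :=
  partD f P e 𝓘 x ≠ 0 ∧
    ∃! g, IsContCondExp P (fun ω => evPartition e 𝓘 x (path f ω)) (partProd f e 𝓘 x) g

/-- The one-block partition `{A}`. -/
def oneBlock (A : Type*) [Fintype A] [DecidableEq A] [Nonempty A] :
    Finpartition (Finset.univ : Finset A) :=
  Finpartition.indiscrete (Finset.univ_nonempty.ne_empty)

end

end KacRice

namespace KacRice

/-! ### Divided differences -/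

/-! Off the large diagonal, passing to divided differences is a linear change of variables. For
distinct points, `ev_x^𝓘(f)` is a triangular matrix applied to the values of f, with determinant
V⁻¹, where V is the product of the differences over the pairs lying in a common block. Modulo these
values, [f]_{|I|+1}(x_I, x_i) is f'(x_i) divided by the product of x_i - x_j over the other j in I.
The numerator therefore acquires the factor V⁻², the square root of the determinant the factor
|V|⁻¹, and the prefactor of ρ_𝓘 is |V|. Everything cancels, so every ρ_𝓘, for every ordering, is the
classical density there (`partDensity_of_injective`).

The one-block density is what extends across the diagonal. Divided differences are continuous in the
nodes, confluent or not (`continuous_divDiff_family`). In a Gaussian space almost sure convergence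
already forces convergence of variances (`exists_map_eq_gaussianReal_of_tendsto`), hence of
covariances, of regression residuals and of the moments that occur. So the density is continuous
wherever the covariance stays invertible (`tendsto_condExpZero_prod_abs`).

The heart is thus non-degeneracy: the successive divided differences of f along any finite sequence
of points are linearly independent in L² (`eq_zero_of_integral_sum_divDiff_sq`). By Bochner's
theorem κ is the Fourier transform of a probability measure μ, and the variance of Λ(f), for a
linear functional Λ, is the μ-integral of |Λ(e^{iξ·})|². Since κ tends to 0, μ has no atom, by a
Wiener-type argument. If the variance vanishes, the real-analytic function ξ ↦ Λ(e^{iξ·}) vanishes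
μ-almost everywhere. It then vanishes identically, for its zero set would otherwise be countable and
so μ-null. Its derivatives at 0 say that Λ kills all monomials, on which divided differences act
triangularly; so Λ = 0. With |A| points this gives D_{A} ≠ 0, with |A| + 1 points it gives N_{A} >
0, and ρ_{A} vanishes exactly where |V| does.

On the diagonal, D_𝓘 is D_{A} times the square of the product of the differences across blocks
(`partD_eq_mul_partD_oneBlock`). If D_𝓘 ≠ 0, coincidences occur only inside blocks, so the prefactor
of ρ_𝓘 vanishes and both densities are 0. -/

theorem hermite_degree {p : ℕ} (g : ℝ → ℝ) (x : Fin p → ℝ) : (hermite g x).degree < p :=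
  (existsUnique_hermite x g).choose_spec.1.1

theorem evalMap_hermite {p : ℕ} (g : ℝ → ℝ) (x : Fin p → ℝ) :
    evalMap x (fun t => (hermite g x).eval t) = evalMap x g :=
  (existsUnique_hermite x g).choose_spec.1.2

theorem hermite_eq {p : ℕ} {g : ℝ → ℝ} {x : Fin p → ℝ} {Q : Polynomial ℝ}
    (hdeg : Q.degree < p) (h : evalMap x (fun t => Q.eval t) = evalMap x g) :
    hermite g x = Q :=
  (existsUnique_hermite x g).unique ⟨hermite_degree g x, evalMap_hermite g x⟩ ⟨hdeg, h⟩

theorem hermite_polynomial {p : ℕ} {x : Fin p → ℝ} {Q : Polynomial ℝ} (hdeg : Q.degree < p) :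
    hermite (fun t => Q.eval t) x = Q :=
  hermite_eq hdeg rfl

theorem divDiff_cast {p q : ℕ} (h : p = q) (g : ℝ → ℝ) (x : Fin p → ℝ) (y : Fin q → ℝ)
    (hxy : ∀ i, x i = y (Fin.cast h i)) : divDiff g x = divDiff g y := by
  subst h
  congr 1
  exact funext hxy

/-- The divided difference is a linear function of the evaluation map. -/
theorem exists_divDiff_eq_sum {p : ℕ} (x : Fin p → ℝ) :
    ∃ w : Fin p → ℝ, ∀ g : ℝ → ℝ, divDiff g x = ∑ i, w i * evalMap x g i := by
  let T : Polynomial.degreeLT ℝ p →ₗ[ℝ] (Fin p → ℝ) :=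
    { toFun := fun Q => evalMap x (fun t => (Q : Polynomial ℝ).eval t)
      map_add' := fun Q R => by
        funext i
        simp only [evalMap, Submodule.coe_add, iteratedDeriv_polynomial, Pi.add_apply]
        rw [iterate_map_add, Polynomial.eval_add, add_div]
      map_smul' := fun c Q => by
        funext i
        simp [evalMap, iteratedDeriv_polynomial, mul_div_assoc] }
  have hinj : LinearMap.ker T = ⊥ := by
    rw [LinearMap.ker_eq_bot']
    intro Q hQ
    exact Subtype.ext (eq_zero_of_evalMap_eq_zero x Q (Polynomial.mem_degreeLT.1 Q.2) hQ)
  obtain ⟨S, hS⟩ := LinearMap.exists_leftInverse_of_injective T hinj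
  let φ : (Fin p → ℝ) →ₗ[ℝ] ℝ :=
    (Polynomial.lcoeff ℝ (p - 1)).comp ((Polynomial.degreeLT ℝ p).subtype.comp S)
  refine ⟨fun i => φ (Pi.single i 1), fun g => ?_⟩
  have h1 : divDiff g x = φ (evalMap x g) := by
    have : S (evalMap x g) = ⟨hermite g x, Polynomial.mem_degreeLT.2 (hermite_degree g x)⟩ := by
      rw [← evalMap_hermite g x]
      exact LinearMap.congr_fun hS ⟨hermite g x, Polynomial.mem_degreeLT.2 (hermite_degree g x)⟩
    simp [φ, this, divDiff]
  rw [h1]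
  conv_lhs => rw [← Finset.univ_sum_single (evalMap x g)]
  rw [map_sum]
  refine Finset.sum_congr rfl fun i _ => ?_
  have : (Pi.single i (evalMap x g i) : Fin p → ℝ)
      = evalMap x g i • (Pi.single i 1 : Fin p → ℝ) := by
    rw [← Pi.single_smul, smul_eq_mul, mul_one]
  rw [this, map_smul, smul_eq_mul, mul_comm]

theorem priorCount_of_injective {p : ℕ} {x : Fin p → ℝ} (hx : Function.Injective x) (i : Fin p) :
    priorCount x i = 0 := by
  rw [priorCount, Finset.card_eq_zero, Finset.filter_eq_empty_iff]
  rintro j - ⟨h1, h2⟩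
  exact h1.ne (hx h2)

theorem evalMap_of_injective {p : ℕ} {x : Fin p → ℝ} (hx : Function.Injective x) (g : ℝ → ℝ)
    (i : Fin p) : evalMap x g i = g (x i) := by
  simp [evalMap, priorCount_of_injective hx]

theorem divDiff_of_injective {p : ℕ} {x : Fin p → ℝ} (hx : Function.Injective x) (g : ℝ → ℝ) :
    divDiff g x = ∑ i, g (x i) / ∏ j ∈ Finset.univ.erase i, (x i - x j) := by
  have h := Lagrange.coeff_eq_sum (s := Finset.univ) (v := x) hx.injOn (P := hermite g x)
    (by simpa using hermite_degree g x)
  rw [Finset.card_univ, Fintype.card_fin] at h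
  rw [divDiff, h]
  refine Finset.sum_congr rfl fun i _ => ?_
  have := congrFun (evalMap_hermite g x) i
  rw [evalMap_of_injective hx, evalMap_of_injective hx] at this
  rw [this]

theorem divDiff_monomial_of_lt {p k : ℕ} (x : Fin p → ℝ) (hk : k + 1 < p) :
    divDiff (fun t => t ^ k) x = 0 := by
  have h := hermite_polynomial (x := x) (Q := Polynomial.X ^ k)
    ((Polynomial.degree_X_pow k).trans_lt (by exact_mod_cast (by omega : k < p)))
  simp only [Polynomial.eval_pow, Polynomial.eval_X] at h
  rw [divDiff, h, Polynomial.coeff_X_pow, if_neg (by omega)]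

theorem divDiff_monomial_self {k : ℕ} (x : Fin (k + 1) → ℝ) :
    divDiff (fun t => t ^ k) x = 1 := by
  have h := hermite_polynomial (x := x) (Q := Polynomial.X ^ k)
    ((Polynomial.degree_X_pow k).trans_lt (by exact_mod_cast (by omega : k < k + 1)))
  simp only [Polynomial.eval_pow, Polynomial.eval_X] at h
  rw [divDiff, h, Polynomial.coeff_X_pow, if_pos (by omega)]

/-! ### Jets -/

/-- Jets are carried as sequences in which each function differentiates to the next. Regularity up
to order q is then a condition on the indices, and iterated derivatives never have to be computed
directly. -/
theorem iteratedDeriv_eq_of_hasDerivAt {F : Type*} [NormedAddCommGroup F] [NormedSpace ℝ F]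
    {G : ℕ → ℝ → F} {q : ℕ}
    (h : ∀ m < q, ∀ y, HasDerivAt (G m) (G (m + 1) y) y) :
    ∀ m ≤ q, iteratedDeriv m (G 0) = G m := by
  intro m
  induction m with
  | zero => intro _; simp
  | succ m ih =>
    intro hm
    rw [iteratedDeriv_succ, ih (by omega)]
    funext y
    exact (h m (by omega) y).deriv

/-- Iterated derivatives of `y ↦ a + (y - b) H_0(y)`. -/
theorem iteratedDeriv_const_add_linear_mul {H : ℕ → ℝ → ℝ} {q : ℕ} (a b : ℝ)
    (h : ∀ m < q, ∀ y, HasDerivAt (H m) (H (m + 1) y) y) (m : ℕ) (hm : m ≤ q) (y : ℝ) :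
    iteratedDeriv m (fun y => a + (y - b) * H 0 y) y
      = (if m = 0 then a else 0) + (y - b) * H m y + m * H (m - 1) y := by
  let K : ℕ → ℝ → ℝ := fun m y => (if m = 0 then a else 0) + (y - b) * H m y + m * H (m - 1) y
  have hK : ∀ m < q, ∀ y, HasDerivAt (K m) (K (m + 1) y) y := by
    intro m hm y
    have h1 : HasDerivAt (fun y => (y - b) * H m y) (1 * H m y + (y - b) * H (m + 1) y) y :=
      ((hasDerivAt_id y).sub_const b).mul (h m hm y)
    rcases Nat.eq_zero_or_pos m with rfl | hpos
    · have hK0 : K 0 = fun y => a + (y - b) * H 0 y := by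
        funext y
        simp [K]
      rw [hK0]
      refine (h1.const_add a).congr_deriv ?_
      simp only [K]
      simp
      ring
    · have h2 : HasDerivAt (fun y => (m : ℝ) * H (m - 1) y) (m * H m y) y := by
        have := (h (m - 1) (by omega) y).const_mul (m : ℝ)
        rwa [Nat.sub_add_cancel hpos] at this
      have := (h1.const_add 0).add h2
      simp only [K]
      rw [if_neg (by omega), if_neg (by omega)]
      refine this.congr_deriv ?_
      simp only [Nat.add_sub_cancel]
      push_cast
      ring
  have h0 : (fun y => a + (y - b) * H 0 y) = K 0 := by
    funext y
    simp [K]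
  rw [h0, iteratedDeriv_eq_of_hasDerivAt hK m hm]

theorem priorCount_cons_succ {p : ℕ} (b : ℝ) (x : Fin p → ℝ) (i : Fin p) :
    priorCount (Fin.cons b x : Fin (p + 1) → ℝ) i.succ
      = priorCount x i + if b = x i then 1 else 0 := by
  unfold priorCount
  rw [Fin.card_filter_univ_succ]
  simp only [Fin.succ_pos, Fin.cons_zero, Fin.cons_succ, true_and,
    Fin.succ_lt_succ_iff]
  split_ifs <;> simp

/-- Recursive computation of divided differences. -/
theorem divDiff_cons {q : ℕ} {g : ℝ → ℝ} {H : ℕ → ℝ → ℝ} (b : ℝ) (x : Fin (q + 1) → ℝ)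
    (hH : ∀ m < q, ∀ y, HasDerivAt (H m) (H (m + 1) y) y)
    (hg : ∀ y, g y = g b + (y - b) * H 0 y)
    (hb : ∀ m ≤ q, iteratedDeriv (m + 1) g b = (m + 1) * H m b) :
    divDiff g (Fin.cons b x : Fin (q + 2) → ℝ) = divDiff (H 0) x := by
  set Q := hermite (H 0) x with hQ
  have hQdeg := hermite_degree (H 0) x
  rw [← hQ] at hQdeg
  set R : Polynomial ℝ := Polynomial.C (g b) + (Polynomial.X - Polynomial.C b) * Q with hR
  have hcount : ∀ i, priorCount x i ≤ q := by
    intro i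
    have : priorCount x i < (Finset.univ : Finset (Fin (q + 1))).card := by
      apply Finset.card_lt_card
      refine (Finset.ssubset_iff_of_subset (Finset.filter_subset _ _)).2 ⟨i, by simp, by simp⟩
    simp at this
    omega
  -- The interpolation condition at index `i` fixes one order of derivation only; the lower orders
  -- at the same node come from the earlier indices sharing it.
  have hjet : ∀ i, ∀ m ≤ priorCount x i,
      (Polynomial.derivative^[m] Q).eval (x i) = H m (x i) := by
    intro i m hm
    have hlt : m < (Finset.univ.filter fun j => x j = x i).card := by
      refine hm.trans_lt ?_
      apply Finset.card_lt_card
      refine (Finset.ssubset_iff_of_subset ?_).2 ⟨i, by simp, by simp⟩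
      intro j hj
      simp only [Finset.mem_filter, Finset.mem_univ, true_and] at hj ⊢
      exact hj.2
    obtain ⟨j, hj, hjm⟩ := exists_priorCount_eq x (x i) m hlt
    have := congrFun (evalMap_hermite (H 0) x) j
    rw [← hQ] at this
    simp only [evalMap, iteratedDeriv_polynomial, hjm, hj] at this
    rw [iteratedDeriv_eq_of_hasDerivAt hH m (hm.trans (hcount i))] at this
    exact (div_left_inj' (by positivity)).1 this
  have hQd : ∀ m < q + 1, ∀ y, HasDerivAt
      (fun y => (Polynomial.derivative^[m] Q).eval y)
      ((fun m y => (Polynomial.derivative^[m] Q).eval y) (m + 1) y) y := by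
    intro m _ y
    simp only [Function.iterate_succ_apply']
    exact Polynomial.hasDerivAt _ y
  have hRfun : (fun t => R.eval t) = fun t => g b + (t - b) *
      (fun m y => (Polynomial.derivative^[m] Q).eval y) 0 t := by
    funext t
    simp [hR]
  have hRd := iteratedDeriv_const_add_linear_mul (g b) b hQd
  have hgd := iteratedDeriv_const_add_linear_mul (g b) b hH
  have hgfun : g = fun t => g b + (t - b) * H 0 t := funext hg
  have heval : evalMap (Fin.cons b x : Fin (q + 2) → ℝ) (fun t => R.eval t)
      = evalMap (Fin.cons b x : Fin (q + 2) → ℝ) g := by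
    funext i
    refine Fin.cases ?_ (fun i => ?_) i
    · have : priorCount (Fin.cons b x : Fin (q + 2) → ℝ) 0 = 0 := by
        simp [priorCount]
      simp [evalMap, this, hR]
    · simp only [evalMap, Fin.cons_succ, priorCount_cons_succ]
      congr 1
      have hi := hcount i
      -- At a node equal to b the count rises by one, and the product rule at b leaves only (m + 1)
      -- times the derivative of order m. The derivative of g there is taken from `hb`, since order
      -- q + 1 is out of reach of the product rule for `H`. At other nodes orders m and m - 1 occur,
      -- both matched by `hjet`.
      by_cases hbi : b = x i
      · rw [if_pos hbi, ← hbi, hb _ hi, hRfun, hRd _ (by omega)]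
        have := hjet i _ le_rfl
        rw [← hbi] at this
        simp [this]
      · rw [if_neg hbi, add_zero, hRfun, hRd _ (by omega)]
        conv_rhs => rw [hgfun, hgd _ hi]
        simp only [hjet i _ le_rfl, hjet i _ (Nat.sub_le _ 1)]
  have hRdeg : R.degree < ((q + 2 : ℕ) : WithBot ℕ) := by
    have hQ' : Q.degree ≤ (q : ℕ) := by
      rw [Polynomial.degree_le_iff_coeff_zero]
      intro m hm
      exact Polynomial.coeff_eq_zero_of_degree_lt (hQdeg.trans_le (by exact_mod_cast hm))
    refine (Polynomial.degree_add_le _ _).trans_lt (max_lt ?_ ?_)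
    · exact Polynomial.degree_C_le.trans_lt (by exact_mod_cast Nat.succ_pos _)
    · rw [Polynomial.degree_mul, Polynomial.degree_X_sub_C]
      calc (1 : WithBot ℕ) + Q.degree ≤ 1 + (q : ℕ) := by gcongr
        _ < _ := by exact_mod_cast (by omega : 1 + q < q + 2)
  have hQq : Q.coeff (q + 1) = 0 := Polynomial.coeff_eq_zero_of_degree_lt hQdeg
  rw [divDiff, hermite_eq hRdeg heval, divDiff, ← hQ]
  simp [hR, sub_mul, hQq]

/-- Divided differences depend continuously on the points and on the function. -/
theorem continuous_divDiff_family (q : ℕ) : ∀ {S : Type} [TopologicalSpace S]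
    (G : ℕ → S → ℝ → ℝ), (∀ m ≤ q, Continuous fun p : S × ℝ => G m p.1 p.2) →
    (∀ m < q, ∀ s y, HasDerivAt (G m s) (G (m + 1) s y) y) →
    Continuous fun p : S × (Fin (q + 1) → ℝ) => divDiff (G 0 p.1) p.2 := by
  induction q with
  | zero =>
    intro S _ G hG _
    have : ∀ p : S × (Fin 1 → ℝ), divDiff (G 0 p.1) p.2 = G 0 p.1 (p.2 0) := by
      intro p
      rw [divDiff_of_injective (Function.injective_of_subsingleton _)]
      simp
    simp only [this]
    exact (hG 0 le_rfl).comp (continuous_fst.prodMk ((continuous_apply 0).comp continuous_snd))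
  | succ q ih =>
    intro S _ G hG hd
    -- Hadamard's formula: `K 0` is the difference quotient (g(y) - g(b)) / (y - b), continued
    -- through y = b, and `K m` is its derivative of order m in y. The base point b joins the
    -- parameters, which is why the induction runs over families.
    let K : ℕ → S × ℝ → ℝ → ℝ := fun m p y =>
      ∫ t in (0 : ℝ)..1, t ^ m * G (m + 1) p.1 (p.2 + t * (y - p.2))
    have hcont : ∀ m ≤ q, Continuous fun r : (((S × ℝ) × ℝ) × ℝ) =>
        r.2 ^ m * G (m + 1) r.1.1.1 (r.1.1.2 + r.2 * (r.1.2 - r.1.1.2)) := by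
      intro m hm
      exact (continuous_snd.pow m).mul ((hG (m + 1) (by omega)).comp
        (f := fun r : (((S × ℝ) × ℝ) × ℝ) => (r.1.1.1, r.1.1.2 + r.2 * (r.1.2 - r.1.1.2)))
        (by fun_prop))
    have hKc : ∀ m ≤ q, Continuous fun p : (S × ℝ) × ℝ => K m p.1 p.2 := by
      intro m hm
      exact intervalIntegral.continuous_parametric_intervalIntegral_of_continuous'
        (f := fun (p : (S × ℝ) × ℝ) t => t ^ m * G (m + 1) p.1.1 (p.1.2 + t * (p.2 - p.1.2)))
        (hcont m hm) 0 1
    have hKd : ∀ m < q, ∀ p y, HasDerivAt (K m p) (K (m + 1) p y) y := by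
      intro m hm p y
      have hc1 : Continuous fun r : ℝ × ℝ =>
          r.2 ^ m * G (m + 1) p.1 (p.2 + r.2 * (r.1 - p.2)) :=
        (hcont m hm.le).comp (g := fun r : (((S × ℝ) × ℝ) × ℝ) =>
        r.2 ^ m * G (m + 1) r.1.1.1 (r.1.1.2 + r.2 * (r.1.2 - r.1.1.2)))
          (f := fun r : ℝ × ℝ => ((p, r.1), r.2)) (by fun_prop)
      have hc2 : Continuous fun r : ℝ × ℝ =>
          r.2 ^ (m + 1) * G (m + 2) p.1 (p.2 + r.2 * (r.1 - p.2)) :=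
        (hcont (m + 1) hm).comp (g := fun r : (((S × ℝ) × ℝ) × ℝ) =>
        r.2 ^ (m + 1) * G (m + 2) r.1.1.1 (r.1.1.2 + r.2 * (r.1.2 - r.1.1.2)))
          (f := fun r : ℝ × ℝ => ((p, r.1), r.2)) (by fun_prop)
      obtain ⟨C, hC⟩ := ((isCompact_Icc (a := y - 1) (b := y + 1)).prod
        (isCompact_Icc (a := (0 : ℝ)) (b := 1))).exists_bound_of_continuousOn hc2.continuousOn
      refine (intervalIntegral.hasDerivAt_integral_of_dominated_loc_of_deriv_le
        (F := fun y t => t ^ m * G (m + 1) p.1 (p.2 + t * (y - p.2)))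
        (F' := fun y t => t ^ (m + 1) * G (m + 2) p.1 (p.2 + t * (y - p.2)))
        (bound := fun _ => C) (s := Set.Icc (y - 1) (y + 1))
        (Icc_mem_nhds (by linarith) (by linarith)) ?_ ?_ ?_ ?_ ?_ ?_).2
      · exact Eventually.of_forall fun z =>
          (hc1.comp (Continuous.prodMk_right z)).aestronglyMeasurable
      · exact (hc1.comp (Continuous.prodMk_right y)).intervalIntegrable _ _
      · exact (hc2.comp (Continuous.prodMk_right y)).aestronglyMeasurable
      · refine Eventually.of_forall fun t ht z hz => hC (z, t) ⟨hz, ?_⟩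
        rw [Set.uIoc_of_le zero_le_one] at ht
        exact ⟨ht.1.le, ht.2⟩
      · exact intervalIntegrable_const
      · refine Eventually.of_forall fun t _ z _ => ?_
        have h1 : HasDerivAt (fun z => p.2 + t * (z - p.2)) t z := by
          simpa using (((hasDerivAt_id z).sub_const p.2).const_mul t).const_add p.2
        have h2 := (hd (m + 1) (by omega) p.1 (p.2 + t * (z - p.2))).comp z h1
        refine (h2.const_mul (t ^ m)).congr_deriv ?_
        ring
    have hstep : ∀ s (x : Fin (q + 2) → ℝ),
        divDiff (G 0 s) x = divDiff (K 0 (s, x 0)) (Fin.tail x) := by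
      intro s x
      conv_lhs => rw [← Fin.cons_self_tail x]
      refine divDiff_cons (H := fun m => K m (s, x 0)) (x 0) (Fin.tail x)
        (fun m hm y => hKd m hm (s, x 0) y) ?_ ?_
      · intro y
        have hc : Continuous fun t : ℝ => G 1 s (x 0 + t * (y - x 0)) :=
          (hG 1 (by omega)).comp (f := fun t : ℝ => (s, x 0 + t * (y - x 0)))
            (by fun_prop)
        have hint := intervalIntegral.integral_eq_sub_of_hasDerivAt (a := 0) (b := 1)
          (f := fun t => G 0 s (x 0 + t * (y - x 0)))
          (f' := fun t => G 1 s (x 0 + t * (y - x 0)) * (y - x 0)) (fun t _ => by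
            have h1 : HasDerivAt (fun t => x 0 + t * (y - x 0)) (y - x 0) t := by
              simpa using ((hasDerivAt_id t).mul_const (y - x 0)).const_add (x 0)
            exact (hd 0 (by omega) s _).comp t h1)
          ((hc.mul continuous_const).intervalIntegrable _ _)
        rw [intervalIntegral.integral_mul_const] at hint
        simp only [one_mul, zero_mul, add_zero, add_sub_cancel] at hint
        simp only [K, pow_zero, one_mul, zero_add]
        linarith
      · intro m hm
        rw [iteratedDeriv_eq_of_hasDerivAt (fun m hm y => hd m hm s y) (m + 1) (by omega)]
        simp only [K, sub_self, mul_zero, add_zero, intervalIntegral.integral_mul_const,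
          integral_pow]
        field_simp
        simp
    simp only [hstep]
    exact (ih (fun m => K m) hKc hKd).comp
      (f := fun p : S × (Fin (q + 2) → ℝ) => ((p.1, p.2 0), Fin.tail p.2))
      ((continuous_fst.prodMk ((continuous_apply 0).comp continuous_snd)).prodMk
        (continuous_pi fun i => (continuous_apply _).comp continuous_snd))

theorem continuous_divDiff {q : ℕ} {g : ℝ → ℝ} (hg : ContDiff ℝ q g) :
    Continuous fun x : Fin (q + 1) → ℝ => divDiff g x := by
  obtain ⟨h1, h2⟩ := contDiff_nat_iff_iteratedDeriv.1 hg
  have := continuous_divDiff_family q (S := Unit) (fun m _ => iteratedDeriv m g)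
    (fun m hm => (h1 m hm).comp continuous_snd)
    (fun m hm _ y => by
      rw [iteratedDeriv_succ]
      exact (h2 m hm y).hasDerivAt)
  simp only [iteratedDeriv_zero] at this
  exact this.comp (f := fun x => ((), x)) (by fun_prop)

/-! ### Centered Gaussian random variables -/

section Gaussian

variable {Ω : Type*} [MeasurableSpace Ω] {P : Measure Ω}

theorem aemeasurable_of_map_eq_gaussianReal {Y : Ω → ℝ} {m : ℝ} {v : NNReal}
    (h : P.map Y = gaussianReal m v) : AEMeasurable Y P :=
  AEMeasurable.of_map_ne_zero (by rw [h]; exact IsProbabilityMeasure.ne_zero _)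

theorem integral_sq_of_map_eq_gaussianReal {Y : Ω → ℝ} {v : NNReal}
    (h : P.map Y = gaussianReal 0 v) : ∫ ω, Y ω ^ 2 ∂P = v := by
  have h1 : Var[id; P.map Y] = v := by rw [h, variance_id_gaussianReal]
  have hm : ∫ ω, Y ω ∂P = 0 := by
    have := integral_map (f := fun x : ℝ => x) (aemeasurable_of_map_eq_gaussianReal h)
      (by fun_prop)
    rw [h, integral_id_gaussianReal] at this
    exact this.symm
  rw [variance_map (by fun_prop) (aemeasurable_of_map_eq_gaussianReal h), Function.id_comp,
    variance_of_integral_eq_zero (aemeasurable_of_map_eq_gaussianReal h) hm] at h1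
  exact h1

variable [IsProbabilityMeasure P]

/-- An almost sure limit of centered Gaussian variables is centered Gaussian, and the variances
converge. -/
theorem exists_map_eq_gaussianReal_of_tendsto {Z : ℕ → Ω → ℝ} {Y : Ω → ℝ} {v : ℕ → NNReal}
    (hZ : ∀ k, P.map (Z k) = gaussianReal 0 (v k))
    (hlim : ∀ᵐ ω ∂P, Tendsto (fun k => Z k ω) atTop (𝓝 (Y ω))) :
    ∃ w : NNReal, P.map Y = gaussianReal 0 w ∧
      Tendsto (fun k => (v k : ℝ)) atTop (𝓝 w) := by
  have hZm : ∀ k, AEMeasurable (Z k) P := fun k => aemeasurable_of_map_eq_gaussianReal (hZ k)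
  have hYm : AEMeasurable Y P := aemeasurable_of_tendsto_metrizable_ae atTop hZm hlim
  have : IsProbabilityMeasure (P.map Y) := Measure.isProbabilityMeasure_map hYm
  have hchar : ∀ (X : Ω → ℝ), AEMeasurable X P → ∀ t : ℝ,
      charFun (P.map X) t = ∫ ω, Complex.exp (t * X ω * Complex.I) ∂P := by
    intro X hX t
    rw [charFun_apply_real, integral_map hX (by fun_prop)]
  have hexp : ∀ k (t : ℝ), charFun (P.map (Z k)) t
      = ((Real.exp (-(v k * t ^ 2 / 2)) : ℝ) : ℂ) := by
    intro k t
    rw [hZ, charFun_gaussianReal]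
    push_cast
    congr 1
    ring
  have hconv : ∀ t : ℝ, Tendsto (fun k => ((Real.exp (-(v k * t ^ 2 / 2)) : ℝ) : ℂ)) atTop
      (𝓝 (charFun (P.map Y) t)) := by
    intro t
    simp only [← hexp]
    simp only [hchar _ (hZm _), hchar _ hYm]
    refine tendsto_integral_of_dominated_convergence (fun _ => 1) ?_ (integrable_const 1) ?_ ?_
    · intro k
      have := (hZm k).aestronglyMeasurable
      fun_prop
    · intro k
      refine Eventually.of_forall fun ω => ?_
      rw [← Complex.ofReal_mul, Complex.norm_exp_ofReal_mul_I]
    · filter_upwards [hlim] with ω hω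
      have hc : Continuous fun x : ℝ => Complex.exp (t * x * Complex.I) := by fun_prop
      exact (hc.tendsto _).comp hω
  have hconvre : ∀ t : ℝ, Tendsto (fun k => Real.exp (-(v k * t ^ 2 / 2))) atTop
      (𝓝 (charFun (P.map Y) t).re) := by
    intro t
    have := (Complex.continuous_re.tendsto _).comp (hconv t)
    simpa only [Function.comp_def, Complex.ofReal_re] using this
  -- A single nonzero frequency at which the limit characteristic function is positive suffices: its
  -- logarithm there recovers the limit of the variances, which in particular cannot escape to
  -- infinity.
  obtain ⟨t, ht0, ht⟩ : ∃ t : ℝ, 0 < t ∧ 0 < (charFun (P.map Y) t).re := by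
    have hc : ContinuousAt (fun t : ℝ => (charFun (P.map Y) t).re) 0 :=
      (Complex.continuous_re.comp continuous_charFun).continuousAt
    have h0 : ∀ᶠ t in 𝓝 (0 : ℝ), 0 < (charFun (P.map Y) t).re :=
      hc.eventually (lt_mem_nhds (by simp))
    have h1 : ∀ᶠ t in 𝓝[>] (0 : ℝ), 0 < (charFun (P.map Y) t).re := h0.filter_mono inf_le_left
    obtain ⟨t, h2, h3⟩ := (h1.and self_mem_nhdsWithin).exists
    exact ⟨t, h3, h2⟩
  have hv : Tendsto (fun k => (v k : ℝ)) atTop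
      (𝓝 (-(Real.log (charFun (P.map Y) t).re) * 2 / t ^ 2)) := by
    have h1 := ((Real.continuousAt_log ht.ne').tendsto.comp (hconvre t)).neg.mul_const 2
    have h2 := h1.div_const (t ^ 2)
    refine h2.congr fun k => ?_
    simp only [Function.comp_apply, Real.log_exp]
    field_simp
  set w : ℝ := -(Real.log (charFun (P.map Y) t).re) * 2 / t ^ 2
  have hw : 0 ≤ w := ge_of_tendsto' hv fun k => (v k).2
  obtain ⟨w', hw'⟩ : ∃ w' : NNReal, (w' : ℝ) = w := ⟨⟨w, hw⟩, rfl⟩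
  rw [← hw'] at hv
  refine ⟨w', ?_, hv⟩
  refine Measure.ext_of_charFun (funext fun s => ?_)
  have h1 : Tendsto (fun k => ((Real.exp (-(v k * s ^ 2 / 2)) : ℝ) : ℂ)) atTop
      (𝓝 ((Real.exp (-(w' * s ^ 2 / 2)) : ℝ) : ℂ)) := by
    have hc : Continuous fun x : ℝ => ((Real.exp (-(x * s ^ 2 / 2)) : ℝ) : ℂ) := by fun_prop
    exact (hc.tendsto (w' : ℝ)).comp hv
  rw [tendsto_nhds_unique (hconv s) h1, charFun_gaussianReal]
  push_cast
  congr 1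
  ring

end Gaussian

/-! ### The Gaussian space of a process -/

/-- The almost sure limits of linear combinations of the values of the process `f`. -/
def gaussianSpace {Ω : Type*} [MeasurableSpace Ω] (f : ℝ → Ω → ℝ) (P : Measure Ω) :
    Submodule ℝ (Ω → ℝ) where
  carrier := {Y | ∃ Z : ℕ → Ω → ℝ, (∀ k, Z k ∈ Submodule.span ℝ (Set.range f)) ∧
    ∀ᵐ ω ∂P, Tendsto (fun k => Z k ω) atTop (𝓝 (Y ω))}
  add_mem' := by
    rintro X Y ⟨Z, hZ, hX⟩ ⟨Z', hZ', hY⟩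
    refine ⟨fun k => Z k + Z' k, fun k => add_mem (hZ k) (hZ' k), ?_⟩
    filter_upwards [hX, hY] with ω h1 h2 using h1.add h2
  zero_mem' := ⟨fun _ => 0, fun _ => zero_mem _, Eventually.of_forall fun _ => tendsto_const_nhds⟩
  smul_mem' := by
    rintro c X ⟨Z, hZ, hX⟩
    refine ⟨fun k => c • Z k, fun k => Submodule.smul_mem _ _ (hZ k), ?_⟩
    filter_upwards [hX] with ω h1 using h1.const_mul c

section GaussianSpace

variable {Ω : Type*} [MeasurableSpace Ω] {P : Measure Ω} {f : ℝ → Ω → ℝ}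

theorem gaussianSpace_of_mem_span {Y : Ω → ℝ} (hY : Y ∈ Submodule.span ℝ (Set.range f)) :
    Y ∈ gaussianSpace f P :=
  ⟨fun _ => Y, fun _ => hY, Eventually.of_forall fun _ => tendsto_const_nhds⟩

theorem mem_gaussianSpace (t : ℝ) : f t ∈ gaussianSpace f P :=
  gaussianSpace_of_mem_span (Submodule.subset_span ⟨t, rfl⟩)

theorem sum_mul_mem_gaussianSpace {ι : Type*} {s : Finset ι} {X : ι → Ω → ℝ}
    (hX : ∀ i, X i ∈ gaussianSpace f P) (c : ι → ℝ) :
    (fun ω => ∑ i ∈ s, c i * X i ω) ∈ gaussianSpace f P := by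
  have : (fun ω => ∑ i ∈ s, c i * X i ω) = ∑ i ∈ s, c i • X i := by
    funext ω
    simp
  rw [this]
  exact Submodule.sum_mem _ fun i _ => Submodule.smul_mem _ _ (hX i)

variable [IsProbabilityMeasure P] (hf : IsStationaryCenteredGaussian f P)
include hf

omit [IsProbabilityMeasure P] in
theorem exists_map_eq_gaussianReal_of_mem_span {Y : Ω → ℝ}
    (hY : Y ∈ Submodule.span ℝ (Set.range f)) : ∃ v : NNReal, P.map Y = gaussianReal 0 v := by
  obtain ⟨c, rfl⟩ := Finsupp.mem_span_range_iff_exists_finsupp.1 hY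
  let L : (c.support → ℝ) →L[ℝ] ℝ := ∑ i : c.support, c i • ContinuousLinearMap.proj i
  have h1 : (c.sum fun i a => a • f i) = fun ω => L (fun i : c.support => f i ω) := by
    funext ω
    simp only [L, Finsupp.sum, Finset.sum_apply, Pi.smul_apply, smul_eq_mul,
      FunLike.coe_sum, FunLike.coe_smul, ContinuousLinearMap.proj_apply]
    exact (Finset.sum_coe_sort c.support fun i => c i * f i ω).symm
  have h2 : HasGaussianLaw (fun ω => L (fun i : c.support => f i ω)) P :=
    (hf.gaussian.hasGaussianLaw c.support).map_fun L
  refine ⟨Var[fun ω => L (fun i : c.support => f i ω); P].toNNReal, ?_⟩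
  rw [h1, h2.map_eq_gaussianReal]
  congr 1
  rw [← h1]
  have h3 : (c.sum fun i a => a • f i) = fun ω => ∑ i ∈ c.support, c i * f i ω := by
    funext ω
    simp [Finsupp.sum]
  rw [h3, integral_finsetSum _ fun i _ =>
    ((hf.gaussian.hasGaussianLaw_eval i).integrable).const_mul _]
  simp [integral_const_mul, hf.centered]

theorem exists_map_eq_gaussianReal {Y : Ω → ℝ} (hY : Y ∈ gaussianSpace f P) :
    ∃ v : NNReal, P.map Y = gaussianReal 0 v := by
  obtain ⟨Z, hZ, hlim⟩ := hY
  choose v hv using fun k => exists_map_eq_gaussianReal_of_mem_span hf (hZ k)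
  obtain ⟨w, hw, -⟩ := exists_map_eq_gaussianReal_of_tendsto hv hlim
  exact ⟨w, hw⟩

theorem gaussianSpace_aemeasurable {Y : Ω → ℝ} (hY : Y ∈ gaussianSpace f P) :
    AEMeasurable Y P := by
  obtain ⟨v, hv⟩ := exists_map_eq_gaussianReal hf hY
  exact aemeasurable_of_map_eq_gaussianReal hv

theorem gaussianSpace_hasGaussianLaw {Y : Ω → ℝ} (hY : Y ∈ gaussianSpace f P) :
    HasGaussianLaw Y P := by
  obtain ⟨v, hv⟩ := exists_map_eq_gaussianReal hf hY
  exact ⟨by rw [hv]; infer_instance⟩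

theorem gaussianSpace_memLp {Y : Ω → ℝ} (hY : Y ∈ gaussianSpace f P) : MemLp Y 2 P :=
  (gaussianSpace_hasGaussianLaw hf hY).memLp_two

theorem gaussianSpace_integral {Y : Ω → ℝ} (hY : Y ∈ gaussianSpace f P) :
    ∫ ω, Y ω ∂P = 0 := by
  obtain ⟨v, hv⟩ := exists_map_eq_gaussianReal hf hY
  have := integral_map (f := fun x : ℝ => x) (gaussianSpace_aemeasurable hf hY) (by fun_prop)
  rw [hv, integral_id_gaussianReal] at this
  exact this.symm

theorem gaussianSpace_covariance {X Y : Ω → ℝ} (hX : X ∈ gaussianSpace f P)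
    (hY : Y ∈ gaussianSpace f P) : cov[X, Y; P] = ∫ ω, X ω * Y ω ∂P := by
  simp [covariance, gaussianSpace_integral hf hX, gaussianSpace_integral hf hY]

theorem gaussianSpace_integrable_mul {X Y : Ω → ℝ} (hX : X ∈ gaussianSpace f P)
    (hY : Y ∈ gaussianSpace f P) : Integrable (fun ω => X ω * Y ω) P :=
  (gaussianSpace_memLp hf hX).integrable_mul (gaussianSpace_memLp hf hY)

/-- No domination is needed: the laws are centered Gaussian, and their variances are read off from
characteristic functions, which do converge. -/
theorem gaussianSpace_tendsto_integral_sq {Z : ℕ → Ω → ℝ} {Y : Ω → ℝ}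
    (hZ : ∀ k, Z k ∈ gaussianSpace f P)
    (hlim : ∀ᵐ ω ∂P, Tendsto (fun k => Z k ω) atTop (𝓝 (Y ω))) :
    Tendsto (fun k => ∫ ω, Z k ω ^ 2 ∂P) atTop (𝓝 (∫ ω, Y ω ^ 2 ∂P)) := by
  choose v hv using fun k => exists_map_eq_gaussianReal hf (hZ k)
  obtain ⟨w, hw, hvw⟩ := exists_map_eq_gaussianReal_of_tendsto hv hlim
  rw [integral_sq_of_map_eq_gaussianReal hw]
  simpa only [integral_sq_of_map_eq_gaussianReal (hv _)] using hvw

/-- Polarization of the convergence of variances, the Gaussian space being stable under sums and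
differences. -/
theorem gaussianSpace_tendsto_integral_mul {Z Z' : ℕ → Ω → ℝ} {Y Y' : Ω → ℝ}
    (hZ : ∀ k, Z k ∈ gaussianSpace f P) (hZ' : ∀ k, Z' k ∈ gaussianSpace f P)
    (hY : Y ∈ gaussianSpace f P) (hY' : Y' ∈ gaussianSpace f P)
    (hlim : ∀ᵐ ω ∂P, Tendsto (fun k => Z k ω) atTop (𝓝 (Y ω)))
    (hlim' : ∀ᵐ ω ∂P, Tendsto (fun k => Z' k ω) atTop (𝓝 (Y' ω))) :
    Tendsto (fun k => ∫ ω, Z k ω * Z' k ω ∂P) atTop (𝓝 (∫ ω, Y ω * Y' ω ∂P)) := by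
  have key : ∀ X X' : Ω → ℝ, X ∈ gaussianSpace f P → X' ∈ gaussianSpace f P →
      ∫ ω, X ω * X' ω ∂P
        = (∫ ω, (X + X') ω ^ 2 ∂P - ∫ ω, (X - X') ω ^ 2 ∂P) / 4 := by
    intro X X' hX hX'
    rw [← integral_sub (gaussianSpace_memLp hf (add_mem hX hX')).integrable_sq
      (gaussianSpace_memLp hf (sub_mem hX hX')).integrable_sq, ← integral_div]
    refine integral_congr_ae (Eventually.of_forall fun ω => ?_)
    simp only [Pi.add_apply, Pi.sub_apply]
    ring
  rw [key _ _ hY hY']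
  simp only [key _ _ (hZ _) (hZ' _)]
  refine ((gaussianSpace_tendsto_integral_sq hf (fun k => add_mem (hZ k) (hZ' k)) ?_).sub
    (gaussianSpace_tendsto_integral_sq hf (fun k => sub_mem (hZ k) (hZ' k)) ?_)).div_const 4
  · filter_upwards [hlim, hlim'] with ω h1 h2 using h1.add h2
  · filter_upwards [hlim, hlim'] with ω h1 h2 using h1.sub h2

/-- Every linear form in the coordinates stays in the Gaussian space, so it is a Gaussian variable.
The two families are kept apart as a pair because independence of a residual from the conditioning
vector will be drawn from their joint law. -/
theorem gaussianSpace_hasGaussianLaw_prod {ι κ : Type*} [Fintype ι] [Fintype κ]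
    {X : ι → Ω → ℝ} {Y : κ → Ω → ℝ} (hX : ∀ i, X i ∈ gaussianSpace f P)
    (hY : ∀ i, Y i ∈ gaussianSpace f P) :
    HasGaussianLaw (fun ω => (fun i => X i ω, fun j => Y j ω)) P := by
  classical
  have hXm : AEMeasurable (fun ω i => X i ω) P :=
    aemeasurable_pi_lambda _ fun i => gaussianSpace_aemeasurable hf (hX i)
  have hYm : AEMeasurable (fun ω i => Y i ω) P :=
    aemeasurable_pi_lambda _ fun i => gaussianSpace_aemeasurable hf (hY i)
  refine ⟨isGaussian_of_map_eq_gaussianReal fun L => ?_⟩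
  have hL : (L ∘ fun ω => (fun i => X i ω, fun j => Y j ω))
      = (fun ω => ∑ i, L (Pi.single i 1, 0) * X i ω)
        + fun ω => ∑ j, L (0, Pi.single j 1) * Y j ω := by
    funext ω
    have h1 : ((fun i => X i ω, fun j => Y j ω) : (ι → ℝ) × (κ → ℝ))
        = ∑ i, X i ω • ((Pi.single i 1, 0) : (ι → ℝ) × (κ → ℝ))
          + ∑ j, Y j ω • ((0, Pi.single j 1) : (ι → ℝ) × (κ → ℝ)) := by
      refine Prod.ext ?_ ?_
      · funext i
        simp [Prod.fst_sum, Finset.sum_apply, Pi.single_apply]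
      · funext i
        simp [Prod.snd_sum, Finset.sum_apply, Pi.single_apply]
    simp only [Function.comp_apply, Pi.add_apply]
    rw [h1, map_add, map_sum, map_sum]
    congr 1
    · refine Finset.sum_congr rfl fun i _ => ?_
      rw [map_smul, smul_eq_mul, mul_comm]
    · refine Finset.sum_congr rfl fun i _ => ?_
      rw [map_smul, smul_eq_mul, mul_comm]
  rw [AEMeasurable.map_map_of_aemeasurable (by fun_prop) (hXm.prodMk hYm), hL]
  obtain ⟨v, hv⟩ := exists_map_eq_gaussianReal hf
    (add_mem (sum_mul_mem_gaussianSpace (s := Finset.univ) hX fun i => L (Pi.single i 1, 0))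
      (sum_mul_mem_gaussianSpace (s := Finset.univ) hY fun j => L (0, Pi.single j 1)))
  exact ⟨0, v, hv⟩

end GaussianSpace

/-! ### Approximation by points outside the large diagonal -/

/-- Add to the points distinct multiples of 1/(k + 1). Equal points are separated at once, distinct
ones stay distinct for large k, and a shift of the sequence discards the first terms. Identities
proved for distinct points pass to confluent ones along such sequences. -/
theorem exists_seq_injective_tendsto {A : Type*} [Finite A] (x : A → ℝ) :
    ∃ s : ℕ → A → ℝ, (∀ k, Function.Injective (s k)) ∧ Tendsto s atTop (𝓝 x) := by
  obtain ⟨n, ⟨e⟩⟩ := Finite.exists_equiv_fin A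
  let u : ℕ → A → ℝ := fun k a => x a + 1 / ((k : ℝ) + 1) * (e a : ℕ)
  have hu : Tendsto u atTop (𝓝 x) := by
    rw [tendsto_pi_nhds]
    intro a
    have := ((tendsto_one_div_add_atTop_nhds_zero_nat (𝕜 := ℝ)).mul_const ((e a : ℕ) : ℝ)).const_add
      (x a)
    simpa [u] using this
  have hinj : ∀ᶠ k in atTop, ∀ a b, a ≠ b → u k a ≠ u k b := by
    rw [eventually_all]
    intro a
    rw [eventually_all]
    intro b
    by_cases hab : a = b
    · exact Eventually.of_forall fun _ h => absurd hab h
    by_cases hx : x a = x b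
    · refine Eventually.of_forall fun k _ h => hab ?_
      simp only [u, hx, add_right_inj] at h
      have h2 := mul_left_cancel₀ (by positivity) h
      exact e.injective (Fin.ext (by exact_mod_cast h2))
    · have h1 : Tendsto (fun k => u k a - u k b) atTop (𝓝 (x a - x b)) :=
        ((tendsto_pi_nhds.1 hu) a).sub ((tendsto_pi_nhds.1 hu) b)
      filter_upwards [h1.eventually_ne (sub_ne_zero.2 hx)] with k hk _ using sub_ne_zero.1 hk
  obtain ⟨N, hN⟩ := eventually_atTop.1 hinj
  refine ⟨fun k => u (k + N), fun k a b h => ?_, (tendsto_add_atTop_iff_nat N).2 hu⟩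
  by_contra hab
  exact hN (k + N) (by omega) a b hab h

/-! ### Divided differences of the trajectories. -/

section Path

theorem divDiff_path_mem_span {Ω : Type*} {f : ℝ → Ω → ℝ} {p : ℕ} {x : Fin p → ℝ}
    (hx : Function.Injective x) :
    (fun ω => divDiff (path f ω) x) ∈ Submodule.span ℝ (Set.range f) := by
  have : (fun ω => divDiff (path f ω) x)
      = ∑ i, (∏ j ∈ Finset.univ.erase i, (x i - x j))⁻¹ • f (x i) := by
    funext ω
    simp [divDiff_of_injective hx, path, div_eq_inv_mul]
  rw [this]
  exact Submodule.sum_mem _ fun i _ => Submodule.smul_mem _ _ (Submodule.subset_span ⟨_, rfl⟩)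

variable {Ω : Type*} [MeasurableSpace Ω] {P : Measure Ω} {f : ℝ → Ω → ℝ}

theorem IsOfClass.mono {m n : ℕ} (h : m ≤ n) (hn : IsOfClass n f P) : IsOfClass m f P := by
  filter_upwards [hn] with ω hω using hω.of_le (by exact_mod_cast h)

/-- Confluent divided differences, hence derivatives of f, are almost sure limits of those at
distinct points, which are linear combinations of values. The p nodes involve at most p - 1
derivatives, whence the bound `p ≤ n + 1`. -/
theorem divDiff_path_mem_gaussianSpace {p n : ℕ} (hn : IsOfClass n f P) (hp : p ≤ n + 1)
    (x : Fin p → ℝ) : (fun ω => divDiff (path f ω) x) ∈ gaussianSpace f P := by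
  obtain ⟨s, hs, hlim⟩ := exists_seq_injective_tendsto x
  refine ⟨fun k ω => divDiff (path f ω) (s k), fun k => divDiff_path_mem_span (hs k), ?_⟩
  rcases p with _ | q
  · refine Eventually.of_forall fun ω => ?_
    simp only [Subsingleton.elim (s _) x]
    exact tendsto_const_nhds
  filter_upwards [hn.mono (by omega : q ≤ n)] with ω hω
  exact ((continuous_divDiff hω).tendsto x).comp hlim

theorem tendsto_divDiff_path {p n : ℕ} (hn : IsOfClass n f P) (hp : p ≤ n + 1)
    {x : Fin p → ℝ} {s : ℕ → Fin p → ℝ} (hlim : Tendsto s atTop (𝓝 x)) :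
    ∀ᵐ ω ∂P, Tendsto (fun k => divDiff (path f ω) (s k)) atTop (𝓝 (divDiff (path f ω) x)) := by
  rcases p with _ | q
  · refine Eventually.of_forall fun ω => ?_
    simp only [Subsingleton.elim (s _) x]
    exact tendsto_const_nhds
  filter_upwards [hn.mono (by omega : q ≤ n)] with ω hω
  exact ((continuous_divDiff hω).tendsto x).comp hlim

end Path

/-! ### Bochner's theorem for real positive definite functions on the line -/

/-- Real continuous positive definite functions normalized by `κ 0 = 1`. -/
structure IsPosDefFun (κ : ℝ → ℝ) : Prop where
  continuous : Continuous κ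
  zero : κ 0 = 1
  even : ∀ t, κ (-t) = κ t
  nonneg : ∀ (N : ℕ) (t c : Fin N → ℝ), 0 ≤ ∑ i, ∑ j, c i * c j * κ (t i - t j)

namespace IsPosDefFun

variable {κ : ℝ → ℝ} (hκ : IsPosDefFun κ)
include hκ

theorem abs_le_one (t : ℝ) : |κ t| ≤ 1 := by
  have h1 := hκ.nonneg 2 ![t, 0] ![1, 1]
  have h2 := hκ.nonneg 2 ![t, 0] ![1, -1]
  simp [Fin.sum_univ_two, hκ.zero, hκ.even] at h1 h2
  rw [abs_le]
  constructor <;> linarith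

/-- Test positive definiteness at N independent points of law N(0, v), with weights cos(ξt_i) and
then sin(ξt_i), and average. The diagonal gives N; each of the N(N - 1) other terms gives the
integral in question, since a difference of two points has law N(0, 2v). A negative integral would
be contradicted as N grows. -/
theorem integral_mul_cos_nonneg (v : NNReal) (ξ : ℝ) :
    0 ≤ ∫ u, κ u * Real.cos (ξ * u) ∂(gaussianReal 0 (v + v)) := by
  set I := ∫ u, κ u * Real.cos (ξ * u) ∂(gaussianReal 0 (v + v)) with hI
  have hc := hκ.continuous
  have hψ : Continuous fun u => κ u * Real.cos (ξ * u) := by fun_prop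
  have hbound : ∀ u, ‖κ u * Real.cos (ξ * u)‖ ≤ 1 := fun u => by
    rw [norm_mul]
    exact mul_le_one₀ (hκ.abs_le_one u) (norm_nonneg _) (Real.abs_cos_le_one _)
  have key : ∀ N : ℕ, 0 ≤ (N : ℝ) + N * (N - 1) * I := by
    intro N
    let Q : Measure (Fin N → ℝ) := Measure.pi fun _ => gaussianReal 0 v
    have hint : ∀ i j : Fin N, Integrable
        (fun ω : Fin N → ℝ => κ (ω i - ω j) * Real.cos (ξ * (ω i - ω j))) Q := by
      intro i j
      refine Integrable.of_bound (C := 1) ?_ (Eventually.of_forall fun ω => hbound _)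
      have : Continuous fun ω : Fin N → ℝ => κ (ω i - ω j) * Real.cos (ξ * (ω i - ω j)) :=
        hψ.comp (f := fun ω : Fin N → ℝ => ω i - ω j) (by fun_prop)
      exact this.aestronglyMeasurable
    have hnn : 0 ≤ ∫ ω, ∑ i, ∑ j, κ (ω i - ω j) * Real.cos (ξ * (ω i - ω j)) ∂Q := by
      refine integral_nonneg fun ω => ?_
      have h1 := hκ.nonneg N ω fun i => Real.cos (ξ * ω i)
      have h2 := hκ.nonneg N ω fun i => Real.sin (ξ * ω i)
      refine (add_nonneg h1 h2).trans_eq ?_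
      rw [← Finset.sum_add_distrib]
      refine Finset.sum_congr rfl fun i _ => ?_
      rw [← Finset.sum_add_distrib]
      refine Finset.sum_congr rfl fun j _ => ?_
      rw [mul_sub, Real.cos_sub]
      ring
    have hoff : ∀ i j : Fin N, i ≠ j →
        ∫ ω, κ (ω i - ω j) * Real.cos (ξ * (ω i - ω j)) ∂Q = I := by
      intro i j hij
      have hindep : iIndepFun (fun (i : Fin N) (ω : Fin N → ℝ) => ω i) Q :=
        iIndepFun_pi (X := fun _ x => x) fun _ => aemeasurable_id'
      have hpair : IndepFun (fun ω : Fin N → ℝ => ω i) (fun ω : Fin N → ℝ => -ω j) Q :=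
        (hindep.indepFun hij).comp measurable_id measurable_neg
      have hmap : ∀ k : Fin N, Q.map (fun ω => ω k) = gaussianReal 0 v := fun k =>
        (measurePreserving_eval (fun _ => gaussianReal 0 v) k).map_eq
      have hmapneg : Q.map (fun ω => -ω j) = gaussianReal 0 v := by
        have := gaussianReal_map_neg (μ := 0) (v := v)
        rw [← hmap j, Measure.map_map (by fun_prop) (by fun_prop), neg_zero] at this
        exact this
      have hsum := gaussianReal_add_gaussianReal_of_indepFun hpair (hmap i) hmapneg
      rw [zero_add] at hsum
      rw [hI, ← hsum, integral_map (by fun_prop) hψ.aestronglyMeasurable]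
      simp [sub_eq_add_neg]
    rw [integral_finsetSum _ fun i _ => integrable_finsetSum _ fun j _ => hint i j] at hnn
    have hrow : ∀ i : Fin N,
        ∫ ω, ∑ j, κ (ω i - ω j) * Real.cos (ξ * (ω i - ω j)) ∂Q = 1 + (N - 1) * I := by
      intro i
      rw [integral_finsetSum _ fun j _ => hint i j, ← Finset.add_sum_erase _ _ (Finset.mem_univ i)]
      congr 1
      · simp [hκ.zero]
      · rw [Finset.sum_congr rfl fun j hj => hoff i j (Finset.ne_of_mem_erase hj).symm]
        have : 1 ≤ N := by have := i.2; omega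
        simp [Finset.card_erase_of_mem, Nat.cast_sub this]
    simp only [hrow, Finset.sum_const, Finset.card_univ, Fintype.card_fin, nsmul_eq_mul] at hnn
    linarith
  by_contra hneg
  rw [not_le] at hneg
  obtain ⟨N, hN⟩ := exists_nat_gt (-1 / I + 1)
  have h1 : (-1 / I) < (N : ℝ) - 1 := by linarith
  have h2 : 0 < -1 / I := div_pos_of_neg_of_neg (by norm_num) hneg
  rw [div_lt_iff_of_neg hneg] at h1
  have h3 : (0 : ℝ) < N := by linarith
  have := key N
  nlinarith

/-- A Gaussian average of `κ` around `t`. -/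
theorem tendsto_gaussianAverage (t : ℝ) : Tendsto (fun n : ℕ => ∫ w, κ (t + w / √(n + 1)) *
    Real.exp (-(t + w / √(n + 1)) ^ 2 / (4 * (n + 1))) ∂(gaussianReal 0 1)) atTop (𝓝 (κ t)) := by
  have hc := hκ.continuous
  have hsq : Tendsto (fun n : ℕ => √((n : ℝ) + 1)) atTop atTop :=
    Real.tendsto_sqrt_atTop.comp (tendsto_atTop_add_const_right _ _ tendsto_natCast_atTop_atTop)
  have h4 : Tendsto (fun n : ℕ => 4 * ((n : ℝ) + 1)) atTop atTop :=
    (tendsto_atTop_add_const_right _ _ tendsto_natCast_atTop_atTop).const_mul_atTop (by norm_num)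
  have hlim : Tendsto (fun n : ℕ => ∫ w, κ (t + w / √(n + 1)) *
      Real.exp (-(t + w / √(n + 1)) ^ 2 / (4 * (n + 1))) ∂(gaussianReal 0 1)) atTop
      (𝓝 (∫ _, κ t ∂(gaussianReal 0 1))) := by
    refine tendsto_integral_of_dominated_convergence (fun _ => 1) ?_ (integrable_const 1) ?_ ?_
    · intro n
      exact Continuous.aestronglyMeasurable (by fun_prop)
    · intro n
      refine Eventually.of_forall fun w => ?_
      rw [norm_mul]
      refine mul_le_one₀ (hκ.abs_le_one _) (norm_nonneg _) ?_
      rw [Real.norm_eq_abs, Real.abs_exp, Real.exp_le_one_iff]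
      rw [neg_div]
      exact neg_nonpos.2 (by positivity)
    · refine Eventually.of_forall fun w => ?_
      have h1 : Tendsto (fun n : ℕ => t + w / √((n : ℝ) + 1)) atTop (𝓝 t) := by
        simpa using (hsq.const_div_atTop w).const_add t
      have h2 : Tendsto (fun n : ℕ => -(t + w / √((n : ℝ) + 1)) ^ 2 / (4 * ((n : ℝ) + 1))) atTop
          (𝓝 0) := ((h1.pow 2).neg).div_atTop h4
      simpa using ((hc.tendsto t).comp h1).mul ((Real.continuous_exp.tendsto 0).comp h2)
  simpa using hlim

/-- The integrand contains two Gaussian factors; only the choice of which one is the density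
changes. The kernel exp(-(n + 1)(t - u)²/2) becomes the density of N(t, 1/(n + 1)), and the density
of N(0, 2(n + 1)) becomes a damping factor. -/
theorem integral_gaussianReal_eq_average (n : ℕ) (t : ℝ) :
    ∫ u, κ u * Real.exp (-((n + 1) * (t - u) ^ 2 / 2))
        ∂(gaussianReal 0 (((n + 1 : ℕ) : NNReal) + ((n + 1 : ℕ) : NNReal)))
      = (√(2 * Real.pi * (2 * (n + 1))))⁻¹ * √(2 * Real.pi * (n + 1 : ℝ)⁻¹) *
        ∫ w, κ (t + w / √(n + 1)) *
          Real.exp (-(t + w / √(n + 1)) ^ 2 / (4 * (n + 1))) ∂(gaussianReal 0 1) := by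
  have hc := hκ.continuous
  have hn : (0 : ℝ) < n + 1 := by positivity
  have hv : ((n + 1 : NNReal)⁻¹) ≠ 0 := by positivity
  have hmap : gaussianReal t ((n + 1 : NNReal)⁻¹)
      = (gaussianReal 0 1).map fun w => t + w / √(n + 1) := by
    have h1 : (gaussianReal 0 1).map (fun w => w / √((n : ℝ) + 1))
        = gaussianReal 0 ((n + 1 : NNReal)⁻¹) := by
      rw [gaussianReal_map_div_const]
      congr 1
      · simp
      · ext
        simp [Real.sq_sqrt hn.le]
    have h2 := gaussianReal_map_const_add (μ := 0) (v := ((n + 1 : NNReal)⁻¹)) t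
    rw [← h1, Measure.map_map (by fun_prop) (by fun_prop), zero_add] at h2
    exact h2.symm
  have havg : ∫ w, κ (t + w / √(n + 1)) *
      Real.exp (-(t + w / √(n + 1)) ^ 2 / (4 * (n + 1))) ∂(gaussianReal 0 1)
      = ∫ u, κ u * Real.exp (-u ^ 2 / (4 * (n + 1)))
        ∂(gaussianReal t ((n + 1 : NNReal)⁻¹)) := by
    rw [hmap, integral_map (by fun_prop) (Continuous.aestronglyMeasurable (by fun_prop))]
  rw [havg, integral_gaussianReal_eq_integral_smul hv,
    integral_gaussianReal_eq_integral_smul (by positivity), ← integral_const_mul]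
  refine integral_congr_ae (Eventually.of_forall fun u => ?_)
  simp only [gaussianPDFReal, smul_eq_mul]
  push_cast
  have hs : √(2 * Real.pi * (n + 1 : ℝ)⁻¹) * (√(2 * Real.pi * (n + 1 : ℝ)⁻¹))⁻¹ = 1 :=
    mul_inv_cancel₀ (by positivity)
  have he : Real.exp (-(u - 0) ^ 2 / (2 * ((n : ℝ) + 1 + (n + 1))))
      * Real.exp (-((n + 1) * (t - u) ^ 2 / 2))
      = Real.exp (-(u - t) ^ 2 / (2 * ((n : ℝ) + 1)⁻¹)) * Real.exp (-u ^ 2 / (4 * (n + 1))) := by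
    rw [← Real.exp_add, ← Real.exp_add]
    congr 1
    field_simp
    ring
  rw [show 2 * Real.pi * ((n : ℝ) + 1 + (n + 1)) = 2 * Real.pi * (2 * (n + 1)) by ring]
  calc _ = (√(2 * Real.pi * (2 * (n + 1))))⁻¹ * κ u *
        (Real.exp (-(u - 0) ^ 2 / (2 * ((n : ℝ) + 1 + (n + 1))))
      * Real.exp (-((n + 1) * (t - u) ^ 2 / 2))) := by ring
    _ = (√(2 * Real.pi * (2 * (n + 1))))⁻¹ * κ u * (√(2 * Real.pi * (n + 1 : ℝ)⁻¹)
        * (√(2 * Real.pi * (n + 1 : ℝ)⁻¹))⁻¹) *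
        (Real.exp (-(u - t) ^ 2 / (2 * ((n : ℝ) + 1)⁻¹)) * Real.exp (-u ^ 2 / (4 * (n + 1)))) := by
      rw [he, hs, mul_one]
    _ = _ := by ring

/-- A Gaussian regularization of κ is a characteristic function. Weight N(0, n + 1) by the
nonnegative function `q` of `integral_mul_cos_nonneg`, normalized; Fubini computes the Fourier
transform of the result as a local average of κ. The mean over t and -t comes from the cosine in
`q`. -/
theorem exists_probabilityMeasure_charFun (n : ℕ)
    (hpos : 0 < ∫ w, κ (0 + w / √(n + 1)) *
      Real.exp (-(0 + w / √(n + 1)) ^ 2 / (4 * (n + 1))) ∂(gaussianReal 0 1)) :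
    ∃ μ : ProbabilityMeasure ℝ, ∀ t, charFun (μ : Measure ℝ) t =
      (((∫ w, κ (t + w / √(n + 1)) *
          Real.exp (-(t + w / √(n + 1)) ^ 2 / (4 * (n + 1))) ∂(gaussianReal 0 1)) +
        ∫ w, κ (-t + w / √(n + 1)) *
          Real.exp (-(-t + w / √(n + 1)) ^ 2 / (4 * (n + 1))) ∂(gaussianReal 0 1)) / 2 /
        ∫ w, κ (0 + w / √(n + 1)) *
          Real.exp (-(0 + w / √(n + 1)) ^ 2 / (4 * (n + 1))) ∂(gaussianReal 0 1) : ℝ) := by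
  have hc := hκ.continuous
  set J : ℝ → ℝ := fun t => ∫ w, κ (t + w / √(n + 1)) *
    Real.exp (-(t + w / √(n + 1)) ^ 2 / (4 * (n + 1))) ∂(gaussianReal 0 1) with hJ
  set γ := gaussianReal 0 (((n + 1 : ℕ) : NNReal) + ((n + 1 : ℕ) : NNReal)) with hγ
  set θ := gaussianReal 0 ((n + 1 : ℕ) : NNReal) with hθ
  set C : ℝ := (√(2 * Real.pi * (2 * (n + 1))))⁻¹ * √(2 * Real.pi * (n + 1 : ℝ)⁻¹) with hC
  have hCpos : 0 < C := by positivity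
  set q : ℝ → ℝ := fun ξ => ∫ u, κ u * Real.cos (ξ * u) ∂γ with hq
  have hq0 : ∀ ξ, 0 ≤ q ξ := fun ξ => hκ.integral_mul_cos_nonneg _ ξ
  have hqm : Measurable q := by
    have : StronglyMeasurable (Function.uncurry fun ξ u : ℝ => κ u * Real.cos (ξ * u)) :=
      Continuous.stronglyMeasurable (by unfold Function.uncurry; fun_prop)
    exact this.integral_prod_right.measurable
  have hZ : 0 < C * J 0 := mul_pos hCpos hpos
  have hθexp : ∀ s : ℝ, ∫ ξ, Complex.exp (s * ξ * Complex.I) ∂θ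
      = Real.exp (-((n + 1) * s ^ 2 / 2)) := by
    intro s
    rw [← charFun_apply_real, hθ, charFun_gaussianReal]
    push_cast
    congr 1
    ring
  have hexpint : ∀ s : ℝ, Integrable (fun ξ : ℝ => Complex.exp (s * ξ * Complex.I)) θ := by
    intro s
    refine Integrable.of_bound (C := 1) (Continuous.aestronglyMeasurable (by fun_prop))
      (Eventually.of_forall fun ξ => ?_)
    rw [← Complex.ofReal_mul, Complex.norm_exp_ofReal_mul_I]
  have hfourier : ∀ t : ℝ, ∫ ξ, Complex.exp (t * ξ * Complex.I) * q ξ ∂θ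
      = ((C * ((J t + J (-t)) / 2) : ℝ) : ℂ) := by
    intro t
    have h1 : ∀ ξ : ℝ, Complex.exp (t * ξ * Complex.I) * q ξ
        = ∫ u, Complex.exp (t * ξ * Complex.I) * ((κ u * Real.cos (ξ * u) : ℝ) : ℂ) ∂γ := by
      intro ξ
      rw [integral_const_mul, integral_complex_ofReal]
    simp only [h1]
    rw [integral_integral_swap]
    · have h2 : ∀ u : ℝ, ∫ ξ, Complex.exp (t * ξ * Complex.I)
          * ((κ u * Real.cos (ξ * u) : ℝ) : ℂ) ∂θ
          = (((κ u * Real.exp (-((n + 1) * (t - u) ^ 2 / 2))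
            + κ u * Real.exp (-((n + 1) * (-t - u) ^ 2 / 2))) / 2 : ℝ) : ℂ) := by
        intro u
        have h3 : ∀ ξ : ℝ, Complex.exp (t * ξ * Complex.I) * ((κ u * Real.cos (ξ * u) : ℝ) : ℂ)
            = κ u / 2 * (Complex.exp (((t + u : ℝ) : ℂ) * ξ * Complex.I)
              + Complex.exp (((t - u : ℝ) : ℂ) * ξ * Complex.I)) := by
          intro ξ
          have e1 : Complex.exp (((t + u : ℝ) : ℂ) * ξ * Complex.I)
              = Complex.exp (t * ξ * Complex.I) * Complex.exp (ξ * u * Complex.I) := by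
            rw [← Complex.exp_add]; push_cast; congr 1; ring
          have e2 : Complex.exp (((t - u : ℝ) : ℂ) * ξ * Complex.I)
              = Complex.exp (t * ξ * Complex.I) * Complex.exp (-(ξ * u) * Complex.I) := by
            rw [← Complex.exp_add]; push_cast; congr 1; ring
          rw [e1, e2]
          push_cast
          rw [Complex.cos]
          ring
        simp only [h3]
        rw [integral_const_mul, integral_add (hexpint _) (hexpint _), hθexp, hθexp,
          show (-t - u) ^ 2 = (t + u) ^ 2 by ring]
        push_cast
        ring
      simp only [h2]
      rw [integral_complex_ofReal, integral_div]
      congr 1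
      have hi : ∀ s : ℝ, Integrable (fun u => κ u * Real.exp (-((n + 1) * (s - u) ^ 2 / 2))) γ := by
        intro s
        refine Integrable.of_bound (C := 1) (Continuous.aestronglyMeasurable (by fun_prop))
          (Eventually.of_forall fun u => ?_)
        rw [norm_mul]
        refine mul_le_one₀ (hκ.abs_le_one _) (norm_nonneg _) ?_
        rw [Real.norm_eq_abs, Real.abs_exp, Real.exp_le_one_iff]
        exact neg_nonpos.2 (by positivity)
      rw [integral_add (hi t) (hi (-t)), hκ.integral_gaussianReal_eq_average n t,
        hκ.integral_gaussianReal_eq_average n (-t)]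
      ring
    · refine Integrable.of_bound (C := 1) (Continuous.aestronglyMeasurable
        (by unfold Function.uncurry; fun_prop)) (Eventually.of_forall fun p => ?_)
      simp only [Function.uncurry]
      rw [norm_mul, ← Complex.ofReal_mul, Complex.norm_exp_ofReal_mul_I, one_mul,
        Complex.norm_real, norm_mul]
      exact mul_le_one₀ (hκ.abs_le_one _) (norm_nonneg _) (Real.abs_cos_le_one _)
  set μ : Measure ℝ := θ.withDensity fun ξ => ENNReal.ofReal (q ξ / (C * J 0)) with hμ
  have hμint : ∀ t : ℝ, ∫ ξ, Complex.exp (t * ξ * Complex.I) ∂μ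
      = (((J t + J (-t)) / 2 / J 0 : ℝ) : ℂ) := by
    intro t
    rw [hμ, integral_withDensity_eq_integral_toReal_smul
      ((hqm.div_const _).ennreal_ofReal) (Eventually.of_forall fun _ => ENNReal.ofReal_lt_top)]
    have h1 : ∀ ξ : ℝ, (ENNReal.ofReal (q ξ / (C * J 0))).toReal
        • Complex.exp (t * ξ * Complex.I)
        = ((C * J 0 : ℝ) : ℂ)⁻¹ * (Complex.exp (t * ξ * Complex.I) * q ξ) := by
      intro ξ
      rw [ENNReal.toReal_ofReal (div_nonneg (hq0 ξ) hZ.le), Complex.real_smul]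
      push_cast
      ring
    simp only [h1]
    rw [integral_const_mul, hfourier, ← Complex.ofReal_inv, ← Complex.ofReal_mul]
    congr 1
    have := hpos.ne'
    change J 0 ≠ 0 at this
    field_simp
  have hqint : Integrable (fun ξ => q ξ / (C * J 0)) θ := by
    refine Integrable.div_const ?_ _
    refine Integrable.of_bound (C := 1) hqm.aestronglyMeasurable (Eventually.of_forall fun ξ => ?_)
    have := norm_integral_le_of_norm_le_const (μ := γ) (C := 1)
      (f := fun u => κ u * Real.cos (ξ * u)) (Eventually.of_forall fun u => by
        rw [norm_mul]
        exact mul_le_one₀ (hκ.abs_le_one _) (norm_nonneg _) (Real.abs_cos_le_one _))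
    simpa using this
  have hfin : IsFiniteMeasure μ := isFiniteMeasure_withDensity_ofReal hqint.hasFiniteIntegral
  have hprob : IsProbabilityMeasure μ := by
    have h1 := hμint 0
    have h2 : J 0 ≠ 0 := hpos.ne'
    simp [h2] at h1
    rw [isProbabilityMeasure_iff_real]
    exact_mod_cast h1
  refine ⟨⟨μ, hprob⟩, fun t => ?_⟩
  rw [charFun_apply_real]
  exact hμint t

/-- **Bochner's theorem.** -/
theorem exists_spectralMeasure : ∃ μ : Measure ℝ, IsProbabilityMeasure μ ∧
    ∀ t, ∫ ξ, Real.cos (t * ξ) ∂μ = κ t := by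
  -- The normalizing averages tend to κ(0) = 1, so they are positive from some `N` on and the
  -- indices are shifted by `N`.
  have h0 := (hκ.tendsto_gaussianAverage 0).eventually (lt_mem_nhds (a := 0) (by simp [hκ.zero]))
  obtain ⟨N, hN⟩ := eventually_atTop.1 h0
  choose μ hμ using fun n : ℕ => hκ.exists_probabilityMeasure_charFun (n + N) (hN _ (by omega))
  have hlim : ∀ t, Tendsto (fun n => charFun (μ n : Measure ℝ) t) atTop (𝓝 (κ t : ℂ)) := by
    intro t
    simp only [hμ]
    have h1 := (((hκ.tendsto_gaussianAverage t).add (hκ.tendsto_gaussianAverage (-t))).div_const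
      2).div (hκ.tendsto_gaussianAverage 0) (by simp [hκ.zero])
    have h2 := (tendsto_add_atTop_iff_nat N).2 h1
    have h3 := (Complex.continuous_ofReal.tendsto _).comp h2
    have h4 : (κ t + κ (-t)) / 2 / κ 0 = κ t := by
      rw [hκ.zero, hκ.even]
      ring
    rw [h4] at h3
    exact h3
  -- Continuity of κ at 0 prevents loss of mass. As the characteristic functions already converge to
  -- κ, any cluster point of the measures will do, and an ultrafilter provides one.
  have htight := isTightMeasureSet_of_tendsto_charFun (μ := fun n => (μ n : Measure ℝ))
    (f := fun t => (κ t : ℂ)) (Complex.continuous_ofReal.comp hκ.continuous).continuousAt hlim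
  have hcomp : IsCompact (closure (Set.range μ)) :=
    isCompact_closure_of_isTightMeasureSet (by
      convert htight using 1
      ext ν
      simp)
  obtain ⟨μ', -, hμ'⟩ := hcomp.ultrafilter_le_nhds ((hyperfilter ℕ).map μ)
    ((Filter.le_principal_iff.2 (by
      rw [Ultrafilter.coe_map, Filter.mem_map]
      exact Filter.mem_of_superset Filter.univ_mem fun n _ => subset_closure ⟨n, rfl⟩)))
  have hμ'' : Tendsto μ (hyperfilter ℕ) (𝓝 μ') := hμ'
  refine ⟨μ', inferInstance, fun t => ?_⟩
  have h1 : Tendsto (fun n => charFun (μ n : Measure ℝ) t) (hyperfilter ℕ)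
      (𝓝 (charFun (μ' : Measure ℝ) t)) := by
    rw [ProbabilityMeasure.tendsto_iff_forall_integral_rclike_tendsto ℂ] at hμ''
    simp_rw [charFun_eq_integral_innerProbChar]
    exact hμ'' _
  have h2 := tendsto_nhds_unique h1 ((hlim t).mono_left (Nat.hyperfilter_le_atTop))
  rw [charFun_apply_real] at h2
  have h3 := congrArg Complex.re h2
  rw [Complex.ofReal_re] at h3
  rw [← h3]
  have hint : Integrable (fun x : ℝ => Complex.exp (t * x * Complex.I)) (μ' : Measure ℝ) := by
    refine Integrable.of_bound (C := 1) (Continuous.aestronglyMeasurable (by fun_prop))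
      (Eventually.of_forall fun ξ => ?_)
    rw [← Complex.ofReal_mul, Complex.norm_exp_ofReal_mul_I]
  have h4 := integral_re hint
  simp only [RCLike.re_to_complex] at h4
  rw [← h4]
  refine integral_congr_ae (Eventually.of_forall fun ξ => ?_)
  simp only
  rw [← Complex.ofReal_mul, Complex.exp_ofReal_mul_I_re]

end IsPosDefFun

/-! ### Absence of atoms of the spectral measure -/

/-- As a sum of squares, this kernel is nonnegative; it serves to detect atoms. -/
theorem sum_sum_cos_mul_cos {N : ℕ} (u v : Fin N → ℝ) :
    ∑ i, ∑ j, Real.cos (u i - u j) * Real.cos (v i - v j)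
      = (∑ i, Real.cos (u i) * Real.cos (v i)) ^ 2 + (∑ i, Real.cos (u i) * Real.sin (v i)) ^ 2
        + (∑ i, Real.sin (u i) * Real.cos (v i)) ^ 2
        + (∑ i, Real.sin (u i) * Real.sin (v i)) ^ 2 := by
  simp only [sq, Finset.sum_mul_sum, ← Finset.sum_add_distrib]
  refine Finset.sum_congr rfl fun i _ => Finset.sum_congr rfl fun j _ => ?_
  rw [Real.cos_sub, Real.cos_sub]
  ring

/-- From cos² = (1 + cos 2·)/2: half of the N² terms' mass remains, and the rest is a nonnegative
double sum. This is the height of the detecting kernel at the putative atom. -/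
theorem sq_card_le_sum_sum_cos_sq {N : ℕ} (u : Fin N → ℝ) :
    (N : ℝ) ^ 2 / 2 ≤ ∑ i, ∑ j, Real.cos (u i - u j) * Real.cos (u i - u j) := by
  have h1 : ∀ i j, Real.cos (u i - u j) * Real.cos (u i - u j)
      = 1 / 2 + 1 / 2 * (Real.cos (2 * u i - 2 * u j) * Real.cos (0 - 0)) := by
    intro i j
    rw [← mul_sub, Real.cos_two_mul]
    simp
    ring
  simp only [h1, Finset.sum_add_distrib, ← Finset.mul_sum]
  have h2 := sum_sum_cos_mul_cos (fun i => 2 * u i) (fun _ => (0 : ℝ))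
  rw [h2]
  simp only [Finset.sum_const, Finset.card_univ, Fintype.card_fin, nsmul_eq_mul]
  have h3 : (0 : ℝ) ≤ (∑ i, Real.cos (2 * u i) * Real.cos 0) ^ 2
      + (∑ i, Real.cos (2 * u i) * Real.sin 0) ^ 2
        + (∑ i, Real.sin (2 * u i) * Real.cos 0) ^ 2
        + (∑ i, Real.sin (2 * u i) * Real.sin 0) ^ 2 := by positivity
  nlinarith

/-- A measure whose Fourier transform vanishes at infinity has no atom. -/
theorem measure_singleton_eq_zero_of_tendsto {κ : ℝ → ℝ} (hκ : IsPosDefFun κ)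
    (hlim : Tendsto κ atTop (𝓝 0)) {μ : Measure ℝ} [IsProbabilityMeasure μ]
    (hμ : ∀ t, ∫ ξ, Real.cos (t * ξ) ∂μ = κ t) (ξ₀ : ℝ) : μ {ξ₀} = 0 := by
  have key : ∀ (N : ℕ) (ε : ℝ), 0 < ε → μ.real {ξ₀} * ((N : ℝ) ^ 2 / 2) ≤ N + N ^ 2 * ε := by
    intro N ε hε
    obtain ⟨T, hT⟩ := eventually_atTop.1 (Metric.tendsto_nhds.1 hlim ε hε)
    -- Distinct integer multiples of `L` lie at distance at least `T`, so κ is at most ε at their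
    -- differences. Nonnegativity of `L` keeps this true for non-consecutive multiples.
    set L : ℝ := max T 0 with hL
    have hfar : ∀ i j : Fin N, i ≠ j → |κ (L * (i : ℕ) - L * (j : ℕ))| ≤ ε := by
      have haux : ∀ i j : Fin N, i < j → |κ (L * (j : ℕ) - L * (i : ℕ))| ≤ ε := by
        intro i j hij
        have h1 : ((i : ℕ) : ℝ) + 1 ≤ (j : ℕ) := by exact_mod_cast hij
        have h2 : T ≤ L * (j : ℕ) - L * (i : ℕ) := by
          have h3 : T ≤ L := le_max_left _ _
          have h4 : 0 ≤ L := le_max_right _ _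
          nlinarith
        have := hT _ h2
        rw [Real.dist_eq, sub_zero] at this
        exact this.le
      intro i j hij
      rcases lt_or_gt_of_ne hij with h | h
      · rw [← hκ.even, neg_sub]
        exact haux i j h
      · exact haux j i h
    set t : Fin N → ℝ := fun i => L * (i : ℕ) with ht
    have hint : ∀ i j : Fin N, Integrable
        (fun ξ => Real.cos (ξ₀ * t i - ξ₀ * t j) * Real.cos (ξ * t i - ξ * t j)) μ := by
      intro i j
      refine Integrable.of_bound (C := 1) (Continuous.aestronglyMeasurable (by fun_prop))
        (Eventually.of_forall fun ξ => ?_)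
      rw [norm_mul]
      exact mul_le_one₀ (Real.abs_cos_le_one _) (norm_nonneg _) (Real.abs_cos_le_one _)
    -- Nonnegative and at least N²/2 at `ξ₀`, while its integral is a double sum of values of κ with
    -- bounded weights, thus at most N + N²ε.
    set Φ : ℝ → ℝ := fun ξ =>
      ∑ i, ∑ j, Real.cos (ξ₀ * t i - ξ₀ * t j) * Real.cos (ξ * t i - ξ * t j) with hΦ
    have hΦint : Integrable Φ μ :=
      integrable_finsetSum _ fun i _ => integrable_finsetSum _ fun j _ => hint i j
    have hΦ0 : ∀ ξ, 0 ≤ Φ ξ := by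
      intro ξ
      simp only [hΦ]
      rw [sum_sum_cos_mul_cos]
      positivity
    have hlow : μ.real {ξ₀} * ((N : ℝ) ^ 2 / 2) ≤ ∫ ξ, Φ ξ ∂μ := by
      calc μ.real {ξ₀} * ((N : ℝ) ^ 2 / 2) ≤ μ.real {ξ₀} * Φ ξ₀ := by
            gcongr
            exact sq_card_le_sum_sum_cos_sq fun i => ξ₀ * t i
        _ = ∫ ξ in {ξ₀}, Φ ξ ∂μ := by
            rw [integral_singleton]
            simp [Measure.real]
        _ ≤ ∫ ξ, Φ ξ ∂μ := setIntegral_le_integral hΦint (Eventually.of_forall hΦ0)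
    refine hlow.trans ?_
    have heq : ∫ ξ, Φ ξ ∂μ = ∑ i, ∑ j, Real.cos (ξ₀ * t i - ξ₀ * t j) * κ (t i - t j) := by
      simp only [hΦ]
      rw [integral_finsetSum _ fun i _ => integrable_finsetSum _ fun j _ => hint i j]
      refine Finset.sum_congr rfl fun i _ => ?_
      rw [integral_finsetSum _ fun j _ => hint i j]
      refine Finset.sum_congr rfl fun j _ => ?_
      rw [integral_const_mul, ← hμ]
      congr 1
      refine integral_congr_ae (Eventually.of_forall fun ξ => ?_)
      simp only
      congr 1
      ring
    rw [heq]
    have hterm : ∀ i j : Fin N, Real.cos (ξ₀ * t i - ξ₀ * t j) * κ (t i - t j)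
        ≤ (if i = j then 1 else 0) + ε := by
      intro i j
      split_ifs with hij
      · subst hij
        simp [hκ.zero, hε.le]
      · rw [zero_add]
        refine (le_abs_self _).trans ?_
        rw [abs_mul]
        calc _ ≤ 1 * ε := by
              gcongr
              · exact Real.abs_cos_le_one _
              · exact hfar i j hij
          _ = ε := one_mul _
    refine (Finset.sum_le_sum fun i _ => Finset.sum_le_sum fun j _ => hterm i j).trans_eq ?_
    simp [Finset.sum_add_distrib]
    ring
  have h0 : μ.real {ξ₀} ≤ 0 := by
    refine le_of_forall_pos_le_add fun δ hδ => ?_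
    -- With ε = δ/4, the estimate reads mass ≤ 2/N + δ/2, and N > 4/δ makes the first term less than
    -- δ/2.
    obtain ⟨N, hN⟩ := exists_nat_gt (4 / δ)
    have hNpos : (0 : ℝ) < N := (by positivity : (0 : ℝ) < 4 / δ).trans hN
    have h1 := key N (δ / 4) (by positivity)
    rw [div_lt_iff₀ hδ] at hN
    have h2 : μ.real {ξ₀} * N ≤ δ * N := by
      have h3 : (μ.real {ξ₀} * N) * N ≤ (2 + N * δ / 2) * N := by nlinarith
      have h4 := le_of_mul_le_mul_right h3 hNpos
      linarith
    have := le_of_mul_le_mul_right h2 hNpos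
    linarith
  have h1 : μ.real {ξ₀} = 0 := le_antisymm h0 measureReal_nonneg
  exact (measureReal_eq_zero_iff).1 h1

/-! ### Exponential polynomials -/

theorem iteratedDeriv_re_mul_exp (a : ℂ) (ξ : ℝ) (m : ℕ) :
    iteratedDeriv m (fun y : ℝ => (a * Complex.exp (ξ * y * Complex.I)).re)
      = fun y : ℝ => (a * (ξ * Complex.I) ^ m * Complex.exp (ξ * y * Complex.I)).re := by
  let G : ℕ → ℝ → ℝ := fun m y => (a * (ξ * Complex.I) ^ m * Complex.exp (ξ * y * Complex.I)).re
  have hG : ∀ k < m, ∀ y, HasDerivAt (G k) (G (k + 1) y) y := by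
    intro k _ y
    have h1 : HasDerivAt (fun y : ℝ => (ξ : ℂ) * y * Complex.I) (ξ * 1 * Complex.I) y :=
      ((Complex.ofRealCLM.hasDerivAt (x := y)).const_mul (ξ : ℂ)).mul_const Complex.I
    have h2 := h1.cexp.const_mul (a * (ξ * Complex.I) ^ k)
    have h3 := Complex.reCLM.hasFDerivAt.comp_hasDerivAt y h2
    refine h3.congr_deriv ?_
    simp only [G, Complex.reCLM_apply]
    congr 1
    ring
  have := iteratedDeriv_eq_of_hasDerivAt hG m le_rfl
  simpa [G] using this

theorem iteratedDeriv_cos_mul (ξ : ℝ) (m : ℕ) (y : ℝ) :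
    iteratedDeriv m (fun y => Real.cos (ξ * y)) y
      = ((ξ * Complex.I) ^ m * Complex.exp (ξ * y * Complex.I)).re := by
  have := congrFun (iteratedDeriv_re_mul_exp 1 ξ m) y
  rw [one_mul] at this
  rw [← this]
  congr 1
  funext y
  rw [one_mul, ← Complex.ofReal_mul, Complex.exp_ofReal_mul_I_re]

theorem iteratedDeriv_sin_mul (ξ : ℝ) (m : ℕ) (y : ℝ) :
    iteratedDeriv m (fun y => Real.sin (ξ * y)) y
      = ((ξ * Complex.I) ^ m * Complex.exp (ξ * y * Complex.I)).im := by
  have h1 : ∀ z : ℂ, (-Complex.I * z).re = z.im := by simp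
  have := congrFun (iteratedDeriv_re_mul_exp (-Complex.I) ξ m) y
  rw [mul_assoc, h1] at this
  rw [← this]
  congr 1
  funext y
  rw [h1, ← Complex.ofReal_mul, Complex.exp_ofReal_mul_I_im]

theorem iteratedDeriv_pow_eq {𝔸 : Type*} [NormedField 𝔸] [NormedAlgebra ℝ 𝔸] (m j : ℕ) :
    iteratedDeriv j (fun ξ : ℝ => (algebraMap ℝ 𝔸 ξ) ^ m)
      = fun ξ => (m.descFactorial j : 𝔸) * (algebraMap ℝ 𝔸 ξ) ^ (m - j) := by
  let G : ℕ → ℝ → 𝔸 := fun j ξ => (m.descFactorial j : 𝔸) * (algebraMap ℝ 𝔸 ξ) ^ (m - j)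
  have hG : ∀ k < j, ∀ y, HasDerivAt (G k) (G (k + 1) y) y := by
    intro k _ y
    have h0 : HasDerivAt (fun ξ : ℝ => algebraMap ℝ 𝔸 ξ) 1 y := by
      have := (Algebra.linearMap ℝ 𝔸).toContinuousLinearMap.hasDerivAt (x := y)
      exact this.congr_deriv (by simp)
    refine ((h0.pow (m - k)).const_mul (m.descFactorial k : 𝔸)).congr_deriv ?_
    simp only [G, Nat.descFactorial_succ, Nat.sub_sub]
    push_cast
    ring
  have := iteratedDeriv_eq_of_hasDerivAt hG j le_rfl
  simpa [G] using this

/-- Both sides are, up to the order of derivation, the mixed derivative of e^{iξy} of order k in ξ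
at 0 and order m in y at z. In the Leibniz expansion only the term differentiating ξ^m exactly m
times survives at 0. -/
theorem iteratedDeriv_pow_mul_exp_zero (z : ℝ) (m k : ℕ) :
    iteratedDeriv k (fun ξ : ℝ => (ξ * Complex.I) ^ m * Complex.exp (ξ * z * Complex.I)) 0
      = Complex.I ^ k * (iteratedDeriv m (fun y : ℝ => y ^ k) z : ℝ) := by
  have hexp : ∀ j, iteratedDeriv j (fun ξ : ℝ => Complex.exp (ξ * z * Complex.I))
      = fun ξ : ℝ => (z * Complex.I) ^ j * Complex.exp (ξ * z * Complex.I) := by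
    intro j
    let G : ℕ → ℝ → ℂ := fun j ξ => (z * Complex.I) ^ j * Complex.exp (ξ * z * Complex.I)
    have hG : ∀ k < j, ∀ y, HasDerivAt (G k) (G (k + 1) y) y := by
      intro k _ y
      have h1 : HasDerivAt (fun y : ℝ => (y : ℂ) * z * Complex.I) (1 * z * Complex.I) y :=
        ((Complex.ofRealCLM.hasDerivAt (x := y)).mul_const (z : ℂ)).mul_const Complex.I
      refine (h1.cexp.const_mul ((z * Complex.I) ^ k)).congr_deriv ?_
      simp only [G]
      ring
    have := iteratedDeriv_eq_of_hasDerivAt hG j le_rfl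
    simpa [G] using this
  have hpow := iteratedDeriv_pow_eq (𝔸 := ℂ) m
  simp only [Complex.coe_algebraMap] at hpow
  have hsplit : (fun ξ : ℝ => ((ξ : ℂ) * Complex.I) ^ m * Complex.exp (ξ * z * Complex.I))
      = Complex.I ^ m • ((fun ξ : ℝ => (ξ : ℂ) ^ m)
          * fun ξ : ℝ => Complex.exp (ξ * z * Complex.I)) := by
    funext ξ
    simp only [Pi.mul_apply, Pi.smul_apply, smul_eq_mul]
    ring
  have hs1 : ContDiff ℝ k (fun ξ : ℝ => (ξ : ℂ) ^ m) := Complex.ofRealCLM.contDiff.pow m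
  have hs2 : ContDiff ℝ k (fun ξ : ℝ => Complex.exp (ξ * z * Complex.I)) :=
    ((Complex.ofRealCLM.contDiff.mul contDiff_const).mul contDiff_const).cexp
  rw [hsplit, iteratedDeriv_const_smul_field, smul_eq_mul,
    iteratedDeriv_mul hs1.contDiffAt hs2.contDiffAt]
  simp only [hpow, hexp]
  have hreal := congrFun (iteratedDeriv_pow_eq (𝔸 := ℝ) k m) z
  simp only [Algebra.algebraMap_self, RingHom.id_apply] at hreal
  rw [hreal]
  rcases lt_or_ge k m with hkm | hkm
  · rw [Nat.descFactorial_eq_zero_iff_lt.2 hkm, Finset.sum_eq_zero]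
    · simp
    · intro j hj
      rw [Finset.mem_range] at hj
      have : m - j ≠ 0 := by omega
      simp [this]
  · rw [Finset.sum_eq_single m]
    · rw [Nat.descFactorial_self, Nat.sub_self, Nat.descFactorial_eq_factorial_mul_choose]
      have hI : Complex.I ^ k = Complex.I ^ m * Complex.I ^ (k - m) := by
        rw [← pow_add, Nat.add_sub_cancel' hkm]
      rw [hI]
      simp
      ring
    · intro j _ hj
      rcases lt_or_gt_of_ne hj with h | h
      · have : m - j ≠ 0 := by omega
        simp [this]
      · simp [Nat.descFactorial_eq_zero_iff_lt.2 h]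
    · intro h
      rw [Finset.mem_range] at h
      omega

/-- A functional given by finitely many derivatives which kills almost every trigonometric function
kills all monomials. -/
theorem sum_iteratedDeriv_pow_eq_zero {σ : Type*} [Fintype σ] (d z : σ → ℝ) (m : σ → ℕ)
    {μ : Measure ℝ} [IsProbabilityMeasure μ] (hμ : ∀ ξ, μ {ξ} = 0)
    (hcos : ∀ᵐ ξ ∂μ, ∑ l, d l * iteratedDeriv (m l) (fun y => Real.cos (ξ * y)) (z l) = 0)
    (hsin : ∀ᵐ ξ ∂μ, ∑ l, d l * iteratedDeriv (m l) (fun y => Real.sin (ξ * y)) (z l) = 0)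
    (k : ℕ) : ∑ l, d l * iteratedDeriv (m l) (fun y => y ^ k) (z l) = 0 := by
  -- The functional evaluated on y ↦ e^{iξy}, its cosine and sine parts being the two hypotheses.
  let h : ℝ → ℂ := fun ξ => ∑ l, (d l : ℂ) *
    ((ξ * Complex.I) ^ (m l) * Complex.exp (ξ * z l * Complex.I))
  have hae : ∀ᵐ ξ ∂μ, h ξ = 0 := by
    filter_upwards [hcos, hsin] with ξ h1 h2
    simp only [iteratedDeriv_cos_mul, iteratedDeriv_sin_mul] at h1 h2
    refine Complex.ext ?_ ?_
    · simp only [h, Complex.re_sum, Complex.re_ofReal_mul, Complex.zero_re, h1]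
    · simp only [h, Complex.im_sum, Complex.im_ofReal_mul, Complex.zero_im, h2]
  have han : AnalyticOnNhd ℝ h Set.univ := by
    intro ξ _
    have h1 : AnalyticAt ℝ (fun ξ : ℝ => (ξ : ℂ)) ξ := Complex.ofRealCLM.analyticAt ξ
    refine Finset.analyticAt_fun_sum _ fun l _ => ?_
    refine analyticAt_const.mul (((h1.mul analyticAt_const).pow _).mul ?_)
    exact AnalyticAt.fun_comp (g := Complex.exp)
      (analyticAt_cexp.restrictScalars (𝕜 := ℝ))
      ((h1.mul analyticAt_const).mul analyticAt_const)
  have hzero : ∀ ξ, h ξ = 0 := by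
    by_contra! hne
    obtain ⟨ξ, hξ⟩ := hne
    have h1 := han.preimage_zero_mem_codiscrete hξ
    -- A nonzero analytic function on the line has discrete, hence countable, zeros. Without atoms
    -- such a set is null, yet it has full measure.
    have hcount : (h ⁻¹' {0}).Countable := by
      have h2 : IsDiscrete (h ⁻¹' {0}) := by
        rw [← Set.inter_univ (h ⁻¹' {0})]
        refine isDiscrete_of_codiscreteWithin ?_
        rw [Set.preimage_compl] at h1
        exact h1
      have h3 : DiscreteTopology (h ⁻¹' {0}) := h2.to_subtype
      exact Set.countable_coe_iff.1 (TopologicalSpace.separableSpace_iff_countable.1 inferInstance)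
    have hnull : μ (h ⁻¹' {0}) = 0 := by
      rw [← Set.biUnion_of_singleton (h ⁻¹' {0})]
      exact (measure_biUnion_null_iff hcount).2 fun ξ _ => hμ ξ
    have hfull : μ (h ⁻¹' {0})ᶜ = 0 := hae
    have := measure_union_le (μ := μ) (h ⁻¹' {0}) (h ⁻¹' {0})ᶜ
    rw [Set.union_compl_self, measure_univ, hnull, hfull] at this
    simp at this
  -- The derivative of order k at ξ = 0 is i^k times the functional evaluated on y^k.
  have hd : iteratedDeriv k h 0 = 0 := by
    have : h = fun _ => 0 := funext hzero
    rw [this, iteratedDeriv_const]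
    simp
  have hsmooth : ∀ l, ContDiff ℝ k
      (fun ξ : ℝ => (ξ * Complex.I) ^ (m l) * Complex.exp (ξ * z l * Complex.I)) := by
    intro l
    exact ((Complex.ofRealCLM.contDiff.mul contDiff_const).pow _).mul
      ((Complex.ofRealCLM.contDiff.mul contDiff_const).mul contDiff_const).cexp
  rw [iteratedDeriv_fun_sum fun l _ => (contDiff_const.mul (hsmooth l)).contDiffAt] at hd
  simp only [iteratedDeriv_const_mul _ (hsmooth _).contDiffAt, iteratedDeriv_pow_mul_exp_zero] at hd
  have hfac : ∑ l, (d l : ℂ) * (Complex.I ^ k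
      * ((iteratedDeriv (m l) (fun y : ℝ => y ^ k) (z l) : ℝ) : ℂ))
      = Complex.I ^ k * ((∑ l, d l * iteratedDeriv (m l) (fun y => y ^ k) (z l) : ℝ) : ℂ) := by
    push_cast
    rw [Finset.mul_sum]
    exact Finset.sum_congr rfl fun l _ => by ring
  rw [hfac] at hd
  have := (mul_eq_zero.1 hd).resolve_left (pow_ne_zero _ Complex.I_ne_zero)
  exact_mod_cast this

/-! ### Non-degeneracy of divided differences -/

section Nondegeneracy

variable {Ω : Type*} [MeasurableSpace Ω] {P : Measure Ω} [IsProbabilityMeasure P]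
  {f : ℝ → Ω → ℝ}

omit [IsProbabilityMeasure P] in
theorem integral_mul_eq_corr (hf : IsStationaryCenteredGaussian f P) (s t : ℝ) :
    ∫ ω, f s ω * f t ω ∂P = corr f P (t - s) := by
  let S : Finset ℝ := {0, t - s}
  let i : S := ⟨0, by simp [S]⟩
  let j : S := ⟨t - s, by simp [S]⟩
  have hm : Measurable fun x : S → ℝ => x i * x j := by fun_prop
  have h := congrArg (fun ν : Measure (S → ℝ) => ∫ x, x i * x j ∂ν) (hf.stationary s S)
  rw [integral_map (aemeasurable_pi_lambda _ fun u => hf.gaussian.aemeasurable _)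
      hm.aestronglyMeasurable,
    integral_map (aemeasurable_pi_lambda _ fun u => hf.gaussian.aemeasurable _)
      hm.aestronglyMeasurable] at h
  simpa [i, j, corr] using h

/-- Continuity is inherited from the trajectories through the Gaussian limit theorem, without any
appeal to derivatives of the correlation; positivity is that of the second moment of Σ c_i f(t_i).
-/
theorem isPosDefFun_corr (hf : IsStationaryCenteredGaussian f P) (hnorm : IsNormalized f P)
    (h0 : IsOfClass 0 f P) : IsPosDefFun (corr f P) where
  continuous := by
    rw [continuous_iff_seqContinuous]
    intro s x hs
    refine gaussianSpace_tendsto_integral_mul hf (fun _ => mem_gaussianSpace 0)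
      (fun k => mem_gaussianSpace (s k)) (mem_gaussianSpace 0) (mem_gaussianSpace x)
      (Eventually.of_forall fun _ => tendsto_const_nhds) ?_
    filter_upwards [h0] with ω hω
    exact (hω.continuous.tendsto x).comp hs
  zero := hnorm.1
  even t := by
    rw [← zero_sub, ← integral_mul_eq_corr hf t 0]
    simp only [corr, mul_comm]
  nonneg N t c := by
    have h1 : ∀ i j, c i * c j * corr f P (t i - t j)
        = ∫ ω, (c j * f (t j) ω) * (c i * f (t i) ω) ∂P := by
      intro i j
      rw [← integral_mul_eq_corr hf, ← integral_const_mul]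
      refine integral_congr_ae (Eventually.of_forall fun ω => ?_)
      ring
    have hint : ∀ i j, Integrable (fun ω => (c j * f (t j) ω) * (c i * f (t i) ω)) P := fun i j =>
      gaussianSpace_integrable_mul hf (Submodule.smul_mem _ (c j) (mem_gaussianSpace (t j)))
        (Submodule.smul_mem _ (c i) (mem_gaussianSpace (t i)))
    simp only [h1]
    simp_rw [← integral_finsetSum _ fun j _ => hint _ j]
    rw [← integral_finsetSum _ fun i _ => integrable_finsetSum _ fun j _ => hint i j]
    refine integral_nonneg fun ω => ?_
    simp only [Pi.zero_apply, ← Finset.sum_mul, ← Finset.mul_sum]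
    exact mul_self_nonneg _

/-- The spectral isometry: stationarity makes both sides the quadratic form with coefficients κ(t_j
- t_i). -/
theorem integral_sum_sq_eq_spectral (hf : IsStationaryCenteredGaussian f P) {μ : Measure ℝ}
    [IsProbabilityMeasure μ] (hμ : ∀ t, ∫ ξ, Real.cos (t * ξ) ∂μ = corr f P t)
    {σ : Type*} [Fintype σ] (c t : σ → ℝ) :
    ∫ ω, (∑ l, c l * f (t l) ω) ^ 2 ∂P
      = ∫ ξ, ((∑ l, c l * Real.cos (ξ * t l)) ^ 2 + (∑ l, c l * Real.sin (ξ * t l)) ^ 2) ∂μ := by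
  have hint : ∀ i j, Integrable (fun ω => (c i * f (t i) ω) * (c j * f (t j) ω)) P := fun i j =>
    gaussianSpace_integrable_mul hf (Submodule.smul_mem _ (c i) (mem_gaussianSpace (t i)))
      (Submodule.smul_mem _ (c j) (mem_gaussianSpace (t j)))
  have hint' : ∀ i j, Integrable (fun ξ => c i * c j * Real.cos ((t j - t i) * ξ)) μ := by
    intro i j
    refine Integrable.const_mul ?_ _
    exact Integrable.of_bound (C := 1) (Continuous.aestronglyMeasurable (by fun_prop))
      (Eventually.of_forall fun ξ => Real.abs_cos_le_one _)
  have hR : ∀ ξ, (∑ l, c l * Real.cos (ξ * t l)) ^ 2 + (∑ l, c l * Real.sin (ξ * t l)) ^ 2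
      = ∑ i, ∑ j, c i * c j * Real.cos ((t j - t i) * ξ) := by
    intro ξ
    simp only [sq, Finset.sum_mul_sum, ← Finset.sum_add_distrib]
    refine Finset.sum_congr rfl fun i _ => Finset.sum_congr rfl fun j _ => ?_
    rw [sub_mul, Real.cos_sub, mul_comm (t j), mul_comm (t i)]
    ring
  simp only [hR]
  simp only [sq, Finset.sum_mul_sum]
  rw [integral_finsetSum _ fun i _ => integrable_finsetSum _ fun j _ => hint i j,
    integral_finsetSum _ fun i _ => integrable_finsetSum _ fun j _ => hint' i j]
  refine Finset.sum_congr rfl fun i _ => ?_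
  rw [integral_finsetSum _ fun j _ => hint i j, integral_finsetSum _ fun j _ => hint' i j]
  refine Finset.sum_congr rfl fun j _ => ?_
  rw [integral_const_mul, hμ, ← integral_mul_eq_corr hf, ← integral_const_mul]
  refine integral_congr_ae (Eventually.of_forall fun ω => ?_)
  simp only
  ring

/-- The first `k + 1` points of a finite sequence. -/
def initPoints {N : ℕ} (y : Fin N → ℝ) (k : Fin N) : Fin (k + 1) → ℝ :=
  fun j => y (Fin.castLE k.2 j)

theorem initPoints_injective {N : ℕ} {y : Fin N → ℝ} (hy : Function.Injective y) (k : Fin N) :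
    Function.Injective (initPoints y k) := fun _ _ h => Fin.castLE_injective k.2 (hy h)

theorem tendsto_initPoints {N : ℕ} {y : Fin N → ℝ} {s : ℕ → Fin N → ℝ}
    (hs : Tendsto s atTop (𝓝 y)) (k : Fin N) :
    Tendsto (fun n => initPoints (s n) k) atTop (𝓝 (initPoints y k)) := by
  rw [tendsto_pi_nhds] at hs ⊢
  exact fun j => hs _

/-- The system is triangular with unit diagonal: on t^m, the divided difference at m + 1 nodes is 1
and those at more nodes are 0, so the coefficients vanish one after the other. -/
theorem eq_zero_of_sum_divDiff_pow_eq_zero {N : ℕ} (y c : Fin N → ℝ)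
    (h : ∀ m : ℕ, ∑ k, c k * divDiff (fun t => t ^ m) (initPoints y k) = 0) : c = 0 := by
  have key : ∀ m : ℕ, ∀ k : Fin N, (k : ℕ) = m → c k = 0 := by
    intro m
    induction m using Nat.strong_induction_on with
    | _ m ih =>
      intro k hk
      have := h m
      rw [Finset.sum_eq_single k] at this
      · subst hk
        rwa [divDiff_monomial_self, mul_one] at this
      · intro j _ hj
        rcases lt_or_gt_of_ne (fun h => hj (Fin.ext h) : (j : ℕ) ≠ (k : ℕ)) with hjk | hjk
        · rw [ih j (by omega) j rfl, zero_mul]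
        · rw [divDiff_monomial_of_lt _ (by omega), mul_zero]
      · simp
  exact funext fun k => key k k rfl

/-- The divided differences of `f` along a finite sequence of points are linearly independent in
`L²`. -/
theorem eq_zero_of_integral_sum_divDiff_sq (hf : IsStationaryCenteredGaussian f P)
    (hnorm : IsNormalized f P) (hlim : Tendsto (corr f P) atTop (𝓝 0)) {n N : ℕ}
    (hn : IsOfClass n f P) (hN : N ≤ n + 1) (y c : Fin N → ℝ)
    (h : ∫ ω, (∑ k, c k * divDiff (path f ω) (initPoints y k)) ^ 2 ∂P = 0) : c = 0 := by
  have hpd := isPosDefFun_corr hf hnorm (hn.mono (Nat.zero_le n))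
  obtain ⟨μ, hprob, hμ⟩ := hpd.exists_spectralMeasure
  have hatom := measure_singleton_eq_zero_of_tendsto hpd hlim hμ
  obtain ⟨s, hs, hsy⟩ := exists_seq_injective_tendsto y
  have hmem : ∀ (z : Fin N → ℝ) (k : Fin N),
      (fun ω => divDiff (path f ω) (initPoints z k)) ∈ gaussianSpace f P := fun z k =>
    divDiff_path_mem_gaussianSpace hn (by have := k.2; omega) _
  have hconv : Tendsto (fun j => ∫ ω, (∑ k, c k * divDiff (path f ω) (initPoints (s j) k)) ^ 2 ∂P)
      atTop (𝓝 0) := by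
    rw [← h]
    refine gaussianSpace_tendsto_integral_sq hf
      (fun j => sum_mul_mem_gaussianSpace (hmem (s j)) c) ?_
    have : ∀ᵐ ω ∂P, ∀ k, Tendsto (fun j => divDiff (path f ω) (initPoints (s j) k)) atTop
        (𝓝 (divDiff (path f ω) (initPoints y k))) := by
      rw [ae_all_iff]
      intro k
      exact tendsto_divDiff_path hn (by have := k.2; omega) (tendsto_initPoints hsy k)
    filter_upwards [this] with ω hω
    exact tendsto_finsetSum _ fun k _ => (hω k).const_mul _
  -- The squared modulus of the functional on e^{iξt}, whose integral against μ is the variance. The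
  -- identity is available only for distinct nodes, where the functional is a combination of values.
  let F : (Fin N → ℝ) → ℝ → ℝ := fun z ξ =>
    (∑ k, c k * divDiff (fun t => Real.cos (ξ * t)) (initPoints z k)) ^ 2
      + (∑ k, c k * divDiff (fun t => Real.sin (ξ * t)) (initPoints z k)) ^ 2
  have hF0 : ∀ z ξ, 0 ≤ F z ξ := fun z ξ => by positivity
  -- the functional is a combination of evaluations off the diagonal
  have hexp : ∀ j, ∃ d t : (Σ k : Fin N, Fin (k + 1)) → ℝ, ∀ g : ℝ → ℝ,
      ∑ k, c k * divDiff g (initPoints (s j) k) = ∑ l, d l * g (t l) := by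
    intro j
    refine ⟨fun l => c l.1 * (∏ i ∈ Finset.univ.erase l.2,
      (initPoints (s j) l.1 l.2 - initPoints (s j) l.1 i))⁻¹,
      fun l => initPoints (s j) l.1 l.2, fun g => ?_⟩
    rw [Fintype.sum_sigma]
    refine Finset.sum_congr rfl fun k _ => ?_
    rw [divDiff_of_injective (initPoints_injective (hs j) k), Finset.mul_sum]
    refine Finset.sum_congr rfl fun i _ => ?_
    ring
  have hspec : ∀ j, Continuous (F (s j)) ∧
      ∫ ω, (∑ k, c k * divDiff (path f ω) (initPoints (s j) k)) ^ 2 ∂P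
        = ∫ ξ, F (s j) ξ ∂μ := by
    intro j
    obtain ⟨d, t, hdt⟩ := hexp j
    simp only [F, hdt]
    exact ⟨by fun_prop, integral_sum_sq_eq_spectral hf hμ d t⟩
  have hFint : ∀ j, Integrable (F (s j)) μ := by
    intro j
    obtain ⟨d, t, hdt⟩ := hexp j
    refine Integrable.of_bound (C := (∑ l, |d l|) ^ 2 + (∑ l, |d l|) ^ 2)
      (hspec j).1.aestronglyMeasurable (Eventually.of_forall fun ξ => ?_)
    rw [Real.norm_of_nonneg (hF0 _ _)]
    simp only [F, hdt]
    have hb : ∀ u : (Σ k : Fin N, Fin (k + 1)) → ℝ, (∀ l, |u l| ≤ 1) →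
        (∑ l, d l * u l) ^ 2 ≤ (∑ l, |d l|) ^ 2 := by
      intro u hu
      refine sq_le_sq' ?_ ?_
      · rw [neg_le]
        refine (neg_le_abs _).trans ((Finset.abs_sum_le_sum_abs _ _).trans ?_)
        refine Finset.sum_le_sum fun l _ => ?_
        rw [abs_mul]
        exact mul_le_of_le_one_right (abs_nonneg _) (hu l)
      · refine (le_abs_self _).trans ((Finset.abs_sum_le_sum_abs _ _).trans ?_)
        refine Finset.sum_le_sum fun l _ => ?_
        rw [abs_mul]
        exact mul_le_of_le_one_right (abs_nonneg _) (hu l)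
    exact add_le_add (hb _ fun l => Real.abs_cos_le_one _) (hb _ fun l => Real.abs_sin_le_one _)
  have hpt : ∀ ξ, Tendsto (fun j => F (s j) ξ) atTop (𝓝 (F y ξ)) := by
    intro ξ
    have hg : ∀ g : ℝ → ℝ, (∀ k : ℕ, ContDiff ℝ k g) →
        Tendsto (fun j => ∑ k, c k * divDiff g (initPoints (s j) k)) atTop
          (𝓝 (∑ k, c k * divDiff g (initPoints y k))) := fun g hg =>
      tendsto_finsetSum _ fun k _ => (((continuous_divDiff (hg k)).tendsto _).comp
        (tendsto_initPoints hsy k)).const_mul _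
    exact ((hg _ fun k => Real.contDiff_cos.comp (contDiff_const.mul contDiff_id)).pow 2).add
      ((hg _ fun k => Real.contDiff_sin.comp (contDiff_const.mul contDiff_id)).pow 2)
  -- Fatou's lemma is enough, as only the vanishing of the limit is wanted; it dispenses with moment
  -- bounds on μ, which the confluent functional would otherwise call for.
  have hFy : ∀ᵐ ξ ∂μ, F y ξ = 0 := by
    have h1 : ∫⁻ ξ, liminf (fun j => ENNReal.ofReal (F (s j) ξ)) atTop ∂μ ≤ 0 := by
      refine (lintegral_liminf_le fun j => (hspec j).1.measurable.ennreal_ofReal).trans ?_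
      have h2 : Tendsto (fun j => ∫⁻ ξ, ENNReal.ofReal (F (s j) ξ) ∂μ) atTop (𝓝 0) := by
        simp only [← ofReal_integral_eq_lintegral_ofReal (hFint _)
          (Eventually.of_forall (hF0 _)), ← (hspec _).2]
        have h6 := (ENNReal.continuous_ofReal.tendsto _).comp hconv
        rw [ENNReal.ofReal_zero] at h6
        exact h6
      rw [h2.liminf_eq]
    have h3 : ∀ ξ, liminf (fun j => ENNReal.ofReal (F (s j) ξ)) atTop = ENNReal.ofReal (F y ξ) :=
      fun ξ => ((ENNReal.continuous_ofReal.tendsto _).comp (hpt ξ)).liminf_eq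
    have h4 : Measurable fun ξ => liminf (fun j => ENNReal.ofReal (F (s j) ξ)) atTop :=
      Measurable.liminf fun j => (hspec j).1.measurable.ennreal_ofReal
    have h5 := (lintegral_eq_zero_iff h4).1 (le_antisymm h1 (zero_le))
    filter_upwards [h5] with ξ hξ
    rw [h3] at hξ
    exact le_antisymm (ENNReal.ofReal_eq_zero.1 hξ) (hF0 _ _)
  -- At the confluent nodes the functional is a combination of derivatives at finitely many points,
  -- the form to which the analyticity argument applies.
  choose w hw using fun k : Fin N => exists_divDiff_eq_sum (initPoints y k)
  let d : (Σ k : Fin N, Fin (k + 1)) → ℝ := fun l =>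
    c l.1 * (w l.1 l.2 / (priorCount (initPoints y l.1) l.2).factorial)
  have hform : ∀ g : ℝ → ℝ, ∑ k, c k * divDiff g (initPoints y k)
      = ∑ l : (Σ k : Fin N, Fin (k + 1)), d l *
        iteratedDeriv (priorCount (initPoints y l.1) l.2) g (initPoints y l.1 l.2) := by
    intro g
    rw [Fintype.sum_sigma]
    refine Finset.sum_congr rfl fun k _ => ?_
    rw [hw, Finset.mul_sum]
    refine Finset.sum_congr rfl fun i _ => ?_
    simp only [d, evalMap]
    ring
  refine eq_zero_of_sum_divDiff_pow_eq_zero y c fun m => ?_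
  rw [hform]
  refine sum_iteratedDeriv_pow_eq_zero d _ _ hatom ?_ ?_ m
  · filter_upwards [hFy] with ξ hξ
    rw [← hform]
    simp only [F] at hξ
    nlinarith [sq_nonneg (∑ k, c k * divDiff (fun t => Real.cos (ξ * t)) (initPoints y k)),
      sq_nonneg (∑ k, c k * divDiff (fun t => Real.sin (ξ * t)) (initPoints y k))]
  · filter_upwards [hFy] with ξ hξ
    rw [← hform]
    simp only [F] at hξ
    nlinarith [sq_nonneg (∑ k, c k * divDiff (fun t => Real.cos (ξ * t)) (initPoints y k)),
      sq_nonneg (∑ k, c k * divDiff (fun t => Real.sin (ξ * t)) (initPoints y k))]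

end Nondegeneracy

/-! ### Regression of Gaussian vectors -/

/-- The matrix of the mixed second moments of two random vectors. -/
noncomputable def momentMatrix {Ω ι κ : Type*} [MeasurableSpace Ω] (P : Measure Ω)
    (X : Ω → ι → ℝ) (Y : Ω → κ → ℝ) : Matrix ι κ ℝ :=
  Matrix.of fun i j => ∫ ω, X ω i * Y ω j ∂P

/-- The residual of the linear regression of `W` on `X`. -/
noncomputable def residual {Ω ι κ : Type*} [MeasurableSpace Ω] [Fintype ι] [DecidableEq ι]
    (P : Measure Ω) (X : Ω → ι → ℝ) (W : Ω → κ → ℝ) (ω : Ω) (j : κ) : ℝ :=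
  W ω j - ∑ i, (momentMatrix P W X * (momentMatrix P X X)⁻¹) j i * X ω i

theorem momentMatrix_transpose {Ω ι κ : Type*} [MeasurableSpace Ω] {P : Measure Ω}
    (U : Ω → ι → ℝ) (V : Ω → κ → ℝ) : (momentMatrix P U V).transpose = momentMatrix P V U := by
  ext i j
  simp [momentMatrix, mul_comm]

section Regression

variable {Ω : Type*} [MeasurableSpace Ω] {P : Measure Ω} [IsProbabilityMeasure P]
  {f : ℝ → Ω → ℝ} (hf : IsStationaryCenteredGaussian f P)
  {ι κ : Type*} [Fintype ι] [DecidableEq ι] [Fintype κ]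
include hf

theorem varDet_eq_det_momentMatrix {X : Ω → ι → ℝ}
    (hX : ∀ i, (fun ω => X ω i) ∈ gaussianSpace f P) :
    varDet P X = (momentMatrix P X X).det := by
  unfold varDet momentMatrix
  congr 1
  ext i j
  exact gaussianSpace_covariance hf (hX i) (hX j)

omit [DecidableEq ι] in
theorem momentMatrix_mul_left {κ' : Type*} {X : Ω → ι → ℝ} {Y : Ω → κ' → ℝ}
    (hX : ∀ i, (fun ω => X ω i) ∈ gaussianSpace f P)
    (hY : ∀ i, (fun ω => Y ω i) ∈ gaussianSpace f P) {κ'' : Type*} (T : Matrix κ'' ι ℝ) :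
    momentMatrix P (fun ω => T.mulVec (X ω)) Y = T * momentMatrix P X Y := by
  ext i j
  simp only [momentMatrix, Matrix.of_apply, Matrix.mul_apply, Matrix.mulVec, dotProduct,
    Finset.sum_mul, mul_assoc]
  rw [integral_finsetSum _ fun k _ => (gaussianSpace_integrable_mul hf (hX k) (hY j)).const_mul _]
  simp only [integral_const_mul]

omit [DecidableEq ι] in
theorem momentMatrix_mul_right {κ' : Type*} {X : Ω → ι → ℝ} {Y : Ω → κ' → ℝ}
    (hX : ∀ i, (fun ω => X ω i) ∈ gaussianSpace f P)
    (hY : ∀ i, (fun ω => Y ω i) ∈ gaussianSpace f P) {κ'' : Type*} (T : Matrix κ'' ι ℝ) :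
    momentMatrix P Y (fun ω => T.mulVec (X ω)) = momentMatrix P Y X * T.transpose := by
  have h := congrArg Matrix.transpose (momentMatrix_mul_left hf hX hY T)
  rw [Matrix.transpose_mul] at h
  rwa [momentMatrix_transpose, momentMatrix_transpose] at h

omit hf [IsProbabilityMeasure P] [DecidableEq ι] in
theorem mulVec_mem_gaussianSpace {X : Ω → ι → ℝ}
    (hX : ∀ i, (fun ω => X ω i) ∈ gaussianSpace f P) {κ' : Type*} (T : Matrix κ' ι ℝ) (j : κ') :
    (fun ω => T.mulVec (X ω) j) ∈ gaussianSpace f P :=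
  sum_mul_mem_gaussianSpace hX fun i => T j i

theorem varDet_mulVec {X : Ω → ι → ℝ} (hX : ∀ i, (fun ω => X ω i) ∈ gaussianSpace f P)
    (T : Matrix ι ι ℝ) : varDet P (fun ω => T.mulVec (X ω)) = T.det ^ 2 * varDet P X := by
  rw [varDet_eq_det_momentMatrix hf hX,
    varDet_eq_det_momentMatrix hf (mulVec_mem_gaussianSpace hX T),
    momentMatrix_mul_left hf hX (mulVec_mem_gaussianSpace hX T),
    momentMatrix_mul_right hf hX hX, Matrix.det_mul, Matrix.det_mul, Matrix.det_transpose]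
  ring

omit [DecidableEq ι] in
theorem dotProduct_momentMatrix_mulVec {X : Ω → ι → ℝ}
    (hX : ∀ i, (fun ω => X ω i) ∈ gaussianSpace f P) (v : ι → ℝ) :
    v ⬝ᵥ (momentMatrix P X X).mulVec v = ∫ ω, (∑ i, v i * X ω i) ^ 2 ∂P := by
  simp only [sq, Finset.sum_mul_sum]
  have hint : ∀ i j, Integrable (fun ω => v i * X ω i * (v j * X ω j)) P := fun i j =>
    gaussianSpace_integrable_mul hf (Submodule.smul_mem _ (v i) (hX i))
      (Submodule.smul_mem _ (v j) (hX j))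
  rw [integral_finsetSum _ fun i _ => integrable_finsetSum _ fun j _ => hint i j]
  simp only [dotProduct, Matrix.mulVec, momentMatrix, Matrix.of_apply, Finset.mul_sum]
  refine Finset.sum_congr rfl fun i _ => ?_
  rw [integral_finsetSum _ fun j _ => hint i j]
  refine Finset.sum_congr rfl fun j _ => ?_
  rw [mul_comm _ (v j), ← mul_assoc, ← integral_const_mul]
  refine integral_congr_ae (Eventually.of_forall fun ω => ?_)
  simp only
  ring

omit [DecidableEq ι] in
theorem momentMatrix_posSemidef {X : Ω → ι → ℝ}
    (hX : ∀ i, (fun ω => X ω i) ∈ gaussianSpace f P) : (momentMatrix P X X).PosSemidef := by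
  refine Matrix.PosSemidef.of_dotProduct_mulVec_nonneg ?_ fun v => ?_
  · ext i j
    simp [momentMatrix, mul_comm]
  · rw [star_trivial, dotProduct_momentMatrix_mulVec hf hX]
    exact integral_nonneg fun ω => sq_nonneg _

theorem varDet_nonneg {X : Ω → ι → ℝ} (hX : ∀ i, (fun ω => X ω i) ∈ gaussianSpace f P) :
    0 ≤ varDet P X := by
  rw [varDet_eq_det_momentMatrix hf hX]
  exact (momentMatrix_posSemidef hf hX).det_nonneg

/-- A kernel vector of the covariance matrix is a linear combination with zero variance. -/
theorem varDet_ne_zero {X : Ω → ι → ℝ} (hX : ∀ i, (fun ω => X ω i) ∈ gaussianSpace f P)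
    (h : ∀ c : ι → ℝ, ∫ ω, (∑ i, c i * X ω i) ^ 2 ∂P = 0 → c = 0) : varDet P X ≠ 0 := by
  rw [varDet_eq_det_momentMatrix hf hX]
  intro hdet
  obtain ⟨v, hv, hv0⟩ := Matrix.exists_mulVec_eq_zero_iff.2 hdet
  refine hv (h v ?_)
  rw [← dotProduct_momentMatrix_mulVec hf hX, hv0, dotProduct_zero]

/-- The law of a non-degenerate Gaussian vector has full support. -/
theorem isOpenPosMeasure_map {X : Ω → ι → ℝ} (hX : ∀ i, (fun ω => X ω i) ∈ gaussianSpace f P)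
    (hdet : varDet P X ≠ 0) : (P.map X).IsOpenPosMeasure := by
  rw [varDet_eq_det_momentMatrix hf hX] at hdet
  have hA : (momentMatrix P X X).IsHermitian := (momentMatrix_posSemidef hf hX).1
  -- In an orthonormal eigenbasis of the covariance the coordinates are uncorrelated, hence
  -- independent, and each is a non-degenerate Gaussian. The product law charges every open set, and
  -- the surjective map `U` carries this back to X.
  set U : Matrix ι ι ℝ := (hA.eigenvectorUnitary : Matrix ι ι ℝ) with hU
  have hUU : U * star U = 1 := Unitary.mul_star_self_of_mem hA.eigenvectorUnitary.2
  have hdiag : star U * momentMatrix P X X * U = Matrix.diagonal hA.eigenvalues := by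
    have := hA.conjStarAlgAut_star_eigenvectorUnitary
    rw [Unitary.conjStarAlgAut_star_apply] at this
    exact this
  set Y : Ω → ι → ℝ := fun ω => (star U).mulVec (X ω) with hY
  have hYmem : ∀ i, (fun ω => Y ω i) ∈ gaussianSpace f P := mulVec_mem_gaussianSpace hX _
  have hYcov : momentMatrix P Y Y = Matrix.diagonal hA.eigenvalues := by
    rw [hY, momentMatrix_mul_left hf hX (mulVec_mem_gaussianSpace hX _),
      momentMatrix_mul_right hf hX hX, ← hdiag, ← mul_assoc]
    congr 1
  have hev : ∀ i, hA.eigenvalues i ≠ 0 := by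
    intro i hi
    apply hdet
    rw [hA.det_eq_prod_eigenvalues]
    exact Finset.prod_eq_zero (Finset.mem_univ i) (by simp [hi])
  have hindep : iIndepFun (fun i ω => Y ω i) P := by
    have hlaw : HasGaussianLaw (fun ω i => Y ω i) P :=
      (gaussianSpace_hasGaussianLaw_prod hf hYmem hYmem).fst
    refine HasGaussianLaw.iIndepFun_of_covariance_eq_zero (X := fun i ω => Y ω i) hlaw
      fun i j hij => ?_
    rw [gaussianSpace_covariance hf (hYmem i) (hYmem j)]
    have := congrFun (congrFun hYcov i) j
    rwa [Matrix.diagonal_apply_ne _ hij] at this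
  have hYm : ∀ i, AEMeasurable (fun ω => Y ω i) P := fun i =>
    gaussianSpace_aemeasurable hf (hYmem i)
  have hmapY := (iIndepFun_iff_map_fun_eq_pi_map hYm).1 hindep
  have hopen : ∀ i, (P.map fun ω => Y ω i).IsOpenPosMeasure := by
    intro i
    obtain ⟨v, hv⟩ := exists_map_eq_gaussianReal hf (hYmem i)
    have hv0 : v ≠ 0 := by
      rintro rfl
      have h1 := integral_sq_of_map_eq_gaussianReal hv
      have h2 := congrFun (congrFun hYcov i) i
      rw [Matrix.diagonal_apply_eq] at h2
      have h3 : momentMatrix P Y Y i i = ∫ ω, Y ω i ^ 2 ∂P := by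
        simp only [momentMatrix, Matrix.of_apply, ← sq]
      exact hev i (h2.symm.trans (h3.trans (h1.trans (by simp))))
    rw [hv]
    exact (gaussianReal_absolutelyContinuous' 0 hv0).isOpenPosMeasure
  have hprob : ∀ i, IsProbabilityMeasure (P.map fun ω => Y ω i) := fun i =>
    Measure.isProbabilityMeasure_map (hYm i)
  have hYopen : (P.map Y).IsOpenPosMeasure := by
    change (P.map fun ω i => Y ω i).IsOpenPosMeasure
    rw [hmapY]
    infer_instance
  have hXY : X = (fun y => U.mulVec y) ∘ Y := by
    funext ω
    simp only [Function.comp_apply, hY, Matrix.mulVec_mulVec, hUU, Matrix.one_mulVec]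
  have hcont : Continuous fun y : ι → ℝ => U.mulVec y :=
    Continuous.matrix_mulVec continuous_const continuous_id
  rw [hXY, ← AEMeasurable.map_map_of_aemeasurable hcont.aemeasurable
    (aemeasurable_pi_lambda _ hYm)]
  refine hcont.isOpenPosMeasure_map fun x => ⟨(star U).mulVec x, ?_⟩
  simp only [Matrix.mulVec_mulVec, hUU, Matrix.one_mulVec]

omit hf [IsProbabilityMeasure P] [Fintype ι] [DecidableEq ι] in
theorem prod_abs_le_norm_pow (w : κ → ℝ) : ∏ j, |w j| ≤ ‖w‖ ^ Fintype.card κ := by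
  refine (Finset.prod_le_prod (fun j _ => abs_nonneg _) fun j _ => norm_le_pi_norm w j).trans_eq ?_
  simp

theorem integrable_prod_abs {W : Ω → κ → ℝ} (hW : ∀ j, (fun ω => W ω j) ∈ gaussianSpace f P) :
    Integrable (fun ω => ∏ j, |W ω j|) P := by
  have hlaw : HasGaussianLaw (fun ω j => W ω j) P :=
    (gaussianSpace_hasGaussianLaw_prod hf hW hW).fst
  have h1 : Integrable (fun ω => ‖W ω‖ ^ Fintype.card κ) P :=
    (hlaw.memLp (p := (Fintype.card κ : ENNReal)) (by simp)).integrable_norm_pow'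
  refine h1.mono' ?_ (Eventually.of_forall fun ω => ?_)
  · have := fun j => (gaussianSpace_aemeasurable hf (hW j))
    exact (Finset.aemeasurable_fun_prod _ fun j _ => (this j).abs).aestronglyMeasurable
  · rw [Real.norm_of_nonneg (Finset.prod_nonneg fun j _ => abs_nonneg _)]
    exact prod_abs_le_norm_pow _

omit [DecidableEq ι] in
/-- The continuous version of the conditional expectation of `∏ |W_j|` given `X`, for a Gaussian
vector `(X, W)`. -/
theorem isContCondExp_prod_abs {X : Ω → ι → ℝ} {W : Ω → κ → ℝ}
    (hX : ∀ i, (fun ω => X ω i) ∈ gaussianSpace f P)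
    (hW : ∀ j, (fun ω => W ω j) ∈ gaussianSpace f P) (B : Matrix κ ι ℝ)
    (hB : ∀ j i, ∫ ω, (W ω j - B.mulVec (X ω) j) * X ω i ∂P = 0) :
    IsContCondExp P X (fun ω => ∏ j, |W ω j|)
      fun u => ∫ ω, ∏ j, |W ω j - B.mulVec (X ω) j + B.mulVec u j| ∂P := by
  -- The residual is uncorrelated with X, hence independent of it by joint Gaussianity, so
  -- conditioning on X = u amounts to integrating over `R` alone. Only orthogonality of the residual
  -- is used here, not the formula for `B`.
  set R : Ω → κ → ℝ := fun ω j => W ω j - B.mulVec (X ω) j with hR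
  have hRmem : ∀ j, (fun ω => R ω j) ∈ gaussianSpace f P := fun j =>
    sub_mem (hW j) (mulVec_mem_gaussianSpace hX B j)
  have hXR : HasGaussianLaw (fun ω => (fun i => X ω i, fun j => R ω j)) P :=
    gaussianSpace_hasGaussianLaw_prod hf hX hRmem
  have hindep : IndepFun X R P := by
    refine HasGaussianLaw.indepFun_of_covariance_eval (X := fun i ω => X ω i)
      (Y := fun j ω => R ω j) hXR fun i j => ?_
    rw [gaussianSpace_covariance hf (hX i) (hRmem j)]
    simpa only [mul_comm] using hB j i
  have hXm : AEMeasurable X P :=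
    aemeasurable_pi_lambda _ fun i => gaussianSpace_aemeasurable hf (hX i)
  have hRm : AEMeasurable R P :=
    aemeasurable_pi_lambda _ fun i => gaussianSpace_aemeasurable hf (hRmem i)
  have hmap := (indepFun_iff_map_prod_eq_prod_map_map hXm hRm).1 hindep
  have hBc : Continuous fun u : ι → ℝ => B.mulVec u :=
    Continuous.matrix_mulVec continuous_const continuous_id
  set φ : (ι → ℝ) × (κ → ℝ) → ℝ := fun p => ∏ j, |p.2 j + B.mulVec p.1 j| with hφ
  have hφc : Continuous φ := by
    refine continuous_finsetProd _ fun j _ => ?_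
    exact (((continuous_apply j).comp continuous_snd).add
      ((continuous_apply j).comp (hBc.comp continuous_fst))).abs
  have hZ : ∀ ω, ∏ j, |W ω j| = φ (X ω, R ω) := by
    intro ω
    simp [hφ, hR]
  have hZint := integrable_prod_abs hf hW
  have hφint : Integrable φ ((P.map X).prod (P.map R)) := by
    rw [← hmap, integrable_map_measure hφc.aestronglyMeasurable (hXm.prodMk hRm)]
    exact hZint.congr (Eventually.of_forall hZ)
  have : IsProbabilityMeasure (P.map X) := Measure.isProbabilityMeasure_map hXm
  have : IsProbabilityMeasure (P.map R) := Measure.isProbabilityMeasure_map hRm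
  have hg : ∀ u, ∫ ω, ∏ j, |W ω j - B.mulVec (X ω) j + B.mulVec u j| ∂P
      = ∫ r, φ (u, r) ∂(P.map R) := by
    intro u
    exact (integral_map hRm
      (hφc.comp (Continuous.prodMk_right u)).aestronglyMeasurable).symm
  refine ⟨hXm, hZint, ?_, ?_, ?_⟩
  · rw [continuous_iff_continuousAt]
    intro u₀
    have hev : ∀ᶠ u in 𝓝 u₀, ‖B.mulVec u‖ < ‖B.mulVec u₀‖ + 1 :=
      (hBc.norm.tendsto u₀).eventually (gt_mem_nhds (lt_add_one _))
    refine continuousAt_of_dominated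
      (bound := fun ω => ‖(‖R ω‖ + (‖B.mulVec u₀‖ + 1) : ℝ)‖ ^ Fintype.card κ) ?_ ?_ ?_ ?_
    · refine Eventually.of_forall fun u => ?_
      exact ((hφc.comp (Continuous.prodMk_right u)).comp_aestronglyMeasurable
        hRm.aestronglyMeasurable)
    · filter_upwards [hev] with u hu
      refine Eventually.of_forall fun ω => ?_
      rw [Real.norm_of_nonneg (Finset.prod_nonneg fun j _ => abs_nonneg _)]
      refine (prod_abs_le_norm_pow (fun j => R ω j + B.mulVec u j)).trans ?_
      gcongr
      refine le_trans ?_ (le_abs_self _)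
      exact (norm_add_le (R ω) (B.mulVec u)).trans (by gcongr)
    · refine MemLp.integrable_norm_pow' (p := Fintype.card κ) ?_
      have hlaw : HasGaussianLaw R P := hXR.snd
      exact (hlaw.memLp (by simp)).norm.add (memLp_const _)
    · refine Eventually.of_forall fun ω => Continuous.continuousAt ?_
      exact hφc.comp (Continuous.prodMk_left (R ω))
  · simp only [hg]
    exact hφint.integral_prod_left
  · intro s hs
    simp only [hg, hZ]
    have h1 := setIntegral_prod (s := s) (t := Set.univ) φ hφint.integrableOn
    rw [← hmap, setIntegral_map (hs.prod MeasurableSet.univ) hφc.aestronglyMeasurable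
      (hXm.prodMk hRm)] at h1
    simp only [Measure.restrict_univ] at h1
    rw [← h1]
    congr 2
    ext ω
    simp

/-- The conditional expectation of `∏ |W_j|` given `X = 0` is the expectation of the product of the
residuals. -/
theorem condExpZero_prod_abs {X : Ω → ι → ℝ} {W : Ω → κ → ℝ}
    (hX : ∀ i, (fun ω => X ω i) ∈ gaussianSpace f P)
    (hW : ∀ j, (fun ω => W ω j) ∈ gaussianSpace f P) (hdet : varDet P X ≠ 0) (B : Matrix κ ι ℝ)
    (hB : ∀ j i, ∫ ω, (W ω j - B.mulVec (X ω) j) * X ω i ∂P = 0) :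
    (∃! g, IsContCondExp P X (fun ω => ∏ j, |W ω j|) g) ∧
      condExpZero P X (fun ω => ∏ j, |W ω j|) = ∫ ω, ∏ j, |W ω j - B.mulVec (X ω) j| ∂P := by
  have h := isContCondExp_prod_abs hf hX hW B hB
  have hopen := isOpenPosMeasure_map hf hX hdet
  -- Two versions agree almost everywhere for a law charging all open sets, hence everywhere by
  -- continuity; the choice in `condExpZero` is then immaterial.
  have huniq : ∀ g g', IsContCondExp P X (fun ω => ∏ j, |W ω j|) g →
      IsContCondExp P X (fun ω => ∏ j, |W ω j|) g' → g = g' := by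
    intro g g' hg hg'
    refine (Continuous.ae_eq_iff_eq (P.map X) hg.continuous hg'.continuous).1 ?_
    refine Integrable.ae_eq_of_forall_setIntegral_eq _ _ hg.integrable_map hg'.integrable_map ?_
    intro s hs _
    rw [← hg.setIntegral_eq s hs, hg'.setIntegral_eq s hs]
  refine ⟨⟨_, h, fun g hg => huniq _ _ hg h⟩, ?_⟩
  have hex : ∃ g, IsContCondExp P X (fun ω => ∏ j, |W ω j|) g := ⟨_, h⟩
  rw [condExpZero, dif_pos hex, huniq _ _ hex.choose_spec h]
  simp [Matrix.mulVec_zero]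

omit [Fintype κ] in
-- The normal equations of least squares.
theorem integral_residual_mul {X : Ω → ι → ℝ} {W : Ω → κ → ℝ}
    (hX : ∀ i, (fun ω => X ω i) ∈ gaussianSpace f P)
    (hW : ∀ j, (fun ω => W ω j) ∈ gaussianSpace f P) (hdet : varDet P X ≠ 0) (j : κ) (i : ι) :
    ∫ ω, (W ω j - (momentMatrix P W X * (momentMatrix P X X)⁻¹).mulVec (X ω) j) * X ω i ∂P
      = 0 := by
  rw [varDet_eq_det_momentMatrix hf hX] at hdet
  set B := momentMatrix P W X * (momentMatrix P X X)⁻¹ with hB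
  simp only [sub_mul]
  rw [integral_sub (gaussianSpace_integrable_mul hf (hW j) (hX i))
    (gaussianSpace_integrable_mul hf (mulVec_mem_gaussianSpace hX B j) (hX i))]
  have h1 := congrFun (congrFun (momentMatrix_mul_left hf hX hX B) j) i
  have h2 : B * momentMatrix P X X = momentMatrix P W X := by
    rw [hB, Matrix.mul_assoc, Matrix.nonsing_inv_mul _ (Ne.isUnit hdet), Matrix.mul_one]
  rw [h2] at h1
  exact sub_eq_zero.2 h1.symm

theorem condExpZero_prod_abs_eq_residual {X : Ω → ι → ℝ} {W : Ω → κ → ℝ}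
    (hX : ∀ i, (fun ω => X ω i) ∈ gaussianSpace f P)
    (hW : ∀ j, (fun ω => W ω j) ∈ gaussianSpace f P) (hdet : varDet P X ≠ 0) :
    condExpZero P X (fun ω => ∏ j, |W ω j|) = ∫ ω, ∏ j, |residual P X W ω j| ∂P :=
  (condExpZero_prod_abs hf hX hW hdet _ (integral_residual_mul hf hX hW hdet)).2

omit hf [IsProbabilityMeasure P] [Fintype κ] in
theorem residual_mem_gaussianSpace {X : Ω → ι → ℝ} {W : Ω → κ → ℝ}
    (hX : ∀ i, (fun ω => X ω i) ∈ gaussianSpace f P)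
    (hW : ∀ j, (fun ω => W ω j) ∈ gaussianSpace f P) (j : κ) :
    (fun ω => residual P X W ω j) ∈ gaussianSpace f P :=
  sub_mem (hW j) (sum_mul_mem_gaussianSpace hX _)

/-- Changing the conditioning vector by an invertible linear map, and the conditioned variables by
factors and linear combinations of the conditioning ones. -/
theorem condExpZero_prod_abs_mulVec {X X' : Ω → ι → ℝ} {W W' : Ω → κ → ℝ}
    (hX : ∀ i, (fun ω => X ω i) ∈ gaussianSpace f P)
    (hW : ∀ j, (fun ω => W ω j) ∈ gaussianSpace f P) (hdet : varDet P X ≠ 0)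
    (T : Matrix ι ι ℝ) (hT : T.det ≠ 0) (hX' : ∀ ω, X' ω = T.mulVec (X ω))
    (a : κ → ℝ) (β : Matrix κ ι ℝ) (hW' : ∀ ω j, W' ω j = a j * (W ω j - β.mulVec (X ω) j)) :
    condExpZero P X' (fun ω => ∏ j, |W' ω j|)
      = (∏ j, |a j|) * condExpZero P X (fun ω => ∏ j, |W ω j|) := by
  classical
  obtain rfl : X' = fun ω => T.mulVec (X ω) := funext hX'
  have hXm := mulVec_mem_gaussianSpace hX T
  have hW'm : ∀ j, (fun ω => W' ω j) ∈ gaussianSpace f P := by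
    intro j
    simp only [hW']
    exact Submodule.smul_mem _ (a j) (sub_mem (hW j) (mulVec_mem_gaussianSpace hX β j))
  have hdet' : varDet P (fun ω => T.mulVec (X ω)) ≠ 0 := by
    rw [varDet_mulVec hf hX]
    exact mul_ne_zero (pow_ne_zero _ hT) hdet
  set B := momentMatrix P W X * (momentMatrix P X X)⁻¹ with hB
  have hTi : T⁻¹ * T = 1 := Matrix.nonsing_inv_mul _ (Ne.isUnit hT)
  -- The regression matrix of the new variables on the new vector, guessed so that the new residual
  -- is a_j times the old one: the combination β is absorbed by the regression, and T is undone.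
  have key : ∀ ω j, W' ω j - (Matrix.diagonal a * (B - β) * T⁻¹).mulVec (T.mulVec (X ω)) j
      = a j * (W ω j - B.mulVec (X ω) j) := by
    intro ω j
    rw [Matrix.mulVec_mulVec, Matrix.mul_assoc, hTi, Matrix.mul_one, ← Matrix.mulVec_mulVec,
      Matrix.mulVec_diagonal, Matrix.sub_mulVec, hW', Pi.sub_apply]
    ring
  rw [(condExpZero_prod_abs hf hXm hW'm hdet' (Matrix.diagonal a * (B - β) * T⁻¹) ?_).2,
    (condExpZero_prod_abs hf hX hW hdet B (integral_residual_mul hf hX hW hdet)).2,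
    ← integral_const_mul]
  · refine integral_congr_ae (Eventually.of_forall fun ω => ?_)
    simp only [key, abs_mul, Finset.prod_mul_distrib]
  · intro j i
    simp only [key]
    have h0 : ∀ k, ∫ ω, a j * T i k * ((W ω j - B.mulVec (X ω) j) * X ω k) ∂P = 0 := by
      intro k
      rw [integral_const_mul, integral_residual_mul hf hX hW hdet, mul_zero]
    have h1 : ∀ ω, a j * (W ω j - B.mulVec (X ω) j) * T.mulVec (X ω) i
        = ∑ k, a j * T i k * ((W ω j - B.mulVec (X ω) j) * X ω k) := by
      intro ω
      generalize W ω j - B.mulVec (X ω) j = r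
      simp only [Matrix.mulVec, dotProduct, Finset.mul_sum]
      exact Finset.sum_congr rfl fun k _ => by ring
    have h2 : ∀ k, Integrable (fun ω => a j * T i k * ((W ω j - B.mulVec (X ω) j) * X ω k)) P :=
      fun k => (gaussianSpace_integrable_mul hf
        (sub_mem (hW j) (mulVec_mem_gaussianSpace hX B j)) (hX k)).const_mul _
    simp only [h1]
    exact (integral_finsetSum _ fun k _ => h2 k).trans (Finset.sum_eq_zero fun k _ => h0 k)

end Regression

/-! ### Continuity of Gaussian expectations -/

/-- By scaling, absolute moments of a centered Gaussian are controlled by its variance alone, with a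
constant independent of the variable. -/
theorem exists_integral_abs_pow_eq (n : ℕ) :
    ∃ m : ℝ, ∀ {Ω : Type*} [MeasurableSpace Ω] {P : Measure Ω} {Y : Ω → ℝ} {v : NNReal},
      P.map Y = gaussianReal 0 v → ∫ ω, |Y ω| ^ n ∂P = √v ^ n * m := by
  refine ⟨∫ x, |x| ^ n ∂(gaussianReal 0 1), fun {Ω _ P Y v} h => ?_⟩
  have hc : Continuous fun x : ℝ => |x| ^ n := by fun_prop
  have h1 := integral_map (f := fun x : ℝ => |x| ^ n) (aemeasurable_of_map_eq_gaussianReal h)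
    hc.aestronglyMeasurable
  have h2 : gaussianReal 0 v = (gaussianReal 0 1).map (√(v : ℝ) * ·) := by
    rw [gaussianReal_map_const_mul]
    congr 1
    · simp
    · ext
      simp
  rw [← h1, h, h2, integral_map (by fun_prop) hc.aestronglyMeasurable, ← integral_const_mul]
  simp only [abs_mul, mul_pow, abs_of_nonneg (Real.sqrt_nonneg _)]

theorem abs_prod_abs_sub_le {κ : Type*} (s : Finset κ) {a b : κ → ℝ} {B D : ℝ}
    (hb : ∀ j, |b j| ≤ B) (hab : ∀ j, |a j - b j| ≤ D) (hB : 0 ≤ B) (hD : 0 ≤ D) :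
    |(∏ j ∈ s, |a j|) - (∏ j ∈ s, |b j|)| ≤ (B + D) ^ s.card - B ^ s.card := by
  classical
  induction s using Finset.induction_on with
  | empty => simp
  | insert j s hj ih =>
    rw [Finset.prod_insert hj, Finset.prod_insert hj, Finset.card_insert_of_notMem hj]
    have ha : |a j| ≤ B + D := by
      have := abs_add_le (b j) (a j - b j)
      rw [add_sub_cancel] at this
      exact this.trans (add_le_add (hb j) (hab j))
    have hp : ∏ i ∈ s, |b i| ≤ B ^ s.card :=
      (Finset.prod_le_prod (fun _ _ => abs_nonneg _) fun i _ => hb i).trans_eq (by simp)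
    have hp0 : 0 ≤ ∏ i ∈ s, |b i| := Finset.prod_nonneg fun _ _ => abs_nonneg _
    have h1 : |a j| * ∏ i ∈ s, |a i| - |b j| * ∏ i ∈ s, |b i|
        = |a j| * (∏ i ∈ s, |a i| - ∏ i ∈ s, |b i|) + (|a j| - |b j|) * ∏ i ∈ s, |b i| := by ring
    rw [h1]
    refine (abs_add_le _ _).trans ?_
    rw [abs_mul, abs_mul, abs_abs, abs_of_nonneg hp0]
    have h2 : |(|a j| - |b j|)| ≤ D := (abs_abs_sub_abs_le_abs_sub _ _).trans (hab j)
    calc _ ≤ (B + D) * ((B + D) ^ s.card - B ^ s.card) + D * B ^ s.card := by gcongr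
      _ = _ := by ring

/-- Separate the cases ‖a - b‖ ≤ ε‖b‖ and ‖a - b‖ ≥ ε‖b‖. The bound has no mixed term, so after
integration only pure moments appear and no Hölder inequality is needed. -/
theorem abs_prod_abs_sub_le_of_pos {κ : Type*} [Fintype κ] (a b : κ → ℝ) {ε : ℝ} (hε : 0 < ε) :
    |(∏ j, |a j|) - (∏ j, |b j|)|
      ≤ ((1 + ε) ^ Fintype.card κ - 1) * ‖b‖ ^ Fintype.card κ
        + (1 + ε⁻¹) ^ Fintype.card κ * ‖a - b‖ ^ Fintype.card κ := by
  have h := abs_prod_abs_sub_le Finset.univ (a := a) (b := b) (norm_le_pi_norm b)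
    (norm_le_pi_norm (a - b)) (norm_nonneg _) (norm_nonneg _)
  refine h.trans ?_
  rw [Finset.card_univ, sub_mul, one_mul, ← mul_pow, ← mul_pow]
  have hb := norm_nonneg b
  have hd := norm_nonneg (a - b)
  have : (‖b‖ + ‖a - b‖) ^ Fintype.card κ
      ≤ ((1 + ε) * ‖b‖) ^ Fintype.card κ + ((1 + ε⁻¹) * ‖a - b‖) ^ Fintype.card κ := by
    rcases le_total ‖a - b‖ (ε * ‖b‖) with h1 | h1
    · refine le_add_of_le_of_nonneg (pow_le_pow_left₀ (by positivity) (by linarith) _)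
        (by positivity)
    · refine le_add_of_nonneg_of_le (by positivity) (pow_le_pow_left₀ (by positivity) ?_ _)
      have : ‖b‖ ≤ ε⁻¹ * ‖a - b‖ := by
        rw [inv_mul_eq_div, le_div_iff₀ hε]
        linarith
      linarith
  linarith

/-! ### Limits of moments and of conditional expectations. -/

section

variable {Ω : Type*} [MeasurableSpace Ω] {P : Measure Ω} [IsProbabilityMeasure P]
  {f : ℝ → Ω → ℝ} (hf : IsStationaryCenteredGaussian f P)
  {ι κ : Type*} [Fintype ι] [DecidableEq ι] [Fintype κ]
include hf

omit [DecidableEq ι] [Fintype ι] in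
theorem integrable_norm_pow_of_mem_gaussianSpace {W : Ω → κ → ℝ}
    (hW : ∀ j, (fun ω => W ω j) ∈ gaussianSpace f P) (n : ℕ) :
    Integrable (fun ω => ‖W ω‖ ^ n) P := by
  have hlaw : HasGaussianLaw (fun ω j => W ω j) P :=
    (gaussianSpace_hasGaussianLaw_prod hf hW hW).fst
  exact (hlaw.memLp (p := (n : ENNReal)) (by simp)).integrable_norm_pow'

/-- The differences are Gaussian with variances tending to 0, and their moments follow; the sup norm
is bounded by the sum over the coordinates. -/
theorem tendsto_integral_norm_sub_pow [Nonempty κ] {Z : ℕ → Ω → κ → ℝ} {Y : Ω → κ → ℝ}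
    (hZ : ∀ k j, (fun ω => Z k ω j) ∈ gaussianSpace f P)
    (hY : ∀ j, (fun ω => Y ω j) ∈ gaussianSpace f P)
    (hlim : ∀ j, ∀ᵐ ω ∂P, Tendsto (fun k => Z k ω j) atTop (𝓝 (Y ω j))) {n : ℕ} (hn : n ≠ 0) :
    Tendsto (fun k => ∫ ω, ‖Z k ω - Y ω‖ ^ n ∂P) atTop (𝓝 0) := by
  obtain ⟨m, hm⟩ := exists_integral_abs_pow_eq.{_} n
  have hD : ∀ k j, (fun ω => Z k ω j - Y ω j) ∈ gaussianSpace f P := fun k j =>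
    sub_mem (hZ k j) (hY j)
  choose v hv using fun k j => exists_map_eq_gaussianReal hf (hD k j)
  have hint : ∀ k j, Integrable (fun ω => |Z k ω j - Y ω j| ^ n) P := fun k j =>
    ((gaussianSpace_hasGaussianLaw hf (hD k j)).memLp
      (p := (n : ENNReal)) (by simp)).integrable_norm_pow'
  have hle : ∀ k, ∫ ω, ‖Z k ω - Y ω‖ ^ n ∂P ≤ ∑ j, √(v k j) ^ n * m := by
    intro k
    simp only [← hm (hv k _)]
    rw [← integral_finsetSum _ fun j _ => hint k j]
    refine integral_mono (integrable_norm_pow_of_mem_gaussianSpace hf (W := fun ω => Z k ω - Y ω)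
      (hD k) n) (integrable_finsetSum _ fun j _ => hint k j) fun ω => ?_
    obtain ⟨j, hj⟩ := Finite.exists_max fun j => ‖(Z k ω - Y ω) j‖
    have h1 : ‖Z k ω - Y ω‖ ≤ |Z k ω j - Y ω j| := (pi_norm_le_iff_of_nonneg (abs_nonneg _)).2 hj
    refine (pow_le_pow_left₀ (norm_nonneg _) h1 n).trans ?_
    exact Finset.single_le_sum (f := fun j => |Z k ω j - Y ω j| ^ n) (fun i _ => by positivity)
      (Finset.mem_univ j)
  have hv0 : ∀ j, Tendsto (fun k => (v k j : ℝ)) atTop (𝓝 0) := by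
    intro j
    have h1 := gaussianSpace_tendsto_integral_sq hf (Z := fun k ω => Z k ω j - Y ω j)
      (Y := fun _ => 0) (fun k => hD k j) ?_
    · simpa only [integral_sq_of_map_eq_gaussianReal (hv _ j), ne_eq, OfNat.ofNat_ne_zero,
        not_false_eq_true, zero_pow, integral_zero] using h1
    · filter_upwards [hlim j] with ω hω
      simpa using hω.sub_const (Y ω j)
  have hbound : Tendsto (fun k => ∑ j, √(v k j) ^ n * m) atTop (𝓝 0) := by
    have : (0 : ℝ) = ∑ j : κ, √0 ^ n * m := by simp [hn]
    rw [this]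
    exact tendsto_finsetSum _ fun j _ =>
      (((Real.continuous_sqrt.tendsto 0).comp (hv0 j)).pow n).mul_const m
  exact squeeze_zero (fun k => integral_nonneg fun ω => by positivity) hle hbound

theorem tendsto_integral_prod_abs [Nonempty κ] {Z : ℕ → Ω → κ → ℝ} {Y : Ω → κ → ℝ}
    (hZ : ∀ k j, (fun ω => Z k ω j) ∈ gaussianSpace f P)
    (hY : ∀ j, (fun ω => Y ω j) ∈ gaussianSpace f P)
    (hlim : ∀ j, ∀ᵐ ω ∂P, Tendsto (fun k => Z k ω j) atTop (𝓝 (Y ω j))) :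
    Tendsto (fun k => ∫ ω, ∏ j, |Z k ω j| ∂P) atTop (𝓝 (∫ ω, ∏ j, |Y ω j| ∂P)) := by
  set n := Fintype.card κ with hn
  set C := ∫ ω, ‖Y ω‖ ^ n ∂P with hC
  have h0 := tendsto_integral_norm_sub_pow hf hZ hY hlim (n := n) Fintype.card_ne_zero
  have hYint := integrable_norm_pow_of_mem_gaussianSpace hf hY n
  have hDint : ∀ k, Integrable (fun ω => ‖Z k ω - Y ω‖ ^ n) P := fun k =>
    integrable_norm_pow_of_mem_gaussianSpace hf (W := fun ω => Z k ω - Y ω)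
      (fun j => sub_mem (hZ k j) (hY j)) n
  have hle : ∀ ε : ℝ, 0 < ε → ∀ k, |∫ ω, ∏ j, |Z k ω j| ∂P - ∫ ω, ∏ j, |Y ω j| ∂P|
      ≤ ((1 + ε) ^ n - 1) * C + (1 + ε⁻¹) ^ n * ∫ ω, ‖Z k ω - Y ω‖ ^ n ∂P := by
    intro ε hε k
    rw [← integral_sub (integrable_prod_abs hf (hZ k)) (integrable_prod_abs hf hY), hC,
      ← integral_const_mul, ← integral_const_mul,
      ← integral_add (hYint.const_mul _) ((hDint k).const_mul _)]
    refine (abs_integral_le_integral_abs).trans (integral_mono ?_ ?_ fun ω => ?_)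
    · exact ((integrable_prod_abs hf (hZ k)).sub (integrable_prod_abs hf hY)).abs
    · exact (hYint.const_mul _).add ((hDint k).const_mul _)
    · exact abs_prod_abs_sub_le_of_pos (Z k ω) (Y ω) hε
  rw [Metric.tendsto_atTop]
  intro δ hδ
  have hε : ∀ᶠ ε in 𝓝[>] (0 : ℝ), ((1 + ε) ^ n - 1) * C < δ / 2 := by
    have hc : Continuous fun ε : ℝ => ((1 + ε) ^ n - 1) * C := by fun_prop
    refine (hc.tendsto 0).mono_left nhdsWithin_le_nhds |>.eventually (gt_mem_nhds ?_)
    simpa using hδ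
  obtain ⟨ε, hε1, hε0⟩ := (hε.and self_mem_nhdsWithin).exists
  have h1 : Tendsto (fun k => (1 + ε⁻¹) ^ n * ∫ ω, ‖Z k ω - Y ω‖ ^ n ∂P) atTop (𝓝 0) := by
    simpa using h0.const_mul ((1 + ε⁻¹) ^ n)
  obtain ⟨N, hN⟩ := eventually_atTop.1 (h1.eventually (gt_mem_nhds (half_pos hδ)))
  refine ⟨N, fun k hk => ?_⟩
  rw [Real.dist_eq]
  have h2 := hle ε hε0 k
  have h3 := hN k hk
  linarith

omit [Fintype ι] [DecidableEq ι] [Fintype κ] in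
theorem tendsto_momentMatrix {X : ℕ → Ω → ι → ℝ} {X₀ : Ω → ι → ℝ} {W : ℕ → Ω → κ → ℝ}
    {W₀ : Ω → κ → ℝ}
    (hX : ∀ k i, (fun ω => X k ω i) ∈ gaussianSpace f P)
    (hX₀ : ∀ i, (fun ω => X₀ ω i) ∈ gaussianSpace f P)
    (hW : ∀ k j, (fun ω => W k ω j) ∈ gaussianSpace f P)
    (hW₀ : ∀ j, (fun ω => W₀ ω j) ∈ gaussianSpace f P)
    (hlim : ∀ i, ∀ᵐ ω ∂P, Tendsto (fun k => X k ω i) atTop (𝓝 (X₀ ω i)))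
    (hlim' : ∀ j, ∀ᵐ ω ∂P, Tendsto (fun k => W k ω j) atTop (𝓝 (W₀ ω j))) :
    Tendsto (fun k => momentMatrix P (W k) (X k)) atTop (𝓝 (momentMatrix P W₀ X₀)) := by
  refine tendsto_pi_nhds.2 fun j => tendsto_pi_nhds.2 fun i => ?_
  exact gaussianSpace_tendsto_integral_mul hf (fun k => hW k j) (fun k => hX k i) (hW₀ j) (hX₀ i)
    (hlim' j) (hlim i)

theorem tendsto_varDet {X : ℕ → Ω → ι → ℝ} {X₀ : Ω → ι → ℝ}
    (hX : ∀ k i, (fun ω => X k ω i) ∈ gaussianSpace f P)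
    (hX₀ : ∀ i, (fun ω => X₀ ω i) ∈ gaussianSpace f P)
    (hlim : ∀ i, ∀ᵐ ω ∂P, Tendsto (fun k => X k ω i) atTop (𝓝 (X₀ ω i))) :
    Tendsto (fun k => varDet P (X k)) atTop (𝓝 (varDet P X₀)) := by
  simp only [varDet_eq_det_momentMatrix hf (hX _), varDet_eq_det_momentMatrix hf hX₀]
  exact ((continuous_id.matrix_det).tendsto _).comp
    (tendsto_momentMatrix hf hX hX₀ hX hX₀ hlim hlim)

/-- Through the residual formula, the conditioning disappears: regression coefficients are
continuous in the covariance while it is invertible, so the residuals converge almost surely within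
the Gaussian space. -/
theorem tendsto_condExpZero_prod_abs [Nonempty κ] {X : ℕ → Ω → ι → ℝ} {X₀ : Ω → ι → ℝ}
    {W : ℕ → Ω → κ → ℝ} {W₀ : Ω → κ → ℝ}
    (hX : ∀ k i, (fun ω => X k ω i) ∈ gaussianSpace f P)
    (hX₀ : ∀ i, (fun ω => X₀ ω i) ∈ gaussianSpace f P)
    (hW : ∀ k j, (fun ω => W k ω j) ∈ gaussianSpace f P)
    (hW₀ : ∀ j, (fun ω => W₀ ω j) ∈ gaussianSpace f P)
    (hlim : ∀ i, ∀ᵐ ω ∂P, Tendsto (fun k => X k ω i) atTop (𝓝 (X₀ ω i)))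
    (hlim' : ∀ j, ∀ᵐ ω ∂P, Tendsto (fun k => W k ω j) atTop (𝓝 (W₀ ω j)))
    (hdet : ∀ k, varDet P (X k) ≠ 0) (hdet₀ : varDet P X₀ ≠ 0) :
    Tendsto (fun k => condExpZero P (X k) fun ω => ∏ j, |W k ω j|) atTop
      (𝓝 (condExpZero P X₀ fun ω => ∏ j, |W₀ ω j|)) := by
  simp only [condExpZero_prod_abs_eq_residual hf (hX _) (hW _) (hdet _),
    condExpZero_prod_abs_eq_residual hf hX₀ hW₀ hdet₀]
  refine tendsto_integral_prod_abs hf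
    (fun k j => residual_mem_gaussianSpace (hX k) (hW k) j)
    (fun j => residual_mem_gaussianSpace hX₀ hW₀ j) fun j => ?_
  have hinv : Tendsto (fun k => (momentMatrix P (X k) (X k))⁻¹) atTop
      (𝓝 (momentMatrix P X₀ X₀)⁻¹) := by
    have h1 := tendsto_momentMatrix hf hX hX₀ hX hX₀ hlim hlim
    have h2 := tendsto_varDet hf hX hX₀ hlim
    simp only [varDet_eq_det_momentMatrix hf (hX _), varDet_eq_det_momentMatrix hf hX₀] at h2 hdet₀
    simp only [Matrix.inv_def, Ring.inverse_eq_inv']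
    exact (h2.inv₀ hdet₀).smul (((continuous_id.matrix_adjugate).tendsto _).comp h1)
  have hB : Tendsto (fun k => momentMatrix P (W k) (X k) * (momentMatrix P (X k) (X k))⁻¹) atTop
      (𝓝 (momentMatrix P W₀ X₀ * (momentMatrix P X₀ X₀)⁻¹)) := by
    have h1 := tendsto_momentMatrix hf hX hX₀ hW hW₀ hlim hlim'
    exact ((continuous_fst.matrix_mul continuous_snd).tendsto
      (momentMatrix P W₀ X₀, (momentMatrix P X₀ X₀)⁻¹)).comp (h1.prodMk_nhds hinv)
  filter_upwards [ae_all_iff.2 hlim, hlim' j] with ω h1 h2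
  refine h2.sub (tendsto_finsetSum _ fun i _ => Tendsto.mul ?_ (h1 i))
  exact tendsto_pi_nhds.1 (tendsto_pi_nhds.1 hB j) i

end

/-! ### Divided differences on finite sets of points -/

section Enum

variable {A : Type*} {n : ℕ} (e : A ≃ Fin n)

theorem enum_injective (S : Finset A) : Function.Injective (enum e S) := fun i j h => by
  have h1 := e.symm.injective h
  exact (Finset.orderEmbOfFin _ _).injective h1

theorem enum_mem (S : Finset A) (j : Fin S.card) : enum e S j ∈ S := by
  have h := Finset.orderEmbOfFin_mem (S.map e.toEmbedding) (Finset.card_map _) j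
  obtain ⟨a, ha, h1⟩ := Finset.mem_map.1 h
  rw [enum, ← h1]
  simpa using ha

theorem exists_enum_eq {S : Finset A} {a : A} (ha : a ∈ S) : ∃ j, enum e S j = a := by
  have h : e a ∈ Set.range ((S.map e.toEmbedding).orderEmbOfFin (Finset.card_map _)) := by
    rw [Finset.range_orderEmbOfFin]
    simpa using ha
  obtain ⟨j, hj⟩ := h
  exact ⟨j, by rw [enum, hj, Equiv.symm_apply_apply]⟩

theorem map_enum (S : Finset A) :
    Finset.univ.map ⟨enum e S, enum_injective e S⟩ = S := by
  ext a
  simp only [Finset.mem_map, Finset.mem_univ, Function.Embedding.coeFn_mk, true_and]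
  exact ⟨fun ⟨j, hj⟩ => hj ▸ enum_mem e S j, exists_enum_eq e⟩

variable [DecidableEq A]

theorem map_enum_erase (S : Finset A) (j : Fin S.card) :
    (Finset.univ.erase j).map ⟨enum e S, enum_injective e S⟩ = S.erase (enum e S j) := by
  rw [Finset.map_erase, map_enum]
  rfl

/-- The right-hand side involves the set S only, so for distinct points the ordering plays no role.
-/
theorem divDiff_enum {x : A → ℝ} (hx : Function.Injective x) (S : Finset A) (g : ℝ → ℝ) :
    divDiff g (fun j => x (enum e S j))
      = ∑ b ∈ S, (∏ c ∈ S.erase b, (x b - x c))⁻¹ * g (x b) := by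
  rw [divDiff_of_injective (x := fun j => x (enum e S j)) (hx.comp (enum_injective e S))]
  conv_rhs => rw [← map_enum e S, Finset.sum_map]
  refine Finset.sum_congr rfl fun j _ => ?_
  rw [map_enum]
  simp only [Function.Embedding.coeFn_mk]
  rw [← map_enum_erase, Finset.prod_map, div_eq_inv_mul]
  rfl

end Enum

/-- The divided difference with one repeated node. -/
theorem exists_divDiff_snoc_eq {m : ℕ} {y : Fin m → ℝ} (hy : Function.Injective y) (i : Fin m) :
    ∃ β : Fin m → ℝ, ∀ g : ℝ → ℝ, divDiff g (Fin.snoc y (y i) : Fin (m + 1) → ℝ)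
      = (∏ j ∈ Finset.univ.erase i, (y i - y j))⁻¹ * (deriv g (y i) - ∑ j, β j * g (y j)) := by
  obtain ⟨w, hw⟩ := exists_divDiff_eq_sum (Fin.snoc y (y i) : Fin (m + 1) → ℝ)
  have hc : ∀ j : Fin m, priorCount (Fin.snoc y (y i) : Fin (m + 1) → ℝ) j.castSucc = 0 := by
    intro j
    rw [priorCount, Finset.card_eq_zero, Finset.filter_eq_empty_iff]
    rintro l - ⟨h1, h2⟩
    obtain ⟨l, rfl⟩ := Fin.eq_castSucc_of_ne_last (h1.trans_le (Fin.le_last _)).ne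
    rw [Fin.snoc_castSucc, Fin.snoc_castSucc] at h2
    exact h1.ne (congrArg _ (hy h2))
  have hl : priorCount (Fin.snoc y (y i) : Fin (m + 1) → ℝ) (Fin.last m) = 1 := by
    rw [priorCount, Finset.card_eq_one]
    refine ⟨i.castSucc, ?_⟩
    ext l
    simp only [Finset.mem_filter, Finset.mem_univ, true_and, Finset.mem_singleton, Fin.snoc_last]
    constructor
    · rintro ⟨h1, h2⟩
      obtain ⟨l, rfl⟩ := Fin.eq_castSucc_of_ne_last h1.ne
      rw [Fin.snoc_castSucc] at h2
      rw [hy h2]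
    · rintro rfl
      exact ⟨Fin.castSucc_lt_last i, by rw [Fin.snoc_castSucc]⟩
  have hev : ∀ g : ℝ → ℝ, divDiff g (Fin.snoc y (y i) : Fin (m + 1) → ℝ)
      = ∑ j, w j.castSucc * g (y j) + w (Fin.last m) * deriv g (y i) := by
    intro g
    rw [hw, Fin.sum_univ_castSucc]
    simp only [evalMap, hc, hl, Fin.snoc_castSucc, Fin.snoc_last, iteratedDeriv_zero,
      iteratedDeriv_one, Nat.factorial_zero, Nat.factorial_one, Nat.cast_one, div_one]
  -- The nodal polynomial isolates the weight of the derivative: it vanishes at the nodes, its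
  -- divided difference is its leading coefficient 1, and its derivative at y_i is the product of
  -- the y_i - y_j.
  set Q : Polynomial ℝ := ∏ j, (Polynomial.X - Polynomial.C (y j)) with hQ
  have hmonic : Q.Monic := Polynomial.monic_prod_X_sub_C y Finset.univ
  have hdeg : Q.natDegree = m := by
    rw [hQ, Polynomial.natDegree_prod_of_monic _ _ fun j _ => Polynomial.monic_X_sub_C _]
    simp
  have hU : ∏ j ∈ Finset.univ.erase i, (y i - y j) ≠ 0 :=
    Finset.prod_ne_zero_iff.2 fun j hj =>
      sub_ne_zero.2 fun h => (Finset.ne_of_mem_erase hj) (hy h.symm)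
  have h1 : w (Fin.last m) * ∏ j ∈ Finset.univ.erase i, (y i - y j) = 1 := by
    have h2 := hev fun t => Q.eval t
    have h3 : ∀ j, Q.eval (y j) = 0 := fun j => by
      rw [hQ, Polynomial.eval_prod]
      exact Finset.prod_eq_zero (Finset.mem_univ j) (by simp)
    have h4 : deriv (fun t => Q.eval t) (y i) = ∏ j ∈ Finset.univ.erase i, (y i - y j) := by
      rw [Polynomial.deriv]
      exact (Lagrange.eval_nodal_derivative_eval_node_eq (Finset.mem_univ i)).trans
        Lagrange.eval_nodal
    have h5 : divDiff (fun t => Q.eval t) (Fin.snoc y (y i) : Fin (m + 1) → ℝ) = 1 := by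
      rw [divDiff, hermite_polynomial]
      · have := hmonic.coeff_natDegree
        rwa [hdeg] at this
      · refine (Polynomial.degree_le_natDegree).trans_lt ?_
        rw [hdeg]
        exact_mod_cast m.lt_succ_self
    rw [h5, h4] at h2
    simpa [h3] using h2.symm
  have hwl : w (Fin.last m) = (∏ j ∈ Finset.univ.erase i, (y i - y j))⁻¹ :=
    eq_inv_of_mul_eq_one_left h1
  refine ⟨fun j => -(∏ j ∈ Finset.univ.erase i, (y i - y j)) * w j.castSucc, fun g => ?_⟩
  rw [hev, hwl, mul_sub, Finset.mul_sum, sub_eq_neg_add, ← Finset.sum_neg_distrib]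
  congr 1
  refine Finset.sum_congr rfl fun j _ => ?_
  field_simp

theorem exists_divDiff_enum_snoc_eq {A : Type*} [Fintype A] [DecidableEq A] {n : ℕ}
    (e : A ≃ Fin n) {x : A → ℝ} (hx : Function.Injective x) {S : Finset A} {a : A} (ha : a ∈ S) :
    ∃ β : A → ℝ, ∀ g : ℝ → ℝ,
      divDiff g (Fin.snoc (α := fun _ => ℝ) (fun j => x (enum e S j)) (x a))
        = (∏ c ∈ S.erase a, (x a - x c))⁻¹ * (deriv g (x a) - ∑ b, β b * g (x b)) := by
  obtain ⟨i, rfl⟩ := exists_enum_eq e ha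
  obtain ⟨β, hβ⟩ := exists_divDiff_snoc_eq (y := fun j => x (enum e S j))
    (hx.comp (enum_injective e S)) i
  refine ⟨fun b => ∑ j, if enum e S j = b then β j else 0, fun g => ?_⟩
  refine (hβ g).trans ?_
  rw [← map_enum_erase, Finset.prod_map]
  congr 2
  simp only [Finset.sum_mul]
  rw [Finset.sum_comm]
  refine Finset.sum_congr rfl fun j _ => ?_
  rw [Finset.sum_eq_single (enum e S j)]
  · simp
  · intro b _ hb
    rw [if_neg hb.symm, zero_mul]
  · simp

/-! ### Blocks that are initial segments of the ordering. -/

section Initial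

variable {A : Type*} {n m : ℕ} {e : A ≃ Fin n} {S : Finset A} (hm : m ≤ n)
  (hS : ∀ b, b ∈ S ↔ (e b : ℕ) < m)
include hm hS

theorem card_of_initial : S.card = m := by
  have : S.map e.toEmbedding = Finset.univ.map (Fin.castLEEmb hm) := by
    ext k
    rw [Finset.mem_map_equiv, hS, Equiv.apply_symm_apply]
    simp only [Finset.mem_map, Finset.mem_univ, true_and, Fin.castLEEmb_apply]
    exact ⟨fun h => ⟨⟨k, h⟩, rfl⟩, fun ⟨j, hj⟩ => hj ▸ j.2⟩
  rw [← Finset.card_map e.toEmbedding, this, Finset.card_map, Finset.card_univ, Fintype.card_fin]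

theorem enum_of_initial (hc : S.card = m) (j : Fin S.card) :
    enum e S j = e.symm (Fin.castLE hm (Fin.cast hc j)) := by
  unfold enum
  congr 1
  have h := Finset.orderEmbOfFin_unique (s := S.map e.toEmbedding) (Finset.card_map _)
    (f := fun j => Fin.castLE hm (Fin.cast hc j)) (fun j => ?_) (fun i j hij => hij)
  · exact (congrFun h j).symm
  · refine Finset.mem_map.2 ⟨e.symm (Fin.castLE hm (Fin.cast hc j)), ?_, by simp⟩
    rw [hS, Equiv.apply_symm_apply]
    exact (Fin.cast hc j).2

theorem divDiff_enum_of_initial (x : A → ℝ) (g : ℝ → ℝ) :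
    divDiff g (fun j => x (enum e S j))
      = divDiff g fun j : Fin m => x (e.symm (Fin.castLE hm j)) := by
  have hc := card_of_initial hm hS
  exact divDiff_cast hc g _ _ fun j => congrArg x (enum_of_initial hm hS hc j)

theorem divDiff_snoc_enum_of_initial (x : A → ℝ) (t : ℝ) (g : ℝ → ℝ) :
    divDiff g (Fin.snoc (α := fun _ => ℝ) (fun j => x (enum e S j)) t)
      = divDiff g (Fin.snoc (α := fun _ => ℝ)
          (fun j : Fin m => x (e.symm (Fin.castLE hm j))) t) := by
  have hc := card_of_initial hm hS
  refine divDiff_cast (congrArg (· + 1) hc) g _ _ fun j => ?_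
  induction j using Fin.lastCases with
  | last =>
    rw [Fin.snoc_last, show Fin.cast (congrArg (· + 1) hc) (Fin.last S.card) = Fin.last m from
      Fin.ext hc, Fin.snoc_last]
  | cast j =>
    rw [Fin.snoc_castSucc, show Fin.cast (congrArg (· + 1) hc) j.castSucc
      = (Fin.cast hc j).castSucc from rfl, Fin.snoc_castSucc, enum_of_initial hm hS hc j]

end Initial

/-! ### Products over the blocks of a partition -/

section Blocks

variable {A : Type*} [Fintype A] [DecidableEq A]

theorem prod_parts_eq (𝓘 : Finpartition (Finset.univ : Finset A)) (F : Finset A → A → ℝ) :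
    ∏ I ∈ 𝓘.parts, ∏ i ∈ I, F I i = ∏ a, F (𝓘.part a) a := by
  have h : ∏ a ∈ 𝓘.parts.biUnion id, F (𝓘.part a) a
      = ∏ I ∈ 𝓘.parts, ∏ i ∈ I, F (𝓘.part i) i :=
    Finset.prod_biUnion 𝓘.disjoint
  rw [𝓘.biUnion_parts] at h
  rw [h]
  refine Finset.prod_congr rfl fun I hI => Finset.prod_congr rfl fun i hi => ?_
  rw [𝓘.part_eq_of_mem hI hi]

omit [Fintype A] in
theorem prod_offDiag_eq (I : Finset A) (h : A → A → ℝ) :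
    ∏ q ∈ I.offDiag, h q.1 q.2 = ∏ a ∈ I, ∏ c ∈ I.erase a, h a c := by
  rw [Finset.prod_sigma']
  refine Finset.prod_bij' (fun q _ => ⟨q.1, q.2⟩) (fun q _ => (q.1, q.2)) ?_ ?_ ?_ ?_ ?_
  · rintro ⟨a, c⟩ hq
    simp only [Finset.mem_offDiag] at hq
    simp [hq.1, hq.2.1, Ne.symm hq.2.2]
  · rintro ⟨a, c⟩ hq
    simp only [Finset.mem_sigma, Finset.mem_erase] at hq
    simp [hq.1, hq.2.2, Ne.symm hq.2.1]
  · intros; rfl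
  · intros; rfl
  · intros; rfl

/-- Every unordered pair in a block occurs twice on the left, and once in the product being squared.
-/
theorem prod_erase_part_eq_sq {n : ℕ} (e : A ≃ Fin n)
    (𝓘 : Finpartition (Finset.univ : Finset A)) {h : A → A → ℝ} (hsymm : ∀ a b, h a b = h b a) :
    ∏ a, ∏ c ∈ (𝓘.part a).erase a, h a c
      = (∏ a, ∏ c ∈ (𝓘.part a).filter (fun c => e c < e a), h a c) ^ 2 := by
  have hsplit : ∀ a, ∏ c ∈ (𝓘.part a).erase a, h a c
      = (∏ c ∈ (𝓘.part a).filter (fun c => e c < e a), h a c)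
        * ∏ c ∈ (𝓘.part a).filter (fun c => e a < e c), h a c := by
    intro a
    rw [← Finset.prod_filter_mul_prod_filter_not ((𝓘.part a).erase a) (fun c => e c < e a)]
    congr 1
    · refine Finset.prod_congr ?_ fun _ _ => rfl
      ext c
      simp only [Finset.mem_filter, Finset.mem_erase]
      exact ⟨fun h => ⟨h.1.2, h.2⟩, fun h => ⟨⟨fun hc => h.2.ne (by rw [hc]), h.1⟩, h.2⟩⟩
    · refine Finset.prod_congr ?_ fun _ _ => rfl
      ext c
      simp only [Finset.mem_filter, Finset.mem_erase, not_lt]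
      exact ⟨fun h => ⟨h.1.2, lt_of_le_of_ne h.2 fun hc => h.1.1 (e.injective hc).symm⟩,
        fun h => ⟨⟨fun hc => h.2.ne (by rw [hc]), h.1⟩, h.2.le⟩⟩
  have hswap : ∏ a, ∏ c ∈ (𝓘.part a).filter (fun c => e a < e c), h a c
      = ∏ a, ∏ c ∈ (𝓘.part a).filter (fun c => e c < e a), h a c := by
    rw [Finset.prod_comm' (t' := Finset.univ)
      (s' := fun c => (𝓘.part c).filter fun a => e a < e c)]
    · refine Finset.prod_congr rfl fun a _ => Finset.prod_congr rfl fun c _ => ?_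
      exact hsymm _ _
    · intro a c
      simp only [Finset.mem_univ, Finset.mem_filter, true_and, and_true]
      rw [𝓘.mem_part_iff_part_eq_part (Finset.mem_univ _) (Finset.mem_univ _),
        𝓘.mem_part_iff_part_eq_part (Finset.mem_univ _) (Finset.mem_univ _), eq_comm]
  simp only [hsplit]
  rw [Finset.prod_mul_distrib, hswap, sq]

end Blocks

/-! ### Comparison with the classical density -/

/-- The divided difference `[f]_{|I|+1}(x_I, x_a)`, where `I` is the block containing `a`. -/
noncomputable def blockDiff {Ω A : Type*} [Fintype A] [DecidableEq A] {n : ℕ} (f : ℝ → Ω → ℝ)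
    (e : A ≃ Fin n) (𝓘 : Finpartition (Finset.univ : Finset A)) (x : A → ℝ) (ω : Ω) (a : A) : ℝ :=
  divDiff (path f ω) (Fin.snoc (α := fun _ => ℝ) (fun j => x (enum e (𝓘.part a) j)) (x a))

/-- The Kac–Rice density at a family of points indexed by a finite set. -/
noncomputable def classicalDensity {Ω A : Type*} [MeasurableSpace Ω] [Fintype A] [DecidableEq A]
    (f : ℝ → Ω → ℝ) (P : Measure Ω) (x : A → ℝ) : ℝ :=
  condExpZero P (fun ω a => f (x a) ω) (fun ω => ∏ a, |deriv (path f ω) (x a)|)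
    / ((2 * Real.pi) ^ ((Fintype.card A : ℝ) / 2) * √(varDet P fun ω a => f (x a) ω))

/-- The product of the differences `x_a - x_c` over the `c` preceding `a` in its block. -/
noncomputable def blockVandermonde {A : Type*} [Fintype A] [DecidableEq A] {n : ℕ}
    (e : A ≃ Fin n) (𝓘 : Finpartition (Finset.univ : Finset A)) (x : A → ℝ) : ℝ :=
  ∏ a, ∏ c ∈ (𝓘.part a).filter (fun c => e c < e a), (x a - x c)

/-- The matrix of the divided differences `ev_x^𝓘` in terms of the values at the points. -/
noncomputable def evMatrix {A : Type*} [Fintype A] [DecidableEq A] {n : ℕ}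
    (e : A ≃ Fin n) (𝓘 : Finpartition (Finset.univ : Finset A)) (x : A → ℝ) : Matrix A A ℝ :=
  Matrix.of fun a b => if b ∈ (𝓘.part a).filter fun b => e b ≤ e a then
    (∏ c ∈ ((𝓘.part a).filter fun b => e b ≤ e a).erase b, (x b - x c))⁻¹ else 0

/-! ### Algebra of the change of variables. -/

section

variable {A : Type*} [Fintype A] [DecidableEq A] {n : ℕ} (e : A ≃ Fin n)
  (𝓘 : Finpartition (Finset.univ : Finset A))

theorem partProd_eq {Ω : Type*} (f : ℝ → Ω → ℝ) (x : A → ℝ) :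
    partProd f e 𝓘 x = fun ω => ∏ a, |blockDiff f e 𝓘 x ω a| := by
  funext ω
  exact prod_parts_eq 𝓘 fun I i =>
    |divDiff (path f ω) (Fin.snoc (α := fun _ => ℝ) (fun j => x (enum e I j)) (x i))|

theorem evPartition_of_injective {x : A → ℝ} (hx : Function.Injective x) (g : ℝ → ℝ) :
    evPartition e 𝓘 x g = (evMatrix e 𝓘 x).mulVec fun a => g (x a) := by
  funext a
  rw [evPartition, divDiff_enum e hx]
  simp only [Matrix.mulVec, dotProduct, evMatrix, Matrix.of_apply, ite_mul, zero_mul]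
  rw [Finset.sum_ite_mem, Finset.univ_inter]

/-- In the ordering `e` the matrix is lower triangular, since the component at a uses only points up
to a; the diagonal entry is the inverse product of differences with the earlier points of the block.
With 0⁻¹ = 0, no injectivity is needed. -/
theorem det_evMatrix (x : A → ℝ) : (evMatrix e 𝓘 x).det = (blockVandermonde e 𝓘 x)⁻¹ := by
  rw [← Matrix.det_submatrix_equiv_self e.symm, Matrix.det_of_isLowerTriangular]
  · rw [blockVandermonde, ← Finset.prod_inv_distrib]
    refine (Equiv.prod_comp e.symm fun a => evMatrix e 𝓘 x a a).trans ?_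
    refine Finset.prod_congr rfl fun a _ => ?_
    simp only [evMatrix, Matrix.of_apply]
    rw [if_pos (by simp)]
    congr 1
    refine Finset.prod_congr ?_ fun _ _ => rfl
    ext c
    simp only [Finset.mem_erase, Finset.mem_filter]
    exact ⟨fun h => ⟨h.2.1, lt_of_le_of_ne h.2.2 fun hc => h.1 (e.injective hc)⟩,
      fun h => ⟨fun hc => h.2.ne (by rw [hc]), h.1, h.2.le⟩⟩
  · intro i j hij
    simp only [evMatrix, Matrix.submatrix_apply, Matrix.of_apply]
    rw [if_neg]
    simp only [Finset.mem_filter, Equiv.apply_symm_apply, not_and, not_le]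
    exact fun _ => hij

variable {e 𝓘}

theorem blockVandermonde_ne_zero {x : A → ℝ} (hx : Function.Injective x) :
    blockVandermonde e 𝓘 x ≠ 0 := by
  refine Finset.prod_ne_zero_iff.2 fun a _ => Finset.prod_ne_zero_iff.2 fun c hc => ?_
  refine sub_ne_zero.2 fun h => ?_
  exact (Finset.mem_filter.1 hc).2.ne (by rw [hx h])

/-- Ordered pairs are counted, so two square roots combine for each unordered pair. -/
theorem prod_sqrt_eq_abs_blockVandermonde (x : A → ℝ) :
    ∏ I ∈ 𝓘.parts, ∏ q ∈ I.offDiag, √|x q.1 - x q.2| = |blockVandermonde e 𝓘 x| := by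
  simp only [prod_offDiag_eq _ fun a c => √|x a - x c|]
  rw [prod_parts_eq 𝓘 fun I a => ∏ c ∈ I.erase a, √|x a - x c|,
    prod_erase_part_eq_sq e 𝓘 fun a b => by rw [abs_sub_comm], blockVandermonde]
  simp only [Finset.abs_prod, ← Finset.prod_pow]
  exact Finset.prod_congr rfl fun a _ => Finset.prod_congr rfl fun c _ =>
    Real.sq_sqrt (abs_nonneg _)

theorem prod_erase_part_eq_sq_blockVandermonde (x : A → ℝ) :
    ∏ a, |∏ c ∈ (𝓘.part a).erase a, (x a - x c)| = blockVandermonde e 𝓘 x ^ 2 := by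
  simp only [Finset.abs_prod]
  rw [prod_erase_part_eq_sq e 𝓘 fun a b => abs_sub_comm _ _, ← sq_abs (blockVandermonde e 𝓘 x),
    blockVandermonde]
  simp only [Finset.abs_prod]

theorem blockVandermonde_eq_zero_iff {x : A → ℝ} :
    blockVandermonde e 𝓘 x = 0 ↔ ∃ a b, a ≠ b ∧ b ∈ 𝓘.part a ∧ x a = x b := by
  constructor
  · intro h
    obtain ⟨a, -, h⟩ := Finset.prod_eq_zero_iff.1 h
    obtain ⟨c, hc, h⟩ := Finset.prod_eq_zero_iff.1 h
    rw [Finset.mem_filter] at hc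
    exact ⟨a, c, fun h => hc.2.ne (by rw [h]), hc.1, sub_eq_zero.1 h⟩
  · rintro ⟨a, b, hab, hb, hx⟩
    have ha : a ∈ 𝓘.part b := by
      rw [𝓘.mem_part_iff_part_eq_part (Finset.mem_univ _) (Finset.mem_univ _)] at hb ⊢
      exact hb.symm
    rcases lt_or_gt_of_ne (e.injective.ne hab) with h | h
    · exact Finset.prod_eq_zero (Finset.mem_univ b)
        (Finset.prod_eq_zero (Finset.mem_filter.2 ⟨ha, h⟩) (sub_eq_zero.2 hx.symm))
    · exact Finset.prod_eq_zero (Finset.mem_univ a)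
        (Finset.prod_eq_zero (Finset.mem_filter.2 ⟨hb, h⟩) (sub_eq_zero.2 hx))

theorem oneBlock_part [Nonempty A] (a : A) : (oneBlock A).part a = Finset.univ :=
  (oneBlock A).part_eq_of_mem (by simp [oneBlock]) (Finset.mem_univ a)

theorem injective_of_notMem_largeDiagonal {B : Type*} {x : B → ℝ} (hx : x ∉ largeDiagonal B) :
    Function.Injective x := by
  intro a b hab
  by_contra h
  exact hx ⟨a, b, h, hab⟩

theorem blockVandermonde_oneBlock_eq_zero_iff [Nonempty A] {x : A → ℝ} :
    blockVandermonde e (oneBlock A) x = 0 ↔ x ∈ largeDiagonal A := by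
  rw [blockVandermonde_eq_zero_iff]
  simp only [oneBlock_part, Finset.mem_univ, true_and]
  rfl

/-- The Vandermonde product over all pairs factors through the one over the pairs within blocks. -/
theorem blockVandermonde_oneBlock_eq [Nonempty A] (x : A → ℝ) :
    blockVandermonde e (oneBlock A) x = blockVandermonde e 𝓘 x
      * ∏ a, ∏ c ∈ Finset.univ.filter (fun c => e c < e a ∧ c ∉ 𝓘.part a), (x a - x c) := by
  unfold blockVandermonde
  rw [← Finset.prod_mul_distrib]
  refine Finset.prod_congr rfl fun a _ => ?_
  rw [oneBlock_part, ← Finset.prod_filter_mul_prod_filter_not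
    (Finset.univ.filter fun c => e c < e a) (fun c => c ∈ 𝓘.part a)]
  congr 1
  · refine Finset.prod_congr ?_ fun _ _ => rfl
    ext c
    simp [and_comm]
  · refine Finset.prod_congr ?_ fun _ _ => rfl
    ext c
    simp

theorem tendsto_snoc {m : ℕ} {s : ℕ → Fin m → ℝ} {y : Fin m → ℝ} {t : ℕ → ℝ} {u : ℝ}
    (hs : Tendsto s atTop (𝓝 y)) (ht : Tendsto t atTop (𝓝 u)) :
    Tendsto (fun k => (Fin.snoc (α := fun _ => ℝ) (s k) (t k) : Fin (m + 1) → ℝ)) atTop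
      (𝓝 (Fin.snoc (α := fun _ => ℝ) y u)) := by
  rw [tendsto_pi_nhds] at hs ⊢
  intro j
  induction j using Fin.lastCases with
  | last => simpa using ht
  | cast j => simpa using hs j

end

/-! ### Densities of the process: continuity and comparison off the diagonal. -/

section

variable {Ω : Type*} [MeasurableSpace Ω] {P : Measure Ω} {f : ℝ → Ω → ℝ}
  {A : Type*} [Fintype A] [DecidableEq A] {n : ℕ} (hn : IsOfClass n f P) (e : A ≃ Fin n)
  (𝓘 : Finpartition (Finset.univ : Finset A))

include e in
omit [DecidableEq A] in
theorem card_le_of_equiv (S : Finset A) : S.card ≤ n := by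
  have := Finset.card_le_univ S
  rwa [Fintype.card_congr e, Fintype.card_fin] at this

include hn

theorem evPartition_mem_gaussianSpace (x : A → ℝ) (a : A) :
    (fun ω => evPartition e 𝓘 x (path f ω) a) ∈ gaussianSpace f P :=
  divDiff_path_mem_gaussianSpace hn ((card_le_of_equiv e _).trans (Nat.le_succ n)) _

theorem blockDiff_mem_gaussianSpace (x : A → ℝ) (a : A) :
    (fun ω => blockDiff f e 𝓘 x ω a) ∈ gaussianSpace f P :=
  divDiff_path_mem_gaussianSpace hn (Nat.succ_le_succ (card_le_of_equiv e _)) _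

theorem tendsto_evPartition {s : ℕ → A → ℝ} {x : A → ℝ} (hs : Tendsto s atTop (𝓝 x)) (a : A) :
    ∀ᵐ ω ∂P, Tendsto (fun k => evPartition e 𝓘 (s k) (path f ω) a) atTop
      (𝓝 (evPartition e 𝓘 x (path f ω) a)) :=
  tendsto_divDiff_path hn ((card_le_of_equiv e _).trans (Nat.le_succ n))
    (tendsto_pi_nhds.2 fun _ => tendsto_pi_nhds.1 hs _)

theorem tendsto_blockDiff {s : ℕ → A → ℝ} {x : A → ℝ} (hs : Tendsto s atTop (𝓝 x)) (a : A) :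
    ∀ᵐ ω ∂P, Tendsto (fun k => blockDiff f e 𝓘 (s k) ω a) atTop (𝓝 (blockDiff f e 𝓘 x ω a)) :=
  tendsto_divDiff_path hn (Nat.succ_le_succ (card_le_of_equiv e _))
    (tendsto_snoc (tendsto_pi_nhds.2 fun _ => tendsto_pi_nhds.1 hs _) (tendsto_pi_nhds.1 hs a))

variable [IsProbabilityMeasure P] (hf : IsStationaryCenteredGaussian f P)
include hf

theorem partDensityDefined_of_partD_ne_zero {x : A → ℝ} (hD : partD f P e 𝓘 x ≠ 0) :
    PartDensityDefined f P e 𝓘 x := by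
  refine ⟨hD, ?_⟩
  rw [partProd_eq]
  have hX := evPartition_mem_gaussianSpace hn e 𝓘 x
  have hW := blockDiff_mem_gaussianSpace hn e 𝓘 x
  exact (condExpZero_prod_abs hf hX hW hD _ (integral_residual_mul hf hX hW hD)).1

theorem tendsto_partD {s : ℕ → A → ℝ} {x : A → ℝ} (hs : Tendsto s atTop (𝓝 x)) :
    Tendsto (fun k => partD f P e 𝓘 (s k)) atTop (𝓝 (partD f P e 𝓘 x)) :=
  tendsto_varDet hf (fun k => evPartition_mem_gaussianSpace hn e 𝓘 (s k))
    (evPartition_mem_gaussianSpace hn e 𝓘 x) (tendsto_evPartition hn e 𝓘 hs)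

theorem tendsto_partN [Nonempty A] {s : ℕ → A → ℝ} {x : A → ℝ} (hs : Tendsto s atTop (𝓝 x))
    (hD : ∀ x, partD f P e 𝓘 x ≠ 0) :
    Tendsto (fun k => partN f P e 𝓘 (s k)) atTop (𝓝 (partN f P e 𝓘 x)) := by
  simp only [partN, partProd_eq]
  exact tendsto_condExpZero_prod_abs hf (fun k => evPartition_mem_gaussianSpace hn e 𝓘 (s k))
    (evPartition_mem_gaussianSpace hn e 𝓘 x) (fun k => blockDiff_mem_gaussianSpace hn e 𝓘 (s k))
    (blockDiff_mem_gaussianSpace hn e 𝓘 x) (tendsto_evPartition hn e 𝓘 hs)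
    (tendsto_blockDiff hn e 𝓘 hs) (fun k => hD _) (hD x)

theorem continuous_partDensity [Nonempty A] (hD : ∀ x, partD f P e 𝓘 x ≠ 0) :
    Continuous (partDensity f P e 𝓘) := by
  rw [continuous_iff_seqContinuous]
  intro s x hs
  have hpos : 0 < partD f P e 𝓘 x :=
    (varDet_nonneg hf (evPartition_mem_gaussianSpace hn e 𝓘 x)).lt_of_ne' (hD x)
  refine Tendsto.mul ?_ ((tendsto_partN hn e 𝓘 hf hs hD).div
    (((Real.continuous_sqrt.tendsto _).comp (tendsto_partD hn e 𝓘 hf hs)).const_mul _) ?_)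
  · have hc : Continuous fun x : A → ℝ =>
        ∏ I ∈ 𝓘.parts, ∏ q ∈ I.offDiag, √|x q.1 - x q.2| := by fun_prop
    exact (hc.tendsto x).comp hs
  · have := Real.pi_pos
    positivity

omit [IsProbabilityMeasure P] hf in
-- The divided difference at the double node (t, t) is f'(t) up to a multiple of f(t).
theorem deriv_mem_gaussianSpace (h1 : 1 ≤ n) (t : ℝ) :
    (fun ω => deriv (path f ω) t) ∈ gaussianSpace f P := by
  obtain ⟨β, hβ⟩ := exists_divDiff_snoc_eq (y := fun _ : Fin 1 => t)
    (Function.injective_of_subsingleton _) 0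
  have h := divDiff_path_mem_gaussianSpace hn (Nat.succ_le_succ h1)
    (Fin.snoc (fun _ : Fin 1 => t) t : Fin (1 + 1) → ℝ)
  have h2 := add_mem h (Submodule.smul_mem _ (β 0) (mem_gaussianSpace (P := P) (f := f) t))
  convert h2 using 1
  funext ω
  simp [hβ, path]

include e in
omit [IsProbabilityMeasure P] hn hf [DecidableEq A] in
theorem card_pos_of_equiv [Nonempty A] : 1 ≤ n := by
  have h : Fintype.card A = n := (Fintype.card_congr e).trans (Fintype.card_fin n)
  exact h ▸ Fintype.card_pos

omit hn in
theorem partD_of_injective {x : A → ℝ} (hx : Function.Injective x) :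
    partD f P e 𝓘 x = (blockVandermonde e 𝓘 x)⁻¹ ^ 2 * varDet P (fun ω a => f (x a) ω) := by
  rw [← det_evMatrix, ← varDet_mulVec hf fun a => mem_gaussianSpace (x a), partD]
  simp only [evPartition_of_injective e 𝓘 hx]
  rfl

/-- With V the block Vandermonde product, the numerator contributes V⁻², the determinant |V|⁻¹ after
the square root, and the prefactor |V|: the powers cancel. -/
theorem partDensity_of_injective [Nonempty A] {x : A → ℝ} (hx : Function.Injective x)
    (hdet : varDet P (fun ω a => f (x a) ω) ≠ 0) :
    partDensity f P e 𝓘 x = classicalDensity f P x := by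
  have hV := blockVandermonde_ne_zero (e := e) (𝓘 := 𝓘) hx
  choose β hβ using fun a =>
    exists_divDiff_enum_snoc_eq e hx (𝓘.mem_part (Finset.mem_univ a))
  have hN : partN f P e 𝓘 x = (blockVandermonde e 𝓘 x ^ 2)⁻¹
      * condExpZero P (fun ω a => f (x a) ω) (fun ω => ∏ a, |deriv (path f ω) (x a)|) := by
    rw [partN, partProd_eq, condExpZero_prod_abs_mulVec hf (X := fun ω a => f (x a) ω)
      (W := fun ω a => deriv (path f ω) (x a)) (fun a => mem_gaussianSpace (x a))
      (fun a => deriv_mem_gaussianSpace hn (card_pos_of_equiv e) (x a)) hdet (evMatrix e 𝓘 x)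
      (by rw [det_evMatrix]; exact inv_ne_zero hV)
      (fun ω => evPartition_of_injective e 𝓘 hx (path f ω))
      (fun a => (∏ c ∈ (𝓘.part a).erase a, (x a - x c))⁻¹) (Matrix.of β)
      (W' := blockDiff f e 𝓘 x)
      (fun ω a => hβ a (path f ω))]
    congr 1
    rw [← prod_erase_part_eq_sq_blockVandermonde, ← Finset.prod_inv_distrib]
    simp only [abs_inv]
  rw [partDensity, prod_sqrt_eq_abs_blockVandermonde (e := e), hN, partD_of_injective e 𝓘 hf hx,
    Real.sqrt_mul (sq_nonneg _), Real.sqrt_sq_eq_abs, classicalDensity, abs_inv,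
    ← sq_abs (blockVandermonde e 𝓘 x)]
  have hV' : |blockVandermonde e 𝓘 x| ≠ 0 := abs_ne_zero.2 hV
  generalize condExpZero P (fun ω a => f (x a) ω) (fun ω => ∏ a, |deriv (path f ω) (x a)|) = N
  have hc : (2 * Real.pi) ^ ((Fintype.card A : ℝ) / 2) ≠ 0 := by
    have := Real.pi_pos
    positivity
  have hs : √(varDet P fun ω a => f (x a) ω) ≠ 0 :=
    (Real.sqrt_pos.2 ((varDet_nonneg hf fun a => mem_gaussianSpace (x a)).lt_of_ne' hdet)).ne'
  field_simp

variable (hnorm : IsNormalized f P) (hlim : Tendsto (corr f P) atTop (𝓝 0))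

/-- For distinct points both determinants are that of the values divided by squared Vandermonde
products, whose ratio is the cross-block part; being polynomial, that part survives the limit to the
diagonal. -/
theorem partD_eq_mul_partD_oneBlock [Nonempty A] (x : A → ℝ) :
    partD f P e 𝓘 x
      = (∏ a, ∏ c ∈ Finset.univ.filter (fun c => e c < e a ∧ c ∉ 𝓘.part a), (x a - x c)) ^ 2
        * partD f P e (oneBlock A) x := by
  obtain ⟨s, hs, hsx⟩ := exists_seq_injective_tendsto x
  have hc : Continuous fun x : A → ℝ =>
      (∏ a, ∏ c ∈ Finset.univ.filter (fun c => e c < e a ∧ c ∉ 𝓘.part a), (x a - x c)) ^ 2 := by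
    fun_prop
  refine tendsto_nhds_unique (tendsto_partD hn e 𝓘 hf hsx) ?_
  refine Tendsto.congr (fun k => ?_)
    (((hc.tendsto x).comp hsx).mul (tendsto_partD hn e (oneBlock A) hf hsx))
  have h1 := blockVandermonde_ne_zero (e := e) (𝓘 := 𝓘) (hs k)
  have h2 := blockVandermonde_ne_zero (e := e) (𝓘 := oneBlock A) (hs k)
  rw [partD_of_injective e 𝓘 hf (hs k), partD_of_injective e _ hf (hs k)]
  rw [blockVandermonde_oneBlock_eq (𝓘 := 𝓘)] at h2 ⊢
  have h3 := right_ne_zero_of_mul h2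
  simp only [Function.comp_apply]
  field_simp

end

/-! ### Non-degeneracy and vanishing locus for a single block. -/

section

variable {Ω : Type*} [MeasurableSpace Ω] {P : Measure Ω} {f : ℝ → Ω → ℝ}
  [IsProbabilityMeasure P] (hf : IsStationaryCenteredGaussian f P)
include hf

/-- Each residual is Gaussian with positive variance, hence almost surely nonzero, and so is the
product. -/
theorem condExpZero_prod_abs_pos {ι κ : Type*} [Fintype ι] [DecidableEq ι] [Fintype κ]
    {X : Ω → ι → ℝ} {W : Ω → κ → ℝ} (hX : ∀ i, (fun ω => X ω i) ∈ gaussianSpace f P)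
    (hW : ∀ j, (fun ω => W ω j) ∈ gaussianSpace f P) (hdet : varDet P X ≠ 0)
    (h : ∀ j (c : ι → ℝ), ∫ ω, (W ω j - ∑ i, c i * X ω i) ^ 2 ∂P ≠ 0) :
    0 < condExpZero P X fun ω => ∏ j, |W ω j| := by
  rw [condExpZero_prod_abs_eq_residual hf hX hW hdet]
  have hR := fun j => residual_mem_gaussianSpace hX hW j
  have hne : ∀ j, ∀ᵐ ω ∂P, residual P X W ω j ≠ 0 := by
    intro j
    obtain ⟨v, hv⟩ := exists_map_eq_gaussianReal hf (hR j)
    have hv0 : v ≠ 0 := by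
      rintro rfl
      exact h j _ ((integral_sq_of_map_eq_gaussianReal hv).trans (by simp))
    have := nullSingletonClass_gaussianReal (μ := 0) hv0
    have h1 : P.map (fun ω => residual P X W ω j) {0} = 0 := by rw [hv, measure_singleton]
    rw [Measure.map_apply_of_aemeasurable (gaussianSpace_aemeasurable hf (hR j))
      (measurableSet_singleton 0)] at h1
    exact measure_eq_zero_iff_ae_notMem.1 h1
  refine lt_of_le_of_ne (integral_nonneg fun ω => Finset.prod_nonneg fun _ _ => abs_nonneg _) ?_
  intro h0
  have h1 := (integral_eq_zero_iff_of_nonneg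
    (fun ω => Finset.prod_nonneg fun _ _ => abs_nonneg _) (integrable_prod_abs hf hR)).1 h0.symm
  obtain ⟨ω, hω, hω'⟩ := (h1.and (ae_all_iff.2 hne)).exists
  exact Finset.prod_ne_zero_iff.2 (fun j _ => abs_ne_zero.2 (hω' j)) hω

variable (hnorm : IsNormalized f P) (hlim : Tendsto (corr f P) atTop (𝓝 0))
  {A : Type*} [Fintype A] [DecidableEq A] [Nonempty A] {n : ℕ} (hn : IsOfClass n f P)
  (e : A ≃ Fin n)

omit [IsProbabilityMeasure P] [MeasurableSpace Ω] hf in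
theorem evPartition_oneBlock (x : A → ℝ) (g : ℝ → ℝ) (a : A) :
    evPartition e (oneBlock A) x g a = divDiff g (initPoints (fun k => x (e.symm k)) (e a)) :=
  divDiff_enum_of_initial (e a).2 (fun b => by
    rw [oneBlock_part, Finset.mem_filter, Fin.le_def]
    simp) x g

omit [IsProbabilityMeasure P] [MeasurableSpace Ω] hf in
theorem blockDiff_oneBlock (x : A → ℝ) (ω : Ω) (a : A) :
    blockDiff f e (oneBlock A) x ω a
      = divDiff (path f ω) (Fin.snoc (fun k => x (e.symm k)) (x a) : Fin (n + 1) → ℝ) :=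
  divDiff_snoc_enum_of_initial (le_refl n) (fun b => by simp [oneBlock_part]) x (x a) (path f ω)

include hnorm hlim hn

theorem partD_oneBlock_ne_zero (x : A → ℝ) : partD f P e (oneBlock A) x ≠ 0 := by
  refine varDet_ne_zero hf (evPartition_mem_gaussianSpace hn e _ x) fun c hc => ?_
  have h := eq_zero_of_integral_sum_divDiff_sq hf hnorm hlim hn (Nat.le_succ n)
    (fun k => x (e.symm k)) (fun k => c (e.symm k)) ?_
  · funext a
    simpa using congrFun h (e a)
  · rw [← hc]
    congr 1
    funext ω
    congr 1
    rw [← Equiv.sum_comp e]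
    refine Finset.sum_congr rfl fun a _ => ?_
    rw [Equiv.symm_apply_apply, evPartition_oneBlock]

theorem partN_oneBlock_pos (x : A → ℝ) : 0 < partN f P e (oneBlock A) x := by
  rw [partN, partProd_eq]
  refine condExpZero_prod_abs_pos hf (evPartition_mem_gaussianSpace hn e _ x)
    (blockDiff_mem_gaussianSpace hn e _ x) (partD_oneBlock_ne_zero hf hnorm hlim hn e x)
    fun a c hc => ?_
  -- Append x_a as an extra node. The conditioned variable is the last divided difference along `y`
  -- and enters with coefficient 1, so a vanishing residual variance contradicts independence. The n
  -- + 1 nodes are the most that class C^n allows.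
  set y : Fin (n + 1) → ℝ := Fin.snoc (fun k => x (e.symm k)) (x a) with hy
  have h := eq_zero_of_integral_sum_divDiff_sq hf hnorm hlim hn (le_refl (n + 1)) y
    (Fin.snoc (fun k => -c (e.symm k)) 1) ?_
  · simpa using congrFun h (Fin.last n)
  · rw [← hc]
    congr 1
    funext ω
    congr 1
    rw [Fin.sum_univ_castSucc, ← Equiv.sum_comp e, add_comm, sub_eq_add_neg,
      ← Finset.sum_neg_distrib]
    congr 1
    · rw [Fin.snoc_last, one_mul, blockDiff_oneBlock]
      rfl
    · refine Finset.sum_congr rfl fun b _ => ?_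
      rw [Fin.snoc_castSucc, Equiv.symm_apply_apply, evPartition_oneBlock, neg_mul]
      congr 3
      funext j
      exact Fin.snoc_castSucc (α := fun _ => ℝ) (x a) (fun k => x (e.symm k))
        (Fin.castLE (e b).2 j)

include e in
theorem varDet_values_ne_zero {x : A → ℝ} (hx : Function.Injective x) :
    varDet P (fun ω a => f (x a) ω) ≠ 0 := by
  have h := partD_oneBlock_ne_zero hf hnorm hlim hn e x
  rw [partD_of_injective e _ hf hx] at h
  exact right_ne_zero_of_mul h

theorem partDensity_oneBlock_eq_zero_iff (x : A → ℝ) :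
    partDensity f P e (oneBlock A) x = 0 ↔ x ∈ largeDiagonal A := by
  have hD := (varDet_nonneg hf (evPartition_mem_gaussianSpace hn e (oneBlock A) x)).lt_of_ne'
    (partD_oneBlock_ne_zero hf hnorm hlim hn e x)
  have hN := partN_oneBlock_pos hf hnorm hlim hn e x
  have hne : partN f P e (oneBlock A) x / ((2 * Real.pi) ^ ((Fintype.card A : ℝ) / 2)
      * √(partD f P e (oneBlock A) x)) ≠ 0 := by
    have h1 := Real.pi_pos
    have h2 : 0 < √(partD f P e (oneBlock A) x) := Real.sqrt_pos.2 hD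
    positivity
  rw [partDensity, prod_sqrt_eq_abs_blockVandermonde (e := e), mul_eq_zero, or_iff_left hne,
    abs_eq_zero, blockVandermonde_oneBlock_eq_zero_iff]

theorem partDensity_oneBlock_eq (x : A → ℝ) (𝓘 : Finpartition (Finset.univ : Finset A))
    (e' : A ≃ Fin n) (hD : partD f P e' 𝓘 x ≠ 0) :
    partDensity f P e (oneBlock A) x = partDensity f P e' 𝓘 x := by
  by_cases hx : x ∈ largeDiagonal A
  · rw [(partDensity_oneBlock_eq_zero_iff hf hnorm hlim hn e x).2 hx]
    have h1 := (blockVandermonde_oneBlock_eq_zero_iff (e := e')).2 hx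
    rw [partD_eq_mul_partD_oneBlock hn e' 𝓘 hf] at hD
    -- Nonvanishing of D_𝓘 rules out coincidences across blocks, so the coincidence lies inside a
    -- block and the prefactor of ρ_𝓘 is 0.
    have h2 := (pow_ne_zero_iff two_ne_zero).1 (left_ne_zero_of_mul hD)
    rw [blockVandermonde_oneBlock_eq (𝓘 := 𝓘), mul_eq_zero, or_iff_left h2] at h1
    rw [partDensity, prod_sqrt_eq_abs_blockVandermonde (e := e'), h1, abs_zero, zero_mul]
  · have hinj := injective_of_notMem_largeDiagonal hx
    have hdet := varDet_values_ne_zero hf hnorm hlim hn e hinj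
    rw [partDensity_of_injective hn e _ hf hinj hdet, partDensity_of_injective hn e' _ hf hinj hdet]

end

/-- A continuous function on `ℝ^A` is determined by its values off the large diagonal. -/
theorem eq_of_eq_off_largeDiagonal {A : Type*} [Finite A] {F G : (A → ℝ) → ℝ} (hF : Continuous F)
    (hG : Continuous G) (h : ∀ x, x ∉ largeDiagonal A → F x = G x) : F = G := by
  funext x
  obtain ⟨s, hs, hsx⟩ := exists_seq_injective_tendsto x
  refine tendsto_nhds_unique ((hF.tendsto x).comp hsx)
    (((hG.tendsto x).comp hsx).congr fun k => (h _ ?_).symm)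
  rintro ⟨a, b, hab, hx⟩
  exact hab (hs k hx)

theorem krD_eq_zero_of_mem {Ω : Type*} [MeasurableSpace Ω] {P : Measure Ω} {f : ℝ → Ω → ℝ} {k : ℕ}
    {x : Fin k → ℝ} (hx : x ∈ largeDiagonal (Fin k)) : krD f P x = 0 := by
  obtain ⟨a, b, hab, hx⟩ := hx
  refine Matrix.det_zero_of_row_eq hab ?_
  funext j
  simp only [Matrix.of_apply, hx]

end KacRice

theorem proposition6p14 {Ω : Type*} [MeasurableSpace Ω] (P : MeasureTheory.Measure Ω)
    [MeasureTheory.IsProbabilityMeasure P] (f : ℝ → Ω → ℝ)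
    (hf : KacRice.IsStationaryCenteredGaussian f P)
    (hnorm : KacRice.IsNormalized f P)
    (hκ : Filter.Tendsto (KacRice.corr f P) Filter.atTop (nhds 0)) :
    -- The densities indexed by the partitions of a finite set `A`; `e`, `e'` are orderings of `A`.
    (∀ (A : Type*) [Fintype A] [DecidableEq A] [Nonempty A],
      KacRice.IsOfClass (Fintype.card A) f P →
      ∀ e : A ≃ Fin (Fintype.card A),
        (∀ x, KacRice.PartDensityDefined f P e (KacRice.oneBlock A) x) ∧
        Continuous (KacRice.partDensity f P e (KacRice.oneBlock A)) ∧
        (∀ (x : A → ℝ) (𝓘 : Finpartition (Finset.univ : Finset A))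
          (e' : A ≃ Fin (Fintype.card A)), KacRice.partD f P e' 𝓘 x ≠ 0 →
            KacRice.PartDensityDefined f P e' 𝓘 x ∧
            KacRice.partDensity f P e (KacRice.oneBlock A) x
              = KacRice.partDensity f P e' 𝓘 x) ∧
        (∀ x, KacRice.partDensity f P e (KacRice.oneBlock A) x = 0
          ↔ x ∈ KacRice.largeDiagonal A)) ∧
    -- The Kac–Rice density `ρ_k`, whose domain is the complement of the large diagonal.
    (∀ k : ℕ, 1 ≤ k → KacRice.IsOfClass k f P →
      (∀ x : Fin k → ℝ, KacRice.krD f P x ≠ 0 ↔ x ∉ KacRice.largeDiagonal (Fin k)) ∧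
      ∃ F : (Fin k → ℝ) → ℝ, Continuous F ∧
        (∀ x, x ∉ KacRice.largeDiagonal (Fin k) → F x = KacRice.krDensity f P x) ∧
        (∀ G : (Fin k → ℝ) → ℝ, Continuous G →
          (∀ x, x ∉ KacRice.largeDiagonal (Fin k) → G x = KacRice.krDensity f P x) → G = F) ∧
        (∀ x, F x = 0 ↔ x ∈ KacRice.largeDiagonal (Fin k)) ∧
        (∀ (x : Fin k → ℝ) (𝓘 : Finpartition (Finset.univ : Finset (Fin k)))
          (e : Fin k ≃ Fin k), KacRice.partD f P e 𝓘 x ≠ 0 →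
            KacRice.PartDensityDefined f P e 𝓘 x ∧
            F x = KacRice.partDensity f P e 𝓘 x)) := by
  refine ⟨fun A _ _ _ hn e => ⟨fun x => ?_, ?_, fun x 𝓘 e' hD => ⟨?_, ?_⟩, fun x => ?_⟩,
    fun k hk hn => ?_⟩
  · exact KacRice.partDensityDefined_of_partD_ne_zero hn e _ hf
      (KacRice.partD_oneBlock_ne_zero hf hnorm hκ hn e x)
  · exact KacRice.continuous_partDensity hn e _ hf
      (KacRice.partD_oneBlock_ne_zero hf hnorm hκ hn e)
  · exact KacRice.partDensityDefined_of_partD_ne_zero hn e' 𝓘 hf hD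
  · exact KacRice.partDensity_oneBlock_eq hf hnorm hκ hn e x 𝓘 e' hD
  · exact KacRice.partDensity_oneBlock_eq_zero_iff hf hnorm hκ hn e x
  have hne : Nonempty (Fin k) := ⟨⟨0, hk⟩⟩
  let e₀ : Fin k ≃ Fin k := Equiv.refl _
  have hkrD : ∀ x : Fin k → ℝ, x ∉ KacRice.largeDiagonal (Fin k) → KacRice.krD f P x ≠ 0 :=
    fun x hx => KacRice.varDet_values_ne_zero hf hnorm hκ hn e₀
      (KacRice.injective_of_notMem_largeDiagonal hx)
  have hF : Continuous (KacRice.partDensity f P e₀ (KacRice.oneBlock (Fin k))) :=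
    KacRice.continuous_partDensity hn e₀ _ hf
      (KacRice.partD_oneBlock_ne_zero hf hnorm hκ hn e₀)
  have hFkr : ∀ x, x ∉ KacRice.largeDiagonal (Fin k) →
      KacRice.partDensity f P e₀ (KacRice.oneBlock (Fin k)) x = KacRice.krDensity f P x := by
    intro x hx
    rw [KacRice.partDensity_of_injective hn e₀ _ hf (KacRice.injective_of_notMem_largeDiagonal hx)
      (hkrD x hx), KacRice.classicalDensity, Fintype.card_fin]
    rfl
  refine ⟨fun x => ⟨fun h hx => h (KacRice.krD_eq_zero_of_mem hx), hkrD x⟩,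
    KacRice.partDensity f P e₀ (KacRice.oneBlock (Fin k)), hF, hFkr, fun G hG hGkr => ?_,
    fun x => ?_, fun x 𝓘 e hD => ⟨?_, ?_⟩⟩
  · exact KacRice.eq_of_eq_off_largeDiagonal hG hF fun x hx => (hGkr x hx).trans (hFkr x hx).symm
  · exact KacRice.partDensity_oneBlock_eq_zero_iff hf hnorm hκ hn e₀ x
  · exact KacRice.partDensityDefined_of_partD_ne_zero hn e 𝓘 hf hD
  · exact KacRice.partDensity_oneBlock_eq hf hnorm hκ hn e₀ x 𝓘 e hD
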